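/- **Notation.** Compositions are nonempty finite words over the positive integers; $M_\emptyset=F_\emptyset=1$. For a composition $\alpha=(\alpha_1,\dots,\alpha_r)$ of $n$ put $D(\alpha)=\{\alpha_1,\alpha_1+\alpha_2,\dots,\alpha_1+\cdots+\alpha_{r-1}\}$ and $P(\alpha)=\{i\in D(\alpha): i\ge 2,\ i-1\notin D(\alpha)\}$, and let $k\cdot\alpha=(k\alpha_1,\dots,k\alpha_r)$. $\mathrm{QSym}\subset\mathbb Z[[x_1,x_2,\dots]]$ is the $\mathbb Z$-span of the monomial quasisymmetric functions $M_\alpha=\sum_{i_1<\cdots<i_r}x_{i_1}^{\alpha_1}\cdots x_{i_r}^{\alpha_r}$ and $1$; it has the basis $F_\alpha=\sum_{D(\alpha)\subseteq D(\beta)}M_\beta$ ($\beta$ running over the compositions of the same $n$), together with $1$. A subset $P\subseteq[2,n-1]$ is a peak subset of $[n-1]$ if $i\in P$ implies $i-1\notin P$, and then $K_P=2^{|P|+1}\sum F_\alpha$, the sum over the compositions $\alpha$ of $n$ with $P\subseteq D(\alpha)\,\triangle\,(D(\alpha)+1)$. $\mathrm{PQSym}$ is the subring of $\mathbb Z[[x_1,x_2,\dots]]$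 generated by all $K_P$ ($n\ge 1$, $P$ a peak subset of $[n-1]$); $\vartheta:\mathrm{QSym}\to\mathrm{PQSym}$ is the additive map with $\vartheta(F_\alpha)=K_{P(\alpha)}$, $\vartheta(1)=1$; and $L_\alpha=\vartheta(M_\alpha)$. $\Gamma$ is the subring of $\mathbb Z[[x_1,x_2,\dots]]$ generated by the $q_n=\sum_{i=0}^n h_ie_{n-i}$, $n\ge 1$, i.e. $\sum_{n\ge0} q_nz^n=\prod_i\frac{1+x_iz}{1-x_iz}$. For a $\lambda$-ring with operations $\lambda^n$ and $\lambda_t(a)=\sum_{n\ge 0}\lambda^n(a)t^n$, the Adams operations $\Psi^n$ are defined by $\frac{d}{dt}\log\lambda_t(a)=\sum_{n\ge0}(-1)^n\Psi^{n+1}(a)t^n$. A composition is odd if all its parts are odd, elementary if the greatest common divisor of its parts is $1$, and Lyndon if it is lexicographically smaller than each of its proper tails. Let $\mathrm{EL}_{od}$ be the set of elementary Lyndon odd compositions. **Corollary 3.9.** There is exactly one $\lambda$-ring structure $(\tilde\lambda^n)_{n\ge0}$ on $\mathrm{PQSym}$ whose Adams operations satisfy, for all odd compositions $\alpha$ and all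 $n\ge1$, $\Phi^n(L_\alpha)=L_{n\cdot\alpha}$ if $n$ is odd and $\Phi^n(L_\alpha)=0$ if $n$ is even. For this structure $\Gamma$ is contained in $\mathrm{PQSym}$ and is a $\lambda$-subring of it. Put $q_n(\alpha)=\tilde\lambda^n(L_\alpha)$ and let $\Gamma_\alpha$ be the subring of $\mathrm{PQSym}$ generated by the $q_n(\alpha)$, $n\ge1$. 1. For every $\alpha\in\mathrm{EL}_{od}$, $\Gamma_\alpha$ is a $\lambda$-subring of $\mathrm{PQSym}$, and there is an isomorphism of $\lambda$-rings $\Gamma_\alpha\cong\Gamma$ with $q_n(\alpha)\mapsto q_n$ for all $n\ge1$. 2. The set $\mathrm{EL}_{od}$ is infinite, and multiplication is a ring isomorphism $\bigotimes_{\alpha\in\mathrm{EL}_{od}}\Gamma_\alpha\cong\mathrm{PQSym}$, $\bigotimes_{\alpha\in s}a_\alpha\mapsto\prod_{\alpha\in s}a_\alpha$ ($s\subset\mathrm{EL}_{od}$ finite). Here the infinite tensor product of rings over $\mathbb Z$ is the direct limit of the tensor products of the finite subfamilies. 3. $q_n((1))=q_n$ for all $n\ge1$, so that $\Gamma_{(1)}=\Gamma$,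 and $\mathrm{PQSym}$ is free as a module over $\Gamma=\Gamma_{(1)}$. -/

import Mathlib

open scoped TensorProduct

noncomputable section

namespace PeakQSym

/-! ## Words and compositions

A word over the positive integers is a `List ℕ+`; a composition of `n` is a word of weight `n`. -/

/-- The weight of a word: the sum of its letters. -/
def wt (w : List ℕ+) : ℕ := (w.map fun a : ℕ+ => (a : ℕ)).sum

/-- A composition in the sense of Mathlib, as a word. -/
def ofComposition {n : ℕ} (c : Composition n) : List ℕ+ :=
  c.blocks.pmap (fun a h => Nat.toPNat a h) fun _ h => c.blocks_pos h

/-- The finite set of all compositions of `n`. -/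
def comps (n : ℕ) : Finset (List ℕ+) :=
  (Finset.univ : Finset (Composition n)).image ofComposition

theorem map_val_ofComposition {n : ℕ} (c : Composition n) :
    (ofComposition c).map (fun a : ℕ+ => (a : ℕ)) = c.blocks := by
  rw [ofComposition, List.map_pmap]
  exact (List.pmap_eq_map _).trans (List.map_id _)

theorem mem_comps {n : ℕ} {w : List ℕ+} : w ∈ comps n ↔ wt w = n := by
  constructor
  · intro h
    obtain ⟨c, -, rfl⟩ := Finset.mem_image.1 h
    rw [wt, map_val_ofComposition, c.blocks_sum]
  · intro h
    refine Finset.mem_image.2 ⟨⟨w.map fun a : ℕ+ => (a : ℕ), ?_, h⟩, Finset.mem_univ _, ?_⟩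
    · intro i hi
      obtain ⟨a, -, rfl⟩ := List.mem_map.1 hi
      exact a.pos
    · apply List.map_injective_iff.2 PNat.coe_injective
      exact map_val_ofComposition _

/-- `k · α`: all the parts of `α` are multiplied by `k`. -/
def scale (k : ℕ+) (w : List ℕ+) : List ℕ+ := w.map fun a => k * a

/-- The descent set `{α₁, α₁ + α₂, …, α₁ + ⋯ + α_{r-1}}` of `α = (α₁, …, α_r)`. -/
def descentSet (w : List ℕ+) : Finset ℕ :=
  (Finset.Ico 1 w.length).image fun i => wt (w.take i)

/-- `P ⊆ [2, n-1]`, and `i ∈ P` implies `i - 1 ∉ P`. -/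
def IsPeakSubset (n : ℕ) (P : Finset ℕ) : Prop :=
  ∀ i ∈ P, 2 ≤ i ∧ i < n ∧ i - 1 ∉ P

/-- The peak set `{i ∈ D(α) : 2 ≤ i, i - 1 ∉ D(α)}` of a composition `α`. -/
def peakSet (w : List ℕ+) : Finset ℕ :=
  (descentSet w).filter fun i => 2 ≤ i ∧ i - 1 ∉ descentSet w

/-- All parts are odd. -/
def IsOdd (w : List ℕ+) : Prop := ∀ a ∈ w, Odd (a : ℕ)

/-- A word is Lyndon if it is lexicographically smaller than each of its proper tails
(`<` on lists is the lexicographic order, in which a proper prefix is smaller). -/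
def IsLyndon (w : List ℕ+) : Prop := ∀ i, 0 < i → i < w.length → w < w.drop i

/-- The greatest common divisor of the parts is `1` (so the empty word is not elementary). -/
def IsElementary (w : List ℕ+) : Prop := (w.map fun a : ℕ+ => (a : ℕ)).foldr Nat.gcd 0 = 1

/-- The elementary Lyndon odd compositions. -/
abbrev ELodd : Type := {w : List ℕ+ // IsLyndon w ∧ IsElementary w ∧ IsOdd w}

/-- The elementary Lyndon odd composition `(1)`. -/
def one1 : ELodd := ⟨[1], by
  refine ⟨?_, by simp [IsElementary], by simp [IsOdd]⟩
  intro i h0 h1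
  simp at h1
  omega⟩

/-! ## Quasisymmetric functions -/

/-- The ring `ℤ⟦x₀, x₁, x₂, …⟧`. -/
abbrev PS : Type := MvPowerSeries ℕ ℤ

/-- The monomial quasisymmetric function
`M_α = ∑_{i₁ < ⋯ < i_r} x_{i₁}^{α₁} ⋯ x_{i_r}^{α_r}`
(each monomial comes from at most one sequence `i₁ < ⋯ < i_r`). -/
def monomialQ (w : List ℕ+) : PS := fun d =>
  open scoped Classical in
  if ∃ i : Fin w.length → ℕ, StrictMono i ∧ d = ∑ k, Finsupp.single (i k) (w.get k : ℕ)
  then 1 else 0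

/-- The fundamental quasisymmetric function `F_α = ∑_{β ≤ α} M_β`, the sum over the compositions
`β` of the same weight that refine `α`, that is, with `D(α) ⊆ D(β)`. -/
def fundamentalQ (w : List ℕ+) : PS :=
  ∑ v ∈ (comps (wt w)).filter (fun v => descentSet w ⊆ descentSet v), monomialQ v

/-- The additive group of quasisymmetric functions over `ℤ`. -/
def QSym : Submodule ℤ PS := Submodule.span ℤ (Set.range monomialQ)

theorem monomialQ_mem (w : List ℕ+) : monomialQ w ∈ QSym :=
  Submodule.subset_span ⟨w, rfl⟩

theorem fundamentalQ_mem (w : List ℕ+) : fundamentalQ w ∈ QSym :=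
  Submodule.sum_mem _ fun v _ => monomialQ_mem v

/-- The exponent vector of `x₀^{α₁} x₁^{α₂} ⋯`. -/
def expo (w : List ℕ+) : ℕ →₀ ℕ := ∑ k : Fin w.length, Finsupp.single (k : ℕ) (w.get k : ℕ)

theorem expo_apply (w : List ℕ+) (j : ℕ) :
    expo w j = if h : j < w.length then (w.get ⟨j, h⟩ : ℕ) else 0 := by
  unfold expo
  rw [Finsupp.finsetSum_apply]
  split_ifs with h
  · rw [Finset.sum_eq_single (⟨j, h⟩ : Fin w.length)]
    · simp
    · intro b _ hb
      have : (b : ℕ) ≠ j := fun e => hb (Fin.ext e)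
      simp [this]
    · simp
  · apply Finset.sum_eq_zero
    intro b _
    have : (b : ℕ) ≠ j := fun e => h (e ▸ b.2)
    simp [this]

theorem coeff_expo_monomialQ (u w : List ℕ+) :
    MvPowerSeries.coeff (expo u) (monomialQ w) = if w = u then 1 else 0 := by
  classical
  change (if _ then _ else _) = _
  congr 1
  refine propext ⟨?_, ?_⟩
  · rintro ⟨i, hi, he⟩
    have key : ∀ j, expo u j = ∑ k, Finsupp.single (i k) (w.get k : ℕ) j := by
      intro j; rw [he, Finsupp.finsetSum_apply]
    have keyi : ∀ k, expo u (i k) = w.get k := by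
      intro k
      rw [key, Finset.sum_eq_single k]
      · simp
      · intro b _ hb
        simp [hi.injective.ne hb]
      · simp
    have hlt : ∀ k, i k < u.length := by
      intro k
      by_contra hk
      have := keyi k
      rw [expo_apply, dif_neg hk] at this
      exact (w.get k).ne_zero this.symm
    have hsurj : ∀ j : Fin u.length, ∃ k, i k = j := by
      intro j
      by_contra hj
      push Not at hj
      have h1 := key j
      rw [expo_apply, dif_pos j.2, Finset.sum_eq_zero] at h1
      · exact (u.get j).ne_zero h1
      · intro b _
        simp [hj b]
    let g : Fin w.length → Fin u.length := fun k => ⟨i k, hlt k⟩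
    have hg : StrictMono g := fun a b h => hi h
    have hgs : Function.Surjective g := fun j => by
      obtain ⟨k, hk⟩ := hsurj j
      exact ⟨k, Fin.ext hk⟩
    have hlen : w.length = u.length := by
      simpa using Fintype.card_of_bijective ⟨hg.injective, hgs⟩
    have hid : ∀ k, i k = k := by
      let e : Fin w.length ≃o Fin u.length :=
        StrictMono.orderIsoOfSurjective g hg hgs
      have : e = Fin.castOrderIso hlen := Subsingleton.elim _ _
      intro k
      have h2 := congrArg (fun f : Fin w.length ≃o Fin u.length => (f k : ℕ)) this
      exact h2
    apply List.ext_get hlen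
    intro n h1 h2
    have := keyi ⟨n, h1⟩
    rw [hid, expo_apply, dif_pos h2] at this
    exact PNat.coe_injective this.symm
  · rintro rfl
    exact ⟨fun k => k, fun a b h => h, rfl⟩

theorem wt_cons (a : ℕ+) (w : List ℕ+) : wt (a :: w) = a + wt w := by simp [wt]

theorem wt_pos_of_ne_nil {w : List ℕ+} (h : w ≠ []) : 0 < wt w := by
  cases w with
  | nil => exact absurd rfl h
  | cons a w => rw [wt_cons]; have := a.pos; omega

theorem mem_descentSet_cons (a : ℕ+) (w : List ℕ+) (j : ℕ) :
    j ∈ descentSet (a :: w) ↔ w ≠ [] ∧ (j = a ∨ ∃ i ∈ descentSet w, j = a + i) := by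
  simp only [descentSet, Finset.mem_image, Finset.mem_Ico, List.length_cons]
  constructor
  · rintro ⟨i, ⟨h1, h2⟩, rfl⟩
    obtain ⟨i, rfl⟩ : ∃ k, i = k + 1 := ⟨i - 1, by omega⟩
    refine ⟨by rintro rfl; simp at h2, ?_⟩
    rcases Nat.eq_zero_or_pos i with rfl | hi
    · left; simp [wt]
    · right
      exact ⟨_, ⟨i, ⟨hi, by omega⟩, rfl⟩, by rw [List.take_succ_cons, wt_cons]⟩
  · rintro ⟨hw, rfl | ⟨_, ⟨i, ⟨h1, h2⟩, rfl⟩, rfl⟩⟩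
    · have := List.length_pos_iff.2 hw
      exact ⟨1, ⟨le_rfl, by omega⟩, by simp [wt]⟩
    · exact ⟨i + 1, ⟨by omega, by omega⟩, by rw [List.take_succ_cons, wt_cons]⟩

theorem descentSet_pos (w : List ℕ+) {j : ℕ} (h : j ∈ descentSet w) : 0 < j := by
  cases w with
  | nil => simp [descentSet] at h
  | cons a w =>
    obtain ⟨-, rfl | ⟨i, -, rfl⟩⟩ := (mem_descentSet_cons a w j).1 h
    · exact a.pos
    · have := a.pos; omega

theorem descentSet_lt (w : List ℕ+) {j : ℕ} (h : j ∈ descentSet w) : j < wt w := by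
  induction w generalizing j with
  | nil => simp [descentSet] at h
  | cons a w ih =>
    rw [wt_cons]
    obtain ⟨hw, rfl | ⟨i, hi, rfl⟩⟩ := (mem_descentSet_cons a w j).1 h
    · have := wt_pos_of_ne_nil hw; omega
    · have := ih hi; omega

theorem descentSet_injective : ∀ {w v : List ℕ+}, wt w = wt v → descentSet w = descentSet v →
    w = v
  | [], v, h, _ => by
    by_contra hv
    have := wt_pos_of_ne_nil (Ne.symm hv)
    rw [← h] at this
    simp [wt] at this
  | a :: w, [], h, _ => by
    have := wt_pos_of_ne_nil (List.cons_ne_nil a w)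
    rw [h] at this
    simp [wt] at this
  | a :: w, b :: v, h, hD => by
    have hm : ∀ j, j ∈ descentSet (a :: w) ↔ j ∈ descentSet (b :: v) := fun j => by rw [hD]
    simp only [mem_descentSet_cons] at hm
    have hwv : w = [] ↔ v = [] := by
      constructor
      · intro hw
        by_contra hv
        exact ((hm b).2 ⟨hv, Or.inl rfl⟩).1 hw
      · intro hv
        by_contra hw
        exact ((hm a).1 ⟨hw, Or.inl rfl⟩).1 hv
    rw [wt_cons, wt_cons] at h
    by_cases hw : w = []
    · have hv := hwv.1 hw
      subst hw hv
      simp only [wt, List.map_nil, List.sum_nil, add_zero] at h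
      rw [PNat.coe_injective h]
    · have hv : v ≠ [] := fun e => hw (hwv.2 e)
      have hab : (a : ℕ) = b := by
        apply le_antisymm
        · rcases ((hm b).2 ⟨hv, Or.inl rfl⟩).2 with e | ⟨i, _, e⟩ <;> omega
        · rcases ((hm a).1 ⟨hw, Or.inl rfl⟩).2 with e | ⟨i, _, e⟩ <;> omega
      have hD' : descentSet w = descentSet v := by
        ext j
        constructor
        · intro hj
          have hp := descentSet_pos w hj
          rcases ((hm (a + j)).1 ⟨hw, Or.inr ⟨j, hj, rfl⟩⟩).2 with e | ⟨i, hi, e⟩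
          · omega
          · have : j = i := by omega
            exact this ▸ hi
        · intro hj
          have hp := descentSet_pos v hj
          rcases ((hm (b + j)).2 ⟨hv, Or.inr ⟨j, hj, rfl⟩⟩).2 with e | ⟨i, hi, e⟩
          · omega
          · have : j = i := by omega
            exact this ▸ hi
      rw [PNat.coe_injective hab, descentSet_injective (by omega) hD']

theorem coeff_expo_fundamentalQ (u w : List ℕ+) :
    MvPowerSeries.coeff (expo u) (fundamentalQ w) =
      if wt u = wt w ∧ descentSet w ⊆ descentSet u then 1 else 0 := by
  classical
  simp only [fundamentalQ, map_sum, coeff_expo_monomialQ]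
  rw [Finset.sum_ite_eq']
  simp [mem_comps]

theorem fundamentalQ_linearIndependent :
    LinearIndependent ℤ fun w => (⟨fundamentalQ w, fundamentalQ_mem w⟩ : QSym) := by
  classical
  rw [linearIndependent_iff]
  intro l hl
  by_contra hne
  obtain ⟨u, hu, hmin⟩ := Finset.exists_min_image l.support (fun w => (descentSet w).card)
    (Finsupp.support_nonempty_iff.2 hne)
  have h1 : ∑ w ∈ l.support, l w * MvPowerSeries.coeff (expo u) (fundamentalQ w) = 0 := by
    have := congrArg (fun f : QSym => MvPowerSeries.coeff (expo u) (f : PS)) hl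
    rw [Finsupp.linearCombination_apply, Finsupp.sum] at this
    simpa only [AddSubmonoidClass.coe_finsetSum, Submodule.coe_smul, map_sum, map_zsmul,
      smul_eq_mul, Submodule.coe_zero, map_zero] using this
  rw [Finset.sum_eq_single u] at h1
  · rw [coeff_expo_fundamentalQ, if_pos ⟨rfl, subset_rfl⟩, mul_one] at h1
    exact Finsupp.mem_support_iff.1 hu h1
  · intro w hw hwu
    rw [coeff_expo_fundamentalQ, if_neg, mul_zero]
    rintro ⟨h2, h3⟩
    exact hwu (descentSet_injective h2.symm (Finset.eq_of_subset_of_card_le h3 (hmin w hw)))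
  · intro h; exact absurd hu h

theorem monomialQ_mem_span_fundamentalQ (w : List ℕ+) :
    monomialQ w ∈ Submodule.span ℤ (Set.range fundamentalQ) := by
  classical
  have hcard : ∀ v : List ℕ+, (descentSet v).card ≤ wt v := fun v => by
    have : descentSet v ⊆ Finset.range (wt v) := fun j hj =>
      Finset.mem_range.2 (descentSet_lt v hj)
    simpa using Finset.card_le_card this
  induction hk : wt w - (descentSet w).card using Nat.strong_induction_on generalizing w with
  | _ k ih =>
    have hw : w ∈ (comps (wt w)).filter (fun v => descentSet w ⊆ descentSet v) := by
      simp [mem_comps]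
    have h1 : monomialQ w = fundamentalQ w -
        ∑ v ∈ ((comps (wt w)).filter (fun v => descentSet w ⊆ descentSet v)).erase w,
          monomialQ v := by
      rw [eq_sub_iff_add_eq, fundamentalQ, Finset.add_sum_erase _ _ hw]
    rw [h1]
    refine Submodule.sub_mem _ (Submodule.subset_span ⟨w, rfl⟩) (Submodule.sum_mem _ ?_)
    intro v hv
    obtain ⟨hvw, hv⟩ := Finset.mem_erase.1 hv
    obtain ⟨hv1, hv2⟩ := Finset.mem_filter.1 hv
    rw [mem_comps] at hv1
    have hlt : (descentSet w).card < (descentSet v).card := by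
      refine Finset.card_lt_card (hv2.ssubset_of_ne fun e => hvw ?_)
      exact descentSet_injective hv1 e.symm
    have := hcard v
    exact ih _ (by omega) v rfl

/-- The basis of `QSym` formed by the fundamental quasisymmetric functions `F_α`. -/
def fundamentalBasis : Module.Basis (List ℕ+) ℤ QSym :=
  Module.Basis.mk fundamentalQ_linearIndependent <| by
    rintro ⟨f, hf⟩ -
    have h1 : QSym ≤ Submodule.map QSym.subtype (Submodule.span ℤ
        (Set.range fun w => (⟨fundamentalQ w, fundamentalQ_mem w⟩ : QSym))) := by
      rw [Submodule.map_span, ← Set.range_comp]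
      refine Submodule.span_le.2 ?_
      rintro _ ⟨w, rfl⟩
      exact monomialQ_mem_span_fundamentalQ w
    obtain ⟨g, hg, hgf⟩ := h1 hf
    have : g = ⟨f, hf⟩ := Subtype.ext hgf
    exact this ▸ hg

/-! ## Peak quasisymmetric functions -/

/-- The peak function
`K_P = 2^{|P|+1} ∑ F_α`, over the compositions `α` of `n` with `P ⊆ D(α) △ (D(α) + 1)`. -/
def peakK (n : ℕ) (P : Finset ℕ) : PS :=
  2 ^ (P.card + 1) * ∑ w ∈ (comps n).filter
    (fun w => P ⊆ symmDiff (descentSet w) ((descentSet w).image (· + 1))), fundamentalQ w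

/-- The ring of peak quasisymmetric functions over `ℤ`: the subring of the power series ring
generated by the peak functions `K_P` (additively, they and `1` already generate it). -/
def PQSym : Subring PS :=
  Subring.closure {f | ∃ n P, 1 ≤ n ∧ IsPeakSubset n P ∧ f = peakK n P}

theorem isPeakSubset_peakSet (w : List ℕ+) : IsPeakSubset (wt w) (peakSet w) := by
  intro i hi
  obtain ⟨h1, h2, h3⟩ := Finset.mem_filter.1 hi
  exact ⟨h2, descentSet_lt w h1, fun h => h3 (Finset.mem_filter.1 h).1⟩

/-- The value `K_{P(α)}` of the descent-to-peak map at `F_α`; it is `1` for the empty `α`. -/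
def peakOf (w : List ℕ+) : PQSym :=
  ⟨if w = [] then 1 else peakK (wt w) (peakSet w), by
    split_ifs with h
    · exact one_mem _
    · exact Subring.subset_closure ⟨_, _, wt_pos_of_ne_nil h, isPeakSubset_peakSet w, rfl⟩⟩

/-- Stembridge's descent-to-peak map `ϑ : QSym → PQSym`, `F_α ↦ K_{P(α)}`. -/
def theta : QSym →ₗ[ℤ] PQSym := fundamentalBasis.constr ℤ peakOf

theorem theta_fundamentalQ (w : List ℕ+) :
    theta ⟨fundamentalQ w, fundamentalQ_mem w⟩ = peakOf w := by
  have h : fundamentalBasis w = ⟨fundamentalQ w, fundamentalQ_mem w⟩ := by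
    simp [fundamentalBasis]
  rw [theta, ← h, Module.Basis.constr_basis]

/-- The monomial peak function `L_α = ϑ(M_α)`. -/
def peakL (w : List ℕ+) : PQSym := theta ⟨monomialQ w, monomialQ_mem w⟩

/-! ## The ring spanned by Schur's `Q`-functions -/

/-- The elementary symmetric function `e_n`: the sum of the squarefree monomials of degree `n`. -/
def elemSymm (n : ℕ) : PS := fun d =>
  open scoped Classical in if d.degree = n ∧ ∀ i, d i ≤ 1 then 1 else 0

/-- The complete symmetric function `h_n`: the sum of all monomials of degree `n`. -/
def complSymm (n : ℕ) : PS := fun d => if d.degree = n then 1 else 0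

/-- `q_n = ∑ h_i e_{n-i}`, the coefficient of `z^n` in `∏ (1 + x_i z) / (1 - x_i z)`. -/
def schurq (n : ℕ) : PS := ∑ p ∈ Finset.HasAntidiagonal.antidiagonal n, complSymm p.1 * elemSymm p.2

/-- The ring `Γ`, generated by the `q_n`, `n ≥ 1`. -/
def Gamma : Subring PS := Subring.closure {f | ∃ n, 1 ≤ n ∧ f = schurq n}

/-- The ring `Γ`, seen inside `PQSym` (which contains it). -/
def GammaP : Subring PQSym := Gamma.comap PQSym.subtype

/-! ## Lambda rings -/

section LambdaRing

variable {R : Type*} [CommRing R]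

/-- The `k`-th elementary symmetric polynomial of a finite family. -/
def esym {ι S : Type*} [Fintype ι] [CommRing S] (x : ι → S) (k : ℕ) : S :=
  ((Finset.univ : Finset ι).val.map x).esymm k

/-- The operations `lam n = λ^n` make the commutative ring `R` a λ-ring. The polynomials `P` below
are the usual universal polynomials: the one for products is determined by
`P(e_1(X), …, e_n(X); e_1(Y), …, e_n(Y)) = e_n(X_i Y_j : 1 ≤ i, j ≤ n)`, the one for compositions by
`P(e_1(X), …, e_{mn}(X)) = e_m(∏_{i ∈ s} X_i : s ⊆ {1, …, mn}, |s| = n)`. -/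
structure IsLambdaRing (lam : ℕ → R → R) : Prop where
  lam_zero : ∀ x, lam 0 x = 1
  lam_one : ∀ x, lam 1 x = x
  lam_unit : ∀ n, 2 ≤ n → lam n 1 = 0
  lam_add : ∀ n x y, lam n (x + y) = ∑ p ∈ Finset.HasAntidiagonal.antidiagonal n, lam p.1 x * lam p.2 y
  lam_mul : ∀ (n : ℕ) (P : MvPolynomial (Fin n ⊕ Fin n) ℤ),
    MvPolynomial.aeval
      (Sum.elim
        (fun i : Fin n => esym (fun k : Fin n =>
          (MvPolynomial.X (Sum.inl k) : MvPolynomial (Fin n ⊕ Fin n) ℤ)) (i + 1))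
        (fun j : Fin n => esym (fun k : Fin n =>
          (MvPolynomial.X (Sum.inr k) : MvPolynomial (Fin n ⊕ Fin n) ℤ)) (j + 1))) P =
      esym (fun k : Fin n × Fin n =>
        (MvPolynomial.X (Sum.inl k.1) * MvPolynomial.X (Sum.inr k.2) :
          MvPolynomial (Fin n ⊕ Fin n) ℤ)) n →
    ∀ x y, lam n (x * y) = MvPolynomial.aeval
      (Sum.elim (fun i : Fin n => lam (i + 1) x) (fun j : Fin n => lam (j + 1) y)) P
  lam_comp : ∀ (m n : ℕ) (P : MvPolynomial (Fin (m * n)) ℤ),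
    MvPolynomial.aeval
      (fun i : Fin (m * n) => esym (fun k : Fin (m * n) =>
        (MvPolynomial.X k : MvPolynomial (Fin (m * n)) ℤ)) (i + 1)) P =
      esym (fun s : {s : Finset (Fin (m * n)) // s.card = n} =>
        ∏ k ∈ s.1, (MvPolynomial.X k : MvPolynomial (Fin (m * n)) ℤ)) m →
    ∀ x, lam m (lam n x) = MvPolynomial.aeval (fun i : Fin (m * n) => lam (i + 1) x) P

/-- The series `λ_t(a) = 1 + λ^1(a) t + λ^2(a) t^2 + ⋯` (when `λ^0 = 1`). -/
def lamSeries (lam : ℕ → R → R) (a : R) : PowerSeries R := PowerSeries.mk fun n => lam n a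

/-- The Adams operation `Ψ^n`, `n ≥ 1`, of the operations `lam n = λ^n`, given by
`d/dt log λ_t(a) = ∑_{n ≥ 0} (-1)^n Ψ^{n+1}(a) t^n`. Here `d/dt log λ_t(a)` is the derivative of
`λ_t(a)` times the inverse of `λ_t(a)`, a series with constant term `1`. -/
def adams (lam : ℕ → R → R) (n : ℕ) (a : R) : R :=
  (-1) ^ (n - 1) * PowerSeries.coeff (n - 1)
    (PowerSeries.derivative R (lamSeries lam a) * PowerSeries.invOfUnit (lamSeries lam a) 1)

/-- The subring `A` of `R` is stable under the operations `λ^n`. -/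
def IsLambdaSubring (lam : ℕ → R → R) (A : Subring R) : Prop := ∀ n, ∀ x ∈ A, lam n x ∈ A

end LambdaRing

/-- `lam` is a λ-ring structure on `PQSym` whose Adams operations send `L_α` to `L_{n·α}` for odd
`n` and to `0` for even `n`, for every (nonempty) composition `α` with odd parts. -/
def IsPeakLambda (lam : ℕ → PQSym → PQSym) : Prop :=
  IsLambdaRing lam ∧ ∀ (n : ℕ+) (w : List ℕ+), w ≠ [] → IsOdd w →
    adams lam n (peakL w) = if Odd (n : ℕ) then peakL (scale n w) else 0

/-- `q_n(α) = λ^n(L_α)`. -/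
def qAt (lam : ℕ → PQSym → PQSym) (w : List ℕ+) (n : ℕ) : PQSym := lam n (peakL w)

/-- `Γ_α`, the subring of `PQSym` generated by the `q_n(α)`, `n ≥ 1`. -/
def GammaAt (lam : ℕ → PQSym → PQSym) (w : List ℕ+) : Subring PQSym :=
  Subring.closure {f | ∃ n, 1 ≤ n ∧ f = qAt lam w n}

theorem qAt_mem (lam : ℕ → PQSym → PQSym) (w : List ℕ+) {n : ℕ} (hn : 1 ≤ n) :
    qAt lam w n ∈ GammaAt lam w :=
  Subring.subset_closure ⟨n, hn, rfl⟩

/-! ## Infinite tensor products of commutative rings -/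

section Tensor

variable {ι : Type*} (A : ι → Type*) [∀ i, CommRing (A i)]

/-- The tensor product over `ℤ` of the rings `A i`, for `i` in a finite set `s`. -/
abbrev FinTensor (s : Finset ι) : Type _ := ⨂[ℤ] i : s, A i

open scoped Classical in
/-- For `s ⊆ t` the ring homomorphism from the tensor product over `s` to the one over `t` that
inserts a factor `1` at the places in `t` outside `s`: it sends `⨂ a i` to the product over `i ∈ s`
of the pure tensors with `a i` at the place `i` and `1` at all other places. -/
def finTensorMap {s t : Finset ι} (h : s ≤ t) : FinTensor A s →+* FinTensor A t :=
  (PiTensorProduct.liftAlgHom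
    ((MultilinearMap.mkPiAlgebra ℤ s (FinTensor A t)).compLinearMap fun i =>
      (PiTensorProduct.singleAlgHom (R := ℤ) (A := fun j : t => A j) ⟨i, h i.2⟩).toLinearMap)
    (by simp only [MultilinearMap.compLinearMap_apply, MultilinearMap.mkPiAlgebra_apply,
          Pi.one_apply, AlgHom.toLinearMap_apply, map_one, Finset.prod_const_one])
    (by
      intro x y
      simp only [MultilinearMap.compLinearMap_apply, MultilinearMap.mkPiAlgebra_apply,
        Pi.mul_apply, AlgHom.toLinearMap_apply, map_mul, Finset.prod_mul_distrib])).toRingHom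

/-- The tensor product over `ℤ` of a possibly infinite family of commutative rings: the direct
limit of the tensor products of its finite subfamilies. -/
abbrev InfTensor : Type _ :=
  Ring.DirectLimit (fun s : Finset ι => FinTensor A s) fun _ _ h => finTensorMap A h

/-- The pure tensor `⨂_{i ∈ s} a i`, with factors `1` outside `s`, in the infinite tensor
product. -/
def pureTensor (s : Finset ι) (a : ∀ i : s, A i) : InfTensor A :=
  Ring.DirectLimit.of (fun s : Finset ι => FinTensor A s) (fun _ _ h => finTensorMap A h) s
    (PiTensorProduct.tprod ℤ a)

end Tensor

end PeakQSym

end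

open scoped TensorProduct

noncomputable section

namespace PeakQSym

/-! ## Quasi-shuffles -/

/-! The monomial functions M_u multiply by quasi-shuffles. So do the L_u: in finitely many
variables, L_u arises from M_u by inserting, for each variable y, the variable y and removing the
variable -y (`linearCombination_ev_isQMul`). This gives an explicit recursion `peakCoeff` for the
coefficients of L_u, which is matched with the definition through the K_P by comparing coefficients
of the M_v (`peakOf_eq_sum`, `coe_peakL`). The recursion shows that an even letter can be merged
into its right neighbour up to sign, and that an even last letter gives zero. Hence the L_w with w
odd form a ℤ-basis (`span_peakL`, `peakL_linearIndependent`).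

The map L_w ↦ L_{n·w} respects quasi-shuffles and the relations for even letters, so it is a ring
endomorphism ψ_n, and for n even it kills L_w for nonempty w. Modulo a prime p, M_w^p equals
M_{p·w}. This is a statement about multiplicities in quasi-shuffle powers, so it passes to the L_w
(`IsQMul.pow_prime`): the ψ_p lift Frobenius. Dwork's lemma turns commuting Frobenius lifts into
integral Witt coordinates, hence into operations λ^n whose power sums are the ψ_n
(`exists_isLamOf`). The λ-ring axioms follow from a splitting principle in an algebraically closed
field (`IsLamOf.isLambdaRing`), and uniqueness from Newton's identities, since `PQSym` is a domain
of characteristic zero.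

For the structure as a ring, words are ordered by length and then lexicographically. The largest
shuffle of two nonincreasing products of Lyndon words is their merge (`le_word_add`), and shuffling
v into v^j T, with the factors of T smaller than v, produces it j + 1 times (`mult_replicate`). This
j + 1 is exactly the denominator in Newton's identity for λ^{j+1}(L_v). So the products of the
λ^n(L_v), over odd Lyndon words v, are unitriangular over ℤ with respect to the L_w
(`lynProd_sub_mem_low`) and form a basis. An odd Lyndon word is m·u for a unique odd m and a unique
elementary u. Grouping the factors by u gives `prodBasis`, whose elements are products of basis
elements of the rings Γ_u. The tensor decomposition and the freeness are read off from it.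

To compare the Γ_u, calculations are made for all u at once, in families indexed by u. A subring
`famRing` of families is closed under the λ-operations, and evaluation at any single u maps it
isomorphically onto Γ_u (`famEquiv`). Finally L_(n) is twice the power sum for n odd, so λ^n(L_(1))
and q_n have the same power sums (`coe_peakLam_singleton_one`). -/

/-- The list of all quasi-shuffles of two words. -/
def qsh : List ℕ+ → List ℕ+ → List (List ℕ+)
  | [], w => [w]
  | a :: u, [] => [a :: u]
  | a :: u, b :: w => (qsh u (b :: w)).map (a :: ·) ++ (qsh (a :: u) w).map (b :: ·) ++
      (qsh u w).map ((a + b) :: ·)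
termination_by u w => u.length + w.length

theorem qsh_nil_left (w : List ℕ+) : qsh [] w = [w] := by rw [qsh]

theorem qsh_nil_right (w : List ℕ+) : qsh w [] = [w] := by cases w <;> rw [qsh]

theorem qsh_cons (a b : ℕ+) (u w : List ℕ+) : qsh (a :: u) (b :: w) =
    (qsh u (b :: w)).map (a :: ·) ++ (qsh (a :: u) w).map (b :: ·) ++
      (qsh u w).map ((a + b) :: ·) := by rw [qsh]

theorem qsh_scale (n : ℕ+) : ∀ u w : List ℕ+,
    qsh (scale n u) (scale n w) = (qsh u w).map (scale n)
  | [], w => by simp [scale, qsh_nil_left]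
  | a :: u, [] => by simp [scale, qsh_nil_right]
  | a :: u, b :: w => by
    have h1 := qsh_scale n u (b :: w)
    have h2 := qsh_scale n (a :: u) w
    have h3 := qsh_scale n u w
    simp only [scale, List.map_cons] at h1 h2 h3 ⊢
    rw [qsh_cons, qsh_cons, h1, h2, h3]
    simp [scale, Function.comp_def, mul_add]
termination_by u w => u.length + w.length

/-- A function on words that is multiplicative for the quasi-shuffle product. -/
structure IsQMul {S : Type*} [CommRing S] (f : List ℕ+ → S) : Prop where
  nil : f [] = 1
  mul : ∀ u w, f u * f w = ((qsh u w).map f).sum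

section
variable {S : Type*} [CommRing S]

theorem isQMul_of_cons {f : List ℕ+ → S} (h0 : f [] = 1)
    (h : ∀ a b u w, f (a :: u) * f (b :: w) = ((qsh (a :: u) (b :: w)).map f).sum) :
    IsQMul f := by
  refine ⟨h0, fun u w => ?_⟩
  rcases u with _ | ⟨a, u⟩
  · simp [h0, qsh_nil_left]
  rcases w with _ | ⟨b, w⟩
  · simp [h0, qsh_nil_right]
  exact h a b u w

/-- Inserting a new smallest variable. -/
theorem IsQMul.step {Z V : List ℕ+ → S} (hZ : IsQMul Z) (y : S) (h0 : V [] = 1)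
    (h : ∀ a u, V (a :: u) = Z (a :: u) + y ^ (a : ℕ) * Z u) : IsQMul V := by
  refine isQMul_of_cons h0 fun a b u w => ?_
  have key := hZ.mul (a :: u) (b :: w)
  have h1 : ∀ (l : List (List ℕ+)) (c : ℕ+), ((l.map (c :: ·)).map V).sum =
      ((l.map (c :: ·)).map Z).sum + y ^ (c : ℕ) * (l.map Z).sum := by
    intro l c
    induction l with
    | nil => simp
    | cons z l ih =>
      simp only [List.map_cons, List.sum_cons] at ih ⊢
      rw [ih, h]; ring
  rw [qsh_cons] at key ⊢
  simp only [List.map_append, List.sum_append] at key ⊢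
  -- The three groups of quasi-shuffles begin with a, b and a + b; their contributions in y are the
  -- two mixed terms and the y^(a+b) term of the product of the two expansions.
  rw [h1, h1, h1, ← hZ.mul, ← hZ.mul, ← hZ.mul, h, h, PNat.add_coe, pow_add]
  linear_combination key

/-- Removing the smallest variable. -/
theorem IsQMul.step_inv {V W : List ℕ+ → S} (hV : IsQMul V) (y : S) (h0 : W [] = 1)
    (h : ∀ a u, W (a :: u) = V (a :: u) - y ^ (a : ℕ) * W u) : IsQMul W := by
  refine ⟨h0, ?_⟩
  have h1 : ∀ (l : List (List ℕ+)) (c : ℕ+), ((l.map (c :: ·)).map W).sum =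
      ((l.map (c :: ·)).map V).sum - y ^ (c : ℕ) * (l.map W).sum := by
    intro l c
    induction l with
    | nil => simp
    | cons z l ih =>
      simp only [List.map_cons, List.sum_cons] at ih ⊢
      rw [ih, h]; ring
  -- Here `W` occurs on both sides of its own recursion, so multiplicativity needs an induction on
  -- the total length.
  suffices H : ∀ n, ∀ u w : List ℕ+, u.length + w.length = n →
      W u * W w = ((qsh u w).map W).sum from fun u w => H _ u w rfl
  intro n
  induction n using Nat.strong_induction_on with
  | _ n ih =>
    intro u w hn
    rcases u with _ | ⟨a, u⟩
    · simp [h0, qsh_nil_left]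
    rcases w with _ | ⟨b, w⟩
    · simp [h0, qsh_nil_right]
    have key := hV.mul (a :: u) (b :: w)
    simp only [List.length_cons] at hn
    rw [qsh_cons] at key ⊢
    simp only [List.map_append, List.sum_append] at key ⊢
    rw [h1, h1, h1, ← ih _ (by simp; omega) u (b :: w) rfl,
      ← ih _ (by simp; omega) (a :: u) w rfl, ← ih _ (by omega) u w rfl]
    have ha : V (a :: u) = W (a :: u) + y ^ (a : ℕ) * W u := by rw [h]; ring
    have hb : V (b :: w) = W (b :: w) + y ^ (b : ℕ) * W w := by rw [h]; ring
    rw [ha, hb] at key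
    rw [PNat.add_coe, pow_add]
    linear_combination key

/-- The value of the monomial quasisymmetric function at a finite list of variables. -/
def ev : List S → List ℕ+ → S
  | [], [] => 1
  | [], _ :: _ => 0
  | _ :: _, [] => 1
  | y :: ys, a :: w => ev ys (a :: w) + y ^ (a : ℕ) * ev ys w

theorem ev_nil (ys : List S) : ev ys [] = 1 := by cases ys <;> rfl

theorem ev_nil_isQMul : IsQMul (ev ([] : List S)) := by
  refine isQMul_of_cons rfl fun a b u w => ?_
  have h : ∀ (l : List (List ℕ+)) (c : ℕ+),
      ((l.map (c :: ·)).map (ev ([] : List S))).sum = 0 := by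
    intro l c
    rw [List.map_map]
    exact List.sum_eq_zero (by simp [ev])
  rw [qsh_cons]
  simp only [List.map_append, List.sum_append, h]
  simp [ev]

theorem ev_isQMul (ys : List S) : IsQMul (ev ys) := by
  induction ys with
  | nil => exact ev_nil_isQMul
  | cons y ys ih => exact ih.step y rfl fun a u => rfl

theorem add_pow_prime_of_eq_zero {p : ℕ} (hp : p.Prime) (h : (p : S) = 0) (x y : S) :
    (x + y) ^ p = x ^ p + y ^ p := by
  obtain ⟨r, hr⟩ := exists_add_pow_prime_eq hp x y
  rw [hr, h]; ring

/-- When p = 0, taking p-th powers is additive, so it only replaces each variable by its p-th power.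
-/
theorem ev_pow_prime {p : ℕ+} (hp : (p : ℕ).Prime) (h : ((p : ℕ) : S) = 0) :
    ∀ (ys : List S) (w : List ℕ+), ev ys w ^ (p : ℕ) = ev ys (scale p w)
  | [], [] => by simp [ev, scale]
  | [], _ :: _ => by simp [ev, scale]
  | _ :: _, [] => by simp [ev, scale]
  | y :: ys, a :: w => by
    have h1 := ev_pow_prime hp h ys (a :: w)
    have h2 := ev_pow_prime hp h ys w
    simp only [scale, List.map_cons] at h1 h2 ⊢
    rw [ev, ev, add_pow_prime_of_eq_zero hp h, mul_pow, h1, h2, ← pow_mul, PNat.mul_coe,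
      mul_comm (a : ℕ)]

end

/-! ## Reduction to finitely many variables -/

/-- The power series without monomials in the first `N` variables only. -/
def farIdeal (N : ℕ) : Ideal PS where
  carrier := {f | ∀ d : ℕ →₀ ℕ, (∀ i, N ≤ i → d i = 0) → MvPowerSeries.coeff d f = 0}
  add_mem' {f g} hf hg d hd := by rw [map_add, hf d hd, hg d hd, add_zero]
  zero_mem' d _ := map_zero _
  smul_mem' c f hf d hd := by
    classical
    rw [smul_eq_mul, MvPowerSeries.coeff_mul]
    refine Finset.sum_eq_zero fun p hp => ?_
    rw [hf p.2, mul_zero]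
    intro i hi
    have := DFunLike.congr_fun (Finset.HasAntidiagonal.mem_antidiagonal.1 hp) i
    rw [hd i hi, Finsupp.add_apply] at this
    omega

theorem exists_bound (d : ℕ →₀ ℕ) : ∃ N, ∀ n, N ≤ n → ∀ i, n ≤ i → d i = 0 := by
  refine ⟨d.support.sup id + 1, fun n hn i hi => ?_⟩
  by_contra h
  have : i ≤ d.support.sup id := Finset.le_sup (f := id) (Finsupp.mem_support_iff.2 h)
  omega

/-- A monomial involves finitely many variables, so it is detected modulo `farIdeal N` for some N.
Identities of power series can thus be checked in finitely many variables. -/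
theorem eq_zero_of_mem_farIdeal {f : PS} (h : ∀ N, f ∈ farIdeal N) : f = 0 := by
  ext d
  obtain ⟨N, hN⟩ := exists_bound d
  exact h N d (hN N le_rfl)

/-- `d` is an exponent vector of pattern `w` in the variables `x_k, x_{k+1}, …`. -/
def Occ (k : ℕ) (w : List ℕ+) (d : ℕ →₀ ℕ) : Prop :=
  ∃ i : Fin w.length → ℕ, StrictMono i ∧ (∀ j, k ≤ i j) ∧
    d = ∑ j, Finsupp.single (i j) (w.get j : ℕ)

theorem occ_nil (k : ℕ) (d : ℕ →₀ ℕ) : Occ k [] d ↔ d = 0 := by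
  constructor
  · rintro ⟨i, -, -, rfl⟩
    rfl
  · rintro rfl
    exact ⟨Fin.elim0, fun a => a.elim0, fun a => a.elim0, rfl⟩

theorem occ_cons (k : ℕ) (a : ℕ+) (w : List ℕ+) (d : ℕ →₀ ℕ) : Occ k (a :: w) d ↔
    ∃ j, k ≤ j ∧ ∃ d', Occ (j + 1) w d' ∧ d = Finsupp.single j (a : ℕ) + d' := by
  constructor
  · rintro ⟨i, hi, hk, rfl⟩
    refine ⟨i ⟨0, by simp⟩, hk _, _, ⟨fun j => i (Fin.succ j), ?_, ?_, rfl⟩, ?_⟩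
    · exact fun x y h => hi (Fin.succ_lt_succ_iff.2 h)
    · exact fun j => hi (Fin.succ_pos j)
    · exact Fin.sum_univ_succ (n := w.length) fun j =>
        Finsupp.single (i j) (((a :: w).get j : ℕ+) : ℕ)
  · rintro ⟨j, hj, d', ⟨i, hi, hk, rfl⟩, rfl⟩
    refine ⟨Fin.cons (α := fun _ => ℕ) j i, ?_, ?_, ?_⟩
    · refine Fin.cases (fun y h => ?_) (fun x y h => ?_)
      · obtain ⟨y, rfl⟩ := Fin.exists_succ_eq.2 (ne_of_gt h)
        exact hk y
      · obtain ⟨y, rfl⟩ := Fin.exists_succ_eq.2 (ne_of_gt (lt_of_le_of_lt (Fin.zero_le _) h))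
        exact hi (Fin.succ_lt_succ_iff.1 h)
    · refine Fin.cases hj fun x => ?_
      have := hk x
      simp only [Fin.cons_succ]; omega
    · refine (Eq.trans (Fin.sum_univ_succ (n := w.length) _) ?_).symm
      rfl

theorem Occ.eq_zero {k : ℕ} {w : List ℕ+} {d : ℕ →₀ ℕ} (h : Occ k w d) {j : ℕ} (hj : j < k) :
    d j = 0 := by
  obtain ⟨i, -, hk, rfl⟩ := h
  rw [Finsupp.finsetSum_apply]
  refine Finset.sum_eq_zero fun x _ => ?_
  have : i x ≠ j := by have := hk x; omega
  simp [this]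

/-- The monomial quasisymmetric function in the variables `x_k, x_{k+1}, …`. -/
def monFrom (k : ℕ) (w : List ℕ+) : PS := fun d =>
  open scoped Classical in if Occ k w d then 1 else 0

open scoped Classical in
theorem coeff_monFrom (k : ℕ) (w : List ℕ+) (d : ℕ →₀ ℕ) :
    MvPowerSeries.coeff d (monFrom k w) = if Occ k w d then 1 else 0 := rfl

theorem monFrom_zero (w : List ℕ+) : monFrom 0 w = monomialQ w := by
  ext d
  have h : Occ 0 w d ↔ ∃ i : Fin w.length → ℕ, StrictMono i ∧
      d = ∑ k, Finsupp.single (i k) (w.get k : ℕ) := by simp [Occ]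
  rw [coeff_monFrom]
  by_cases hh : Occ 0 w d
  · rw [if_pos hh]
    exact (if_pos (h.1 hh)).symm
  · rw [if_neg hh]
    exact (if_neg fun h1 => hh (h.2 h1)).symm

theorem monFrom_nil (k : ℕ) : monFrom k [] = 1 := by
  classical
  ext d
  rw [coeff_monFrom, MvPowerSeries.coeff_one]
  simp [occ_nil]

/-- Monomials are separated by whether the first letter sits at the variable k or further on. This
is the same recursion as that of `ev`. -/
theorem monFrom_cons (k : ℕ) (a : ℕ+) (w : List ℕ+) : monFrom k (a :: w) =
    monFrom (k + 1) (a :: w) + MvPowerSeries.X k ^ (a : ℕ) * monFrom (k + 1) w := by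
  classical
  ext d
  rw [map_add, coeff_monFrom, coeff_monFrom, MvPowerSeries.X_pow_eq,
    MvPowerSeries.coeff_monomial_mul, one_mul]
  by_cases h : Finsupp.single k (a : ℕ) ≤ d
  · rw [if_pos h, coeff_monFrom, if_neg (c := Occ (k + 1) (a :: w) d), zero_add]
    · congr 1
      refine propext ?_
      rw [occ_cons]
      constructor
      · rintro ⟨j, hj, d', hd', rfl⟩
        obtain rfl | hj := hj.eq_or_lt
        · simpa using hd'
        · exfalso
          have h1 := h k
          rw [Finsupp.single_eq_same, Finsupp.add_apply, hd'.eq_zero (by omega),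
            Finsupp.single_eq_of_ne (by omega)] at h1
          have := a.pos; omega
      · exact fun h1 => ⟨k, le_rfl, _, h1, (add_tsub_cancel_of_le h).symm⟩
    · intro h1
      have h2 := h k
      rw [h1.eq_zero (by omega), Finsupp.single_eq_same] at h2
      have := a.pos; omega
  · rw [if_neg h, add_zero]
    congr 1
    refine propext ?_
    rw [occ_cons, occ_cons]
    constructor
    · rintro ⟨j, hj, d', hd', rfl⟩
      obtain rfl | hj := hj.eq_or_lt
      · exact absurd (le_self_add) h
      · exact ⟨j, hj, d', hd', rfl⟩
    · rintro ⟨j, hj, h1⟩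
      exact ⟨j, by omega, h1⟩

theorem monFrom_mem_farIdeal (k : ℕ) (a : ℕ+) (w : List ℕ+) : monFrom k (a :: w) ∈ farIdeal k := by
  classical
  intro d hd
  rw [coeff_monFrom, if_neg]
  rw [occ_cons]
  rintro ⟨j, hj, d', -, rfl⟩
  have := hd j hj
  rw [Finsupp.add_apply, Finsupp.single_eq_same] at this
  have := a.pos; omega

/-- Modulo `farIdeal N`, monomial quasisymmetric functions are polynomials in `N` variables. -/
theorem map_monomialQ {S : Type*} [CommRing S] {N : ℕ} (φ : PS →+* S)
    (hφ : ∀ f ∈ farIdeal N, φ f = 0) (w : List ℕ+) :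
    φ (monomialQ w) = ev ((List.range' 0 N).map fun i => φ (MvPowerSeries.X i)) w := by
  suffices H : ∀ m k w, k + m = N →
      φ (monFrom k w) = ev ((List.range' k m).map fun i => φ (MvPowerSeries.X i)) w by
    rw [← monFrom_zero]
    exact H N 0 w (zero_add N)
  intro m
  induction m with
  | zero =>
    rintro k w rfl
    rcases w with _ | ⟨a, w⟩
    · simp [monFrom_nil, ev]
    · simpa [ev] using hφ _ (monFrom_mem_farIdeal k a w)
  | succ m ih =>
    intro k w hk
    rcases w with _ | ⟨a, w⟩
    · simp [monFrom_nil, ev_nil]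
    · rw [monFrom_cons, List.range'_succ, List.map_cons, ev, map_add, map_mul, map_pow,
        ih (k + 1) _ (by omega), ih (k + 1) _ (by omega)]

theorem monomialQ_isQMul : IsQMul monomialQ := by
  refine ⟨by rw [← monFrom_zero, monFrom_nil], fun u w => ?_⟩
  rw [← sub_eq_zero]
  refine eq_zero_of_mem_farIdeal fun N => ?_
  rw [← Ideal.Quotient.eq_zero_iff_mem, map_sub, map_mul, map_list_sum, List.map_map,
    Function.comp_def, sub_eq_zero]
  have h := map_monomialQ (Ideal.Quotient.mk (farIdeal N))
    fun f hf => Ideal.Quotient.eq_zero_iff_mem.2 hf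
  simp only [h]
  exact (ev_isQMul _).mul u w

/-- Modulo p and `farIdeal N` this is Frobenius on polynomials. With N beyond the variables of d,
elements of `farIdeal N` have coefficient zero at d, and only a multiple of p remains. -/
theorem exists_coeff_monomialQ_pow {p : ℕ+} (hp : (p : ℕ).Prime) (w : List ℕ+) (d : ℕ →₀ ℕ) :
    ((p : ℕ) : ℤ) ∣ MvPowerSeries.coeff d (monomialQ w ^ (p : ℕ) - monomialQ (scale p w)) := by
  obtain ⟨N, hN⟩ := exists_bound d
  let J : Ideal PS := farIdeal N ⊔ Ideal.span {((p : ℕ) : PS)}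
  have h := map_monomialQ (N := N) (Ideal.Quotient.mk J)
    fun f hf => Ideal.Quotient.eq_zero_iff_mem.2 (Ideal.mem_sup_left hf)
  have hpS : ((p : ℕ) : PS ⧸ J) = 0 := by
    rw [← map_natCast (Ideal.Quotient.mk J), Ideal.Quotient.eq_zero_iff_mem]
    exact Ideal.mem_sup_right (Ideal.mem_span_singleton_self _)
  have h1 : monomialQ w ^ (p : ℕ) - monomialQ (scale p w) ∈ J := by
    rw [← Ideal.Quotient.eq_zero_iff_mem, map_sub, map_pow, h, h, ev_pow_prime hp hpS, sub_self]
  obtain ⟨f, hf, g, hg, hfg⟩ := Submodule.mem_sup.1 h1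
  obtain ⟨g, rfl⟩ := Ideal.mem_span_singleton.1 hg
  rw [← hfg, map_add, hf d (hN N le_rfl), zero_add, ← nsmul_eq_mul, map_nsmul, nsmul_eq_mul]
  exact dvd_mul_right _ _

/-- The words that occur in the `n`-th power of the word `u`, with multiplicities. -/
def qpow (u : List ℕ+) : ℕ → List (List ℕ+)
  | 0 => [[]]
  | n + 1 => (qpow u n).flatMap (qsh u)

theorem IsQMul.pow {S : Type*} [CommRing S] {f : List ℕ+ → S} (hf : IsQMul f) (u : List ℕ+)
    (n : ℕ) : f u ^ n = ((qpow u n).map f).sum := by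
  induction n with
  | zero => simp [qpow, hf.nil]
  | succ n ih =>
    rw [pow_succ, ih, qpow, List.map_flatMap, mul_comm]
    induction qpow u n with
    | nil => simp
    | cons z l ih =>
      rw [List.map_cons, List.sum_cons, mul_add, ih, hf.mul, List.flatMap_cons, List.sum_append]

/-- The coefficient at `expo z` isolates M_z, so the congruence between power series becomes one
between multiplicities of words. In this form it no longer mentions quasisymmetric functions and
applies to every quasi-shuffle multiplicative function. -/
theorem count_qpow {p : ℕ+} (hp : (p : ℕ).Prime) (u z : List ℕ+) :
    ((p : ℕ) : ℤ) ∣ ((qpow u p).count z : ℤ) - if z = scale p u then 1 else 0 := by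
  have h := exists_coeff_monomialQ_pow hp u (expo z)
  have h1 : ∀ l : List (List ℕ+),
      (l.map fun w => if w = z then (1 : ℤ) else 0).sum = l.count z := by
    intro l
    induction l with
    | nil => simp
    | cons w l ih => rw [List.map_cons, List.sum_cons, ih, List.count_cons]; simp [add_comm]
  rw [monomialQ_isQMul.pow, map_sub, map_list_sum, List.map_map, Function.comp_def,
    coeff_expo_monomialQ] at h
  simp only [coeff_expo_monomialQ] at h
  rwa [h1, if_congr eq_comm rfl rfl] at h

theorem list_sum_eq_sum_count {S : Type*} [AddCommGroup S] (f : List ℕ+ → S)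
    (l : List (List ℕ+)) (T : Finset (List ℕ+)) (hT : ∀ z ∈ l, z ∈ T) :
    (l.map f).sum = ∑ z ∈ T, (l.count z : ℤ) • f z := by
  induction l with
  | nil => simp
  | cons w l ih =>
    rw [List.map_cons, List.sum_cons, ih fun z hz => hT z (List.mem_cons_of_mem _ hz)]
    have h1 : f w = ∑ z ∈ T, (if z = w then 1 else 0 : ℤ) • f z := by
      simp [ite_smul, hT w List.mem_cons_self]
    rw [h1, ← Finset.sum_add_distrib]
    refine Finset.sum_congr rfl fun z _ => ?_
    rw [← add_smul, List.count_cons]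
    by_cases h : z = w
    · simp [h, add_comm]
    · simp [h, Ne.symm h]

/-- Frobenius congruences for functions that are multiplicative for the quasi-shuffle product. -/
theorem IsQMul.pow_prime {S : Type*} [CommRing S] {f : List ℕ+ → S} (hf : IsQMul f) {p : ℕ+}
    (hp : (p : ℕ).Prime) (u : List ℕ+) : ((p : ℕ) : S) ∣ f u ^ (p : ℕ) - f (scale p u) := by
  -- Both terms are written as sums over the same set of words, so that the divisibility holds
  -- coefficient by coefficient.
  let T : Finset (List ℕ+) := insert (scale p u) (qpow u p).toFinset
  have h1 := list_sum_eq_sum_count f (qpow u p) T fun z hz =>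
    Finset.mem_insert_of_mem (List.mem_toFinset.2 hz)
  have h2 : f (scale p u) = ∑ z ∈ T, (if z = scale p u then 1 else 0 : ℤ) • f z := by
    simp [T, ite_smul]
  rw [hf.pow, h1, h2, ← Finset.sum_sub_distrib]
  refine Finset.dvd_sum fun z _ => ?_
  rw [← sub_smul]
  obtain ⟨c, hc⟩ := count_qpow hp u z
  rw [hc, mul_smul, zsmul_eq_mul, Int.cast_natCast]
  exact dvd_mul_right _ _

/-! ## The expansion of the monomial peak functions -/

/-- Prefixing a letter, on linear combinations of words. -/
def consL (a : ℕ+) : (List ℕ+ →₀ ℤ) →ₗ[ℤ] (List ℕ+ →₀ ℤ) :=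
  Finsupp.linearCombination ℤ fun v => Finsupp.single (a :: v) 1

/-- Adding `a` to the first letter, on linear combinations of words; the empty word goes to `0`. -/
def incL (a : ℕ+) : (List ℕ+ →₀ ℤ) →ₗ[ℤ] (List ℕ+ →₀ ℤ) :=
  Finsupp.linearCombination ℤ fun
    | [] => 0
    | b :: v => Finsupp.single ((a + b) :: v) 1

theorem consL_single (a : ℕ+) (v : List ℕ+) :
    consL a (Finsupp.single v 1) = Finsupp.single (a :: v) 1 := by simp [consL]

theorem incL_single_cons (a b : ℕ+) (v : List ℕ+) :
    incL a (Finsupp.single (b :: v) 1) = Finsupp.single ((a + b) :: v) 1 := by simp [incL]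

theorem incL_single_nil (a : ℕ+) : incL a (Finsupp.single [] 1) = 0 := by simp [incL]

theorem words_hom_ext {M : Type*} [AddCommGroup M] {f g : (List ℕ+ →₀ ℤ) →ₗ[ℤ] M}
    (h : ∀ v, f (Finsupp.single v 1) = g (Finsupp.single v 1)) (x : List ℕ+ →₀ ℤ) :
    f x = g x := by
  refine LinearMap.congr_fun (Finsupp.lhom_ext' fun v => LinearMap.ext_ring ?_) x
  exact h v

theorem incL_consL (a b : ℕ+) (x : List ℕ+ →₀ ℤ) : incL a (consL b x) = consL (a + b) x :=
  words_hom_ext (f := incL a ∘ₗ consL b) (fun v => by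
    simp [consL_single, incL_single_cons]) x

theorem incL_incL (a b : ℕ+) (x : List ℕ+ →₀ ℤ) : incL a (incL b x) = incL (a + b) x :=
  words_hom_ext (f := incL a ∘ₗ incL b) (fun v => by
    rcases v with _ | ⟨c, v⟩ <;> simp [incL_single_nil, incL_single_cons, add_assoc]) x

/-- The coefficients of the monomial peak function `L_u` at the monomial quasisymmetric
functions. -/
def peakCoeff : List ℕ+ → (List ℕ+ →₀ ℤ)
  | [] => Finsupp.single [] 1
  | a :: u => (if Odd (a : ℕ) then 2 else 0 : ℤ) • consL a (peakCoeff u) +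
      (-1 : ℤ) ^ ((a : ℕ) + 1) • incL a (peakCoeff u)

/-- The linear extension of the monomial quasisymmetric functions. -/
def monLin : (List ℕ+ →₀ ℤ) →ₗ[ℤ] PS := Finsupp.linearCombination ℤ monomialQ

theorem coeff_expo_monLin (v : List ℕ+) (x : List ℕ+ →₀ ℤ) :
    MvPowerSeries.coeff (expo v) (monLin x) = x v :=
  words_hom_ext (f := MvPowerSeries.coeff (expo v) ∘ₗ monLin) (g := Finsupp.lapply v)
    (fun w => by
      change MvPowerSeries.coeff (expo v) (monLin (Finsupp.single w 1)) = _
      rw [monLin, Finsupp.linearCombination_single, one_smul, coeff_expo_monomialQ,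
        Finsupp.lapply_apply, Finsupp.single_apply]) x

/-- The monomial peak function, defined by its coefficients. -/
def peakT (u : List ℕ+) : PS := monLin (peakCoeff u)

section
variable {S : Type*} [CommRing S]

/-- Passing from `ys` to `y :: ys` amounts to inserting the variable y and then removing the
variable -y; both operations preserve multiplicativity. Since y^a - (-y)^a is 2y^a for a odd and 0
for a even, the result satisfies the recursion that defines `peakCoeff`. -/
theorem linearCombination_ev_isQMul (ys : List S) :
    IsQMul fun u => Finsupp.linearCombination ℤ (ev ys) (peakCoeff u) := by
  induction ys with
  | nil =>
    have h : (fun u => Finsupp.linearCombination ℤ (ev ([] : List S)) (peakCoeff u)) = ev [] := by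
      funext u
      rcases u with _ | ⟨a, u⟩
      · simp [peakCoeff]
      have h1 : ∀ x, Finsupp.linearCombination ℤ (ev ([] : List S)) (consL a x) = 0 := fun x =>
        words_hom_ext (f := Finsupp.linearCombination ℤ (ev ([] : List S)) ∘ₗ consL a) (g := 0)
          (fun v => by simp [consL_single, ev]) x
      have h2 : ∀ x, Finsupp.linearCombination ℤ (ev ([] : List S)) (incL a x) = 0 := fun x =>
        words_hom_ext (f := Finsupp.linearCombination ℤ (ev ([] : List S)) ∘ₗ incL a) (g := 0)
          (fun v => by
            rcases v with _ | ⟨b, v⟩ <;> simp [incL_single_nil, incL_single_cons, ev]) x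
      rw [peakCoeff, map_add, map_smul, map_smul, h1, h2]
      simp [ev]
    rw [h]
    exact ev_nil_isQMul
  | cons y ys ih =>
    -- The part of the evaluation at `y :: ys` in which the first letter is carried by y. Prefixing
    -- a letter or enlarging the first one acts on it simply (`hc`, `hi`).
    let r : (List ℕ+ →₀ ℤ) →ₗ[ℤ] S := Finsupp.linearCombination ℤ fun
      | [] => 0
      | b :: v => y ^ (b : ℕ) * ev ys v
    have hr : ∀ x, Finsupp.linearCombination ℤ (ev (y :: ys)) x =
        Finsupp.linearCombination ℤ (ev ys) x + r x := fun x =>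
      words_hom_ext (g := Finsupp.linearCombination ℤ (ev ys) + r) (fun v => by
        rcases v with _ | ⟨b, v⟩ <;> simp [r, ev, ev_nil]) x
    have hc : ∀ (a : ℕ+) x, r (consL a x) = y ^ (a : ℕ) *
        Finsupp.linearCombination ℤ (ev ys) x := fun a x =>
      words_hom_ext (f := r ∘ₗ consL a)
        (g := LinearMap.mulLeft ℤ (y ^ (a : ℕ)) ∘ₗ Finsupp.linearCombination ℤ (ev ys))
        (fun v => by simp [r, consL_single]) x
    have hi : ∀ (a : ℕ+) x, r (incL a x) = y ^ (a : ℕ) * r x := fun a x =>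
      words_hom_ext (f := r ∘ₗ incL a) (g := LinearMap.mulLeft ℤ (y ^ (a : ℕ)) ∘ₗ r)
        (fun v => by
          rcases v with _ | ⟨b, v⟩
          · simp [r, incL_single_nil]
          · simp [r, incL_single_cons, pow_add, mul_assoc]) x
    refine IsQMul.step_inv (V := fun
      | [] => 1
      | a :: u => Finsupp.linearCombination ℤ (ev ys) (peakCoeff (a :: u)) +
          y ^ (a : ℕ) * Finsupp.linearCombination ℤ (ev ys) (peakCoeff u))
      (ih.step y rfl fun a u => rfl) (-y) (by simp [peakCoeff, ev]) fun a u => ?_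
    simp only [hr]
    rw [show r (peakCoeff (a :: u)) = _ by rw [peakCoeff, map_add, map_smul, map_smul, hc, hi]]
    rcases Nat.even_or_odd (a : ℕ) with ha | ha
    · rw [if_neg (Nat.not_odd_iff_even.2 ha), ha.neg_pow, pow_succ, ha.neg_one_pow]
      simp only [zero_smul, zsmul_eq_mul]; push_cast; ring
    · rw [if_pos ha, ha.neg_pow, pow_succ, ha.neg_one_pow]
      simp only [zsmul_eq_mul]; push_cast; ring

end

theorem peakT_isQMul : IsQMul peakT := by
  have h0 : ∀ N (x : List ℕ+ →₀ ℤ), Ideal.Quotient.mk (farIdeal N) (monLin x) =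
      Finsupp.linearCombination ℤ (ev ((List.range' 0 N).map fun i =>
        Ideal.Quotient.mk (farIdeal N) (MvPowerSeries.X i))) x := fun N x =>
    words_hom_ext
      (f := (Ideal.Quotient.mk (farIdeal N)).toAddMonoidHom.toIntLinearMap ∘ₗ monLin)
      (fun v => by
        simpa [monLin] using map_monomialQ (Ideal.Quotient.mk (farIdeal N))
          (fun f hf => Ideal.Quotient.eq_zero_iff_mem.2 hf) v) x
  refine ⟨by simp [peakT, peakCoeff, monLin, monomialQ_isQMul.nil], fun u w => ?_⟩
  rw [← sub_eq_zero]
  refine eq_zero_of_mem_farIdeal fun N => ?_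
  rw [← Ideal.Quotient.eq_zero_iff_mem, map_sub, map_mul, map_list_sum, List.map_map,
    Function.comp_def, sub_eq_zero]
  simp only [peakT, h0]
  exact (linearCombination_ev_isQMul _).mul u w

/-- For an even letter the `consL` term has coefficient zero, and `incL` annihilates the empty word;
the prefix then acts linearly on zero. -/
theorem peakCoeff_even_last {a : ℕ+} (ha : Even (a : ℕ)) : ∀ p : List ℕ+,
    peakCoeff (p ++ [a]) = 0
  | [] => by
    simp [peakCoeff, Nat.not_odd_iff_even.2 ha, incL_single_nil]
  | c :: p => by
    rw [List.cons_append, peakCoeff, peakCoeff_even_last ha p]; simp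

/-- Only the `incL a` term survives at an even a, with sign -1. Applied to the expansion at b it
gives the expansion at a + b, because a + b and b have the same parity. -/
theorem peakCoeff_even {a : ℕ+} (ha : Even (a : ℕ)) (b : ℕ+) (u : List ℕ+) : ∀ p : List ℕ+,
    peakCoeff (p ++ a :: b :: u) = -peakCoeff (p ++ (a + b) :: u)
  | [] => by
    have h1 : Odd ((a + b : ℕ+) : ℕ) ↔ Odd (b : ℕ) := by
      rw [PNat.add_coe]; exact Nat.odd_add'.trans (by simp [ha])
    simp only [List.nil_append, peakCoeff, if_neg (Nat.not_odd_iff_even.2 ha), h1, map_add,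
      map_smul, incL_consL, incL_incL]
    rw [PNat.add_coe, add_assoc, pow_add (-1 : ℤ) (a : ℕ) 1, pow_add (-1 : ℤ) (a : ℕ) ((b : ℕ) + 1), ha.neg_one_pow]
    module
  | c :: p => by
    rw [List.cons_append, peakCoeff, peakCoeff_even ha b u p, List.cons_append, peakCoeff]
    simp only [map_neg]
    module

theorem consL_apply_of_length {a : ℕ+} {x : List ℕ+ →₀ ℤ} {u : List ℕ+} {c : ℤ}
    (h : ∀ v, u.length ≤ v.length → x v = if v = u then c else 0) (v : List ℕ+)
    (hv : u.length + 1 ≤ v.length) : consL a x v = if v = a :: u then c else 0 := by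
  have h1 : ∀ b w, consL a x (b :: w) = if b = a then x w else 0 := fun b w =>
    words_hom_ext (f := Finsupp.lapply (b :: w) ∘ₗ consL a)
      (g := if b = a then Finsupp.lapply w else 0) (fun v => by
        by_cases hb : b = a
        · subst hb; simp [consL_single, Finsupp.single_apply]
        · simp [consL_single, hb]) x |>.trans (by
          split_ifs <;> simp)
  rcases v with _ | ⟨b, w⟩
  · simp at hv
  · rw [h1, h w (by simpa using hv)]
    by_cases hb : b = a <;> simp [hb]

theorem incL_apply_of_length {a : ℕ+} {x : List ℕ+ →₀ ℤ} {n : ℕ}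
    (h : ∀ v, n < v.length → x v = 0) (v : List ℕ+)
    (hv : n < v.length) : incL a x v = 0 := by
  rw [incL, Finsupp.linearCombination_apply, Finsupp.sum, Finsupp.finsetSum_apply]
  refine Finset.sum_eq_zero fun w hw => ?_
  rcases w with _ | ⟨b, w⟩
  · simp
  · rw [Finsupp.smul_apply, Finsupp.single_apply, if_neg, smul_zero]
    rintro rfl
    exact Finsupp.mem_support_iff.1 hw (h _ (by simpa using hv))

/-- Only `consL` lengthens a word, so full length is reached by choosing it at every letter, which
reproduces u with a factor 2 for each odd letter. -/
theorem peakCoeff_apply_of_length : ∀ {u : List ℕ+}, IsOdd u → ∀ v, u.length ≤ v.length →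
    peakCoeff u v = if v = u then 2 ^ u.length else 0
  | [], _, v, _ => by
    rw [peakCoeff, Finsupp.single_apply]; simp [eq_comm]
  | a :: u, hu, v, hv => by
    have ih := peakCoeff_apply_of_length (u := u) fun b hb => hu b (List.mem_cons_of_mem _ hb)
    rw [peakCoeff, Finsupp.add_apply, Finsupp.smul_apply, Finsupp.smul_apply,
      consL_apply_of_length ih v hv, incL_apply_of_length (n := u.length) _ v hv,
      if_pos (hu a List.mem_cons_self)]
    · by_cases h : v = a :: u
      · simp [h, pow_succ, mul_comm]
      · simp [h]
    · intro w hw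
      rw [ih w hw.le, if_neg]
      rintro rfl
      exact hw.false

/-! ## Compositions built by unit steps -/

/-- Adding `1` to the first letter. -/
def incHead : List ℕ+ → List ℕ+
  | [] => []
  | a :: u => (1 + a) :: u

theorem wt_incHead {w : List ℕ+} (h : w ≠ []) : wt (incHead w) = wt w + 1 := by
  cases w with
  | nil => exact absurd rfl h
  | cons a u => rw [incHead, wt_cons, wt_cons, PNat.add_coe, PNat.one_coe]; ring

theorem length_incHead (w : List ℕ+) : (incHead w).length = w.length := by
  cases w <;> simp [incHead]

theorem incHead_injective : Function.Injective incHead := by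
  intro u v h
  rcases u with _ | ⟨a, u⟩ <;> rcases v with _ | ⟨b, v⟩ <;> simp_all [incHead]

theorem cons_one_ne_incHead (u v : List ℕ+) : (1 : ℕ+) :: u ≠ incHead v := by
  rcases v with _ | ⟨b, v⟩
  · simp [incHead]
  · intro h
    have h1 := congrArg (fun c : ℕ+ => (c : ℕ)) (List.cons.inj h).1
    have := b.pos
    simp only [PNat.add_coe, PNat.one_coe] at h1
    omega

theorem word_cases {w : List ℕ+} (hw : w ≠ []) : w = [1] ∨ (∃ u, u ≠ [] ∧ w = 1 :: u) ∨
    ∃ u, u ≠ [] ∧ w = incHead u := by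
  rcases w with _ | ⟨a, u⟩
  · exact absurd rfl hw
  by_cases ha : a = 1
  · subst ha
    rcases eq_or_ne u [] with rfl | hu
    · exact Or.inl rfl
    · exact Or.inr (Or.inl ⟨u, hu, rfl⟩)
  · obtain ⟨b, rfl⟩ := PNat.exists_eq_succ_of_ne_one ha
    exact Or.inr (Or.inr ⟨b :: u, by simp, by rw [incHead, add_comm]⟩)

/-- With the descent set read as a string of bits, prefixing 1 and `incHead` each prepend one bit.
Two compositions of the same weight can therefore be unwound in parallel, one unit at a time. -/
theorem word_induction {p : List ℕ+ → Prop} (h1 : p [1])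
    (hc : ∀ w, w ≠ [] → p w → p (1 :: w)) (hi : ∀ w, w ≠ [] → p w → p (incHead w))
    (w : List ℕ+) (hw : w ≠ []) : p w := by
  induction hn : wt w using Nat.strong_induction_on generalizing w with
  | _ n ih =>
    rcases word_cases hw with rfl | ⟨u, hu, rfl⟩ | ⟨u, hu, rfl⟩
    · exact h1
    · exact hc u hu (ih (wt u) (by rw [wt_cons, PNat.one_coe] at hn; omega) u hu rfl)
    · exact hi u hu (ih (wt u) (by rw [wt_incHead hu] at hn; omega) u hu rfl)

theorem mem_descentSet_incHead (w : List ℕ+) (j : ℕ) :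
    j ∈ descentSet (incHead w) ↔ ∃ i ∈ descentSet w, j = i + 1 := by
  rcases w with _ | ⟨a, u⟩
  · simp [incHead, descentSet]
  · simp only [incHead, mem_descentSet_cons, PNat.add_coe, PNat.one_coe]
    constructor
    · rintro ⟨hu, rfl | ⟨i, hi, rfl⟩⟩
      · exact ⟨a, ⟨hu, Or.inl rfl⟩, by ring⟩
      · exact ⟨a + i, ⟨hu, Or.inr ⟨i, hi, rfl⟩⟩, by ring⟩
    · rintro ⟨k, ⟨hu, rfl | ⟨i, hi, rfl⟩⟩, rfl⟩
      · exact ⟨hu, Or.inl (by ring)⟩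
      · exact ⟨hu, Or.inr ⟨i, hi, by ring⟩⟩

theorem succ_mem_descentSet_incHead (w : List ℕ+) (i : ℕ) :
    i + 1 ∈ descentSet (incHead w) ↔ i ∈ descentSet w := by
  rw [mem_descentSet_incHead]; simp

theorem mem_descentSet_one_cons {w : List ℕ+} (hw : w ≠ []) (j : ℕ) :
    j ∈ descentSet (1 :: w) ↔ j = 1 ∨ ∃ i ∈ descentSet w, j = i + 1 := by
  simp [mem_descentSet_cons, hw, add_comm]

theorem succ_mem_descentSet_one_cons {w : List ℕ+} (hw : w ≠ []) {i : ℕ} (hi : i ≠ 0) :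
    i + 1 ∈ descentSet (1 :: w) ↔ i ∈ descentSet w := by
  rw [mem_descentSet_one_cons hw]; simp [hi]

theorem zero_notMem_descentSet (w : List ℕ+) : 0 ∉ descentSet w := fun h =>
  (descentSet_pos w h).false

theorem one_notMem_descentSet_incHead (w : List ℕ+) : 1 ∉ descentSet (incHead w) := by
  rw [← zero_add 1, succ_mem_descentSet_incHead]; exact zero_notMem_descentSet w

/-- The compositions of the same weight that refine `w`. -/
def refinements (w : List ℕ+) : Finset (List ℕ+) :=
  (comps (wt w)).filter fun v => descentSet w ⊆ descentSet v

theorem mem_refinements {w v : List ℕ+} :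
    v ∈ refinements w ↔ wt v = wt w ∧ descentSet w ⊆ descentSet v := by
  rw [refinements, Finset.mem_filter, mem_comps]

theorem ne_nil_of_wt {v : List ℕ+} (h : 0 < wt v) : v ≠ [] := by
  rintro rfl; simp [wt] at h

theorem descentSet_singleton (a : ℕ+) : descentSet [a] = ∅ := by simp [descentSet]

theorem refinements_one : refinements [1] = {[1]} := by
  ext v
  rw [mem_refinements, Finset.mem_singleton]
  constructor
  · rintro ⟨h, -⟩
    have h0 : wt [1] = 1 := by simp [wt]
    rw [h0] at h
    rcases word_cases (ne_nil_of_wt (by omega : 0 < wt v)) with rfl | ⟨u, hu, rfl⟩ | ⟨u, hu, rfl⟩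
    · rfl
    · have := wt_pos_of_ne_nil hu
      rw [wt_cons, PNat.one_coe] at h; omega
    · have := wt_pos_of_ne_nil hu
      rw [wt_incHead hu] at h; omega
  · rintro rfl
    exact ⟨rfl, subset_rfl⟩

theorem refinements_one_cons {w : List ℕ+} (hw : w ≠ []) :
    refinements (1 :: w) = (refinements w).image (1 :: ·) := by
  ext v
  have hw' := wt_pos_of_ne_nil hw
  rw [mem_refinements, Finset.mem_image]
  constructor
  · rintro ⟨h, hs⟩
    rw [wt_cons, PNat.one_coe] at h
    rcases word_cases (ne_nil_of_wt (by omega : 0 < wt v)) with rfl | ⟨u, hu, rfl⟩ | ⟨u, hu, rfl⟩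
    · simp [wt] at h hw'; omega
    · rw [wt_cons, PNat.one_coe] at h
      refine ⟨u, mem_refinements.2 ⟨by omega, fun i hi => ?_⟩, rfl⟩
      have hi0 := descentSet_pos w hi
      rw [← succ_mem_descentSet_one_cons hu hi0.ne']
      exact hs ((succ_mem_descentSet_one_cons hw hi0.ne').2 hi)
    · exact absurd (hs ((mem_descentSet_one_cons hw 1).2 (Or.inl rfl)))
        (one_notMem_descentSet_incHead u)
  · rintro ⟨u, hu, rfl⟩
    obtain ⟨h, hs⟩ := mem_refinements.1 hu
    have hu0 : u ≠ [] := ne_nil_of_wt (by omega)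
    refine ⟨by rw [wt_cons, wt_cons, h], fun i hi => ?_⟩
    rw [mem_descentSet_one_cons hw] at hi
    rw [mem_descentSet_one_cons hu0]
    rcases hi with rfl | ⟨k, hk, rfl⟩
    · exact Or.inl rfl
    · exact Or.inr ⟨k, hs hk, rfl⟩

/-- The position 1 is not a descent of `incHead w`, so a refinement may or may not have a descent
there. For `1 :: w` that descent is forced. -/
theorem refinements_incHead {w : List ℕ+} (hw : w ≠ []) : refinements (incHead w) =
    (refinements w).image (1 :: ·) ∪ (refinements w).image incHead := by
  ext v
  have hw' := wt_pos_of_ne_nil hw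
  rw [mem_refinements, Finset.mem_union, Finset.mem_image, Finset.mem_image, wt_incHead hw]
  constructor
  · rintro ⟨h, hs⟩
    rcases word_cases (ne_nil_of_wt (by omega : 0 < wt v)) with rfl | ⟨u, hu, rfl⟩ | ⟨u, hu, rfl⟩
    · simp [wt] at h hw'; omega
    · rw [wt_cons, PNat.one_coe] at h
      refine Or.inl ⟨u, mem_refinements.2 ⟨by omega, fun i hi => ?_⟩, rfl⟩
      rw [← succ_mem_descentSet_one_cons hu (descentSet_pos w hi).ne']
      exact hs ((succ_mem_descentSet_incHead w i).2 hi)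
    · rw [wt_incHead hu] at h
      refine Or.inr ⟨u, mem_refinements.2 ⟨by omega, fun i hi => ?_⟩, rfl⟩
      rw [← succ_mem_descentSet_incHead]
      exact hs ((succ_mem_descentSet_incHead w i).2 hi)
  · rintro (⟨u, hu, rfl⟩ | ⟨u, hu, rfl⟩) <;> obtain ⟨h, hs⟩ := mem_refinements.1 hu <;>
      have hu0 : u ≠ [] := ne_nil_of_wt (by omega)
    · refine ⟨by rw [wt_cons, h, PNat.one_coe, add_comm], fun i hi => ?_⟩
      obtain ⟨k, hk, rfl⟩ := (mem_descentSet_incHead w i).1 hi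
      rw [succ_mem_descentSet_one_cons hu0 (descentSet_pos w hk).ne']
      exact hs hk
    · refine ⟨by rw [wt_incHead hu0, h], fun i hi => ?_⟩
      obtain ⟨k, hk, rfl⟩ := (mem_descentSet_incHead w i).1 hi
      rw [succ_mem_descentSet_incHead]
      exact hs hk

section
variable {M : Type*} [AddCommMonoid M] (f : List ℕ+ → M)

theorem sum_refinements_one_cons {w : List ℕ+} (hw : w ≠ []) :
    ∑ u ∈ refinements (1 :: w), f u = ∑ u ∈ refinements w, f (1 :: u) := by
  rw [refinements_one_cons hw, Finset.sum_image (by simp)]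

theorem sum_refinements_incHead {w : List ℕ+} (hw : w ≠ []) :
    ∑ u ∈ refinements (incHead w), f u =
      ∑ u ∈ refinements w, f (1 :: u) + ∑ u ∈ refinements w, f (incHead u) := by
  rw [refinements_incHead hw, Finset.sum_union, Finset.sum_image (by simp),
    Finset.sum_image fun _ _ _ _ h => incHead_injective h]
  rw [Finset.disjoint_left]
  intro v h1 h2
  obtain ⟨a, -, rfl⟩ := Finset.mem_image.1 h1
  obtain ⟨b, -, h⟩ := Finset.mem_image.1 h2
  exact cons_one_ne_incHead a b h.symm

end

theorem exists_descentSet_eq : ∀ (n : ℕ) (D : Finset ℕ), (∀ i ∈ D, 0 < i ∧ i < n) →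
    ∃ w, wt w = n ∧ descentSet w = D
  | 0, D, h => ⟨[], by simp [wt], by
      rw [show descentSet [] = ∅ by simp [descentSet], eq_comm, Finset.eq_empty_iff_forall_notMem]
      intro i hi; have := h i hi; omega⟩
  | 1, D, h => ⟨[1], by simp [wt], by
      rw [descentSet_singleton, eq_comm, Finset.eq_empty_iff_forall_notMem]
      intro i hi; have := h i hi; omega⟩
  | n + 2, D, h => by
    obtain ⟨w, hw, hwD⟩ := exists_descentSet_eq (n + 1)
      ((Finset.Ico 1 (n + 1)).filter fun i => i + 1 ∈ D) (by
        intro i hi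
        have := Finset.mem_Ico.1 (Finset.mem_filter.1 hi).1
        omega)
    have hw0 : w ≠ [] := ne_nil_of_wt (by omega)
    have hD : ∀ i, i ∈ descentSet w ↔ (1 ≤ i ∧ i < n + 1) ∧ i + 1 ∈ D := by
      intro i; rw [hwD, Finset.mem_filter, Finset.mem_Ico]
    by_cases h1 : 1 ∈ D
    · refine ⟨1 :: w, by rw [wt_cons, hw, PNat.one_coe]; ring, ?_⟩
      ext j
      rw [mem_descentSet_one_cons hw0]
      constructor
      · rintro (rfl | ⟨i, hi, rfl⟩)
        · exact h1
        · exact ((hD i).1 hi).2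
      · intro hj
        have h2 := h j hj
        by_cases hj1 : j = 1
        · exact Or.inl hj1
        · refine Or.inr ⟨j - 1, (hD _).2 ⟨by omega, ?_⟩, by omega⟩
          rwa [Nat.sub_add_cancel (by omega)]
    · refine ⟨incHead w, by rw [wt_incHead hw0, hw], ?_⟩
      ext j
      rw [mem_descentSet_incHead]
      constructor
      · rintro ⟨i, hi, rfl⟩
        exact ((hD i).1 hi).2
      · intro hj
        have h2 := h j hj
        have hj1 : j ≠ 1 := by rintro rfl; exact h1 hj
        refine ⟨j - 1, (hD _).2 ⟨by omega, ?_⟩, by omega⟩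
        rwa [Nat.sub_add_cancel (by omega)]

/-! ## The peak condition -/

/-- Each peak of `w` is met by a descent of `v`, at the peak or just before it. -/
def Meets (w v : List ℕ+) : Prop :=
  ∀ p ∈ peakSet w, p ∈ descentSet v ∨ p - 1 ∈ descentSet v

instance (w v : List ℕ+) : Decidable (Meets w v) :=
  inferInstanceAs (Decidable (∀ p ∈ peakSet w, p ∈ descentSet v ∨ p - 1 ∈ descentSet v))

theorem mem_peakSet {w : List ℕ+} {i : ℕ} :
    i ∈ peakSet w ↔ i ∈ descentSet w ∧ 2 ≤ i ∧ i - 1 ∉ descentSet w := by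
  rw [peakSet, Finset.mem_filter]

theorem succ_mem_peakSet_one_cons {w : List ℕ+} (hw : w ≠ []) (i : ℕ) :
    i + 1 ∈ peakSet (1 :: w) ↔ i ∈ peakSet w := by
  rw [mem_peakSet, mem_peakSet, Nat.add_sub_cancel]
  rcases i with _ | _ | i
  · simp
  · simp [mem_descentSet_one_cons hw]
  · rw [succ_mem_descentSet_one_cons hw (by omega), succ_mem_descentSet_one_cons hw (by omega)]
    simp

theorem succ_mem_peakSet_incHead (w : List ℕ+) (i : ℕ) :
    i + 1 ∈ peakSet (incHead w) ↔ i ∈ peakSet w ∨ (i = 1 ∧ 1 ∈ descentSet w) := by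
  rw [mem_peakSet, mem_peakSet, Nat.add_sub_cancel, succ_mem_descentSet_incHead]
  rcases i with _ | _ | i
  · simp [zero_notMem_descentSet]
  · simp [one_notMem_descentSet_incHead]
  · rw [succ_mem_descentSet_incHead]
    simp

theorem forall_peakSet {w : List ℕ+} {p : ℕ → Prop} :
    (∀ i ∈ peakSet w, p i) ↔ ∀ i, 1 ≤ i → i + 1 ∈ peakSet w → p (i + 1) := by
  constructor
  · exact fun h i _ hi => h _ hi
  · intro h i hi
    have := (mem_peakSet.1 hi).2.1
    obtain ⟨j, rfl⟩ : ∃ j, i = j + 1 := ⟨i - 1, by omega⟩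
    exact h j (by omega) hi

theorem two_le_of_mem_peakSet {w : List ℕ+} {i : ℕ} (hi : i ∈ peakSet w) : 2 ≤ i :=
  (mem_peakSet.1 hi).2.1

theorem meets_one_cons {w v : List ℕ+} (hw : w ≠ []) (hv : v ≠ []) :
    Meets (1 :: w) (1 :: v) ↔ Meets w v := by
  rw [Meets, forall_peakSet, Meets]
  simp only [succ_mem_peakSet_one_cons hw]
  constructor
  · intro h i hi
    have h2 := two_le_of_mem_peakSet hi
    have := h i (by omega) hi
    obtain ⟨j, rfl⟩ : ∃ j, i = j + 1 := ⟨i - 1, by omega⟩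
    rwa [Nat.add_sub_cancel, succ_mem_descentSet_one_cons hv (by omega),
      succ_mem_descentSet_one_cons hv (by omega)] at this
  · intro h i _ hi
    have h2 := two_le_of_mem_peakSet hi
    have := h i hi
    obtain ⟨j, rfl⟩ : ∃ j, i = j + 1 := ⟨i - 1, by omega⟩
    rwa [Nat.add_sub_cancel, succ_mem_descentSet_one_cons hv (by omega),
      succ_mem_descentSet_one_cons hv (by omega)]

theorem meets_one_cons_incHead {w v : List ℕ+} (hw : w ≠ []) :
    Meets (1 :: w) (incHead v) ↔ Meets w v := by
  rw [Meets, forall_peakSet, Meets]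
  simp only [succ_mem_peakSet_one_cons hw]
  constructor
  · intro h i hi
    have h2 := two_le_of_mem_peakSet hi
    have := h i (by omega) hi
    obtain ⟨j, rfl⟩ : ∃ j, i = j + 1 := ⟨i - 1, by omega⟩
    rwa [Nat.add_sub_cancel, succ_mem_descentSet_incHead, succ_mem_descentSet_incHead] at this
  · intro h i _ hi
    have h2 := two_le_of_mem_peakSet hi
    have := h i hi
    obtain ⟨j, rfl⟩ : ∃ j, i = j + 1 := ⟨i - 1, by omega⟩
    rwa [Nat.add_sub_cancel, succ_mem_descentSet_incHead, succ_mem_descentSet_incHead]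

theorem meets_incHead_one_cons {w v : List ℕ+} (hv : v ≠ []) :
    Meets (incHead w) (1 :: v) ↔ Meets w v := by
  rw [Meets, forall_peakSet, Meets]
  simp only [succ_mem_peakSet_incHead]
  constructor
  · intro h i hi
    have h2 := two_le_of_mem_peakSet hi
    have := h i (by omega) (Or.inl hi)
    obtain ⟨j, rfl⟩ : ∃ j, i = j + 1 := ⟨i - 1, by omega⟩
    rwa [Nat.add_sub_cancel, succ_mem_descentSet_one_cons hv (by omega),
      succ_mem_descentSet_one_cons hv (by omega)] at this
  · rintro h i _ (hi | ⟨rfl, hi⟩)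
    · have h2 := two_le_of_mem_peakSet hi
      have := h i hi
      obtain ⟨j, rfl⟩ : ∃ j, i = j + 1 := ⟨i - 1, by omega⟩
      rwa [Nat.add_sub_cancel, succ_mem_descentSet_one_cons hv (by omega),
        succ_mem_descentSet_one_cons hv (by omega)]
    · exact Or.inr ((mem_descentSet_one_cons hv _).2 (Or.inl rfl))

/-- A descent of w at 1 becomes a new peak of `incHead w` at 2. As `incHead v` has no descent at 1,
this peak must be met at 2, that is, by a descent of v at 1. -/
theorem meets_incHead {w v : List ℕ+} :
    Meets (incHead w) (incHead v) ↔ Meets w v ∧ (1 ∈ descentSet w → 1 ∈ descentSet v) := by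
  rw [Meets, forall_peakSet, Meets]
  simp only [succ_mem_peakSet_incHead]
  constructor
  · refine fun h => ⟨fun i hi => ?_, fun h1 => ?_⟩
    · have h2 := two_le_of_mem_peakSet hi
      have := h i (by omega) (Or.inl hi)
      obtain ⟨j, rfl⟩ : ∃ j, i = j + 1 := ⟨i - 1, by omega⟩
      rwa [Nat.add_sub_cancel, succ_mem_descentSet_incHead, succ_mem_descentSet_incHead] at this
    · have := h 1 le_rfl (Or.inr ⟨rfl, h1⟩)
      rw [succ_mem_descentSet_incHead, Nat.add_sub_cancel] at this
      exact this.resolve_right (one_notMem_descentSet_incHead v)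
  · rintro ⟨h, h1⟩ i _ (hi | ⟨rfl, hi⟩)
    · have h2 := two_le_of_mem_peakSet hi
      have := h i hi
      obtain ⟨j, rfl⟩ : ∃ j, i = j + 1 := ⟨i - 1, by omega⟩
      rwa [Nat.add_sub_cancel, succ_mem_descentSet_incHead, succ_mem_descentSet_incHead]
    · exact Or.inl ((succ_mem_descentSet_incHead v 1).2 (h1 hi))

/-! ## The descent-to-peak map on the fundamental quasisymmetric functions -/

/-- The companion of `peakCoeff` with the parity of the first letter changed. -/
def peakCoeff' : List ℕ+ → (List ℕ+ →₀ ℤ)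
  | [] => 0
  | a :: u => (if Odd (a : ℕ) then 0 else 2 : ℤ) • consL a (peakCoeff u) -
      (-1 : ℤ) ^ ((a : ℕ) + 1) • incL a (peakCoeff u)

theorem peakCoeff_one_cons (u : List ℕ+) :
    peakCoeff (1 :: u) = (2 : ℤ) • consL 1 (peakCoeff u) + incL 1 (peakCoeff u) := by
  rw [peakCoeff, PNat.one_coe, if_pos odd_one]
  norm_num

theorem peakCoeff'_one_cons (u : List ℕ+) :
    peakCoeff' (1 :: u) = -incL 1 (peakCoeff u) := by
  rw [peakCoeff', PNat.one_coe, if_pos odd_one]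
  norm_num

/-- Adding 1 to the first letter changes its parity, so `incHead` interchanges `peakCoeff` and
`peakCoeff'`. The companion is what closes the recursion on unit steps. -/
theorem peakCoeff_incHead {u : List ℕ+} (hu : u ≠ []) :
    peakCoeff (incHead u) = incL 1 (peakCoeff' u) := by
  rcases u with _ | ⟨a, u⟩
  · exact absurd rfl hu
  rw [incHead, peakCoeff, peakCoeff', map_sub, map_smul, map_smul, incL_consL, incL_incL,
    PNat.add_coe, PNat.one_coe]
  have h : Odd (1 + (a : ℕ)) ↔ ¬ Odd (a : ℕ) := by
    rw [add_comm, Nat.odd_add_one]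
  rw [show 1 + (a : ℕ) + 1 = (a : ℕ) + 1 + 1 by ring, pow_succ _ ((a : ℕ) + 1)]
  by_cases ha : Odd (a : ℕ) <;> simp [h, ha, sub_eq_add_neg]

theorem peakCoeff'_incHead {u : List ℕ+} (hu : u ≠ []) :
    peakCoeff' (incHead u) = incL 1 (peakCoeff u) := by
  rcases u with _ | ⟨a, u⟩
  · exact absurd rfl hu
  rw [incHead, peakCoeff, peakCoeff', map_add, map_smul, map_smul, incL_consL, incL_incL,
    PNat.add_coe, PNat.one_coe]
  have h : Odd (1 + (a : ℕ)) ↔ ¬ Odd (a : ℕ) := by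
    rw [add_comm, Nat.odd_add_one]
  rw [show 1 + (a : ℕ) + 1 = (a : ℕ) + 1 + 1 by ring, pow_succ _ ((a : ℕ) + 1)]
  by_cases ha : Odd (a : ℕ) <;> simp [h, ha]

theorem consL_one_apply_one_cons (x : List ℕ+ →₀ ℤ) (v : List ℕ+) :
    consL 1 x (1 :: v) = x v :=
  words_hom_ext (f := Finsupp.lapply (1 :: v) ∘ₗ consL 1) (g := Finsupp.lapply v)
    (fun w => by simp [consL_single, Finsupp.single_apply]) x

theorem consL_one_apply_incHead (x : List ℕ+ →₀ ℤ) (v : List ℕ+) :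
    consL 1 x (incHead v) = 0 :=
  words_hom_ext (f := Finsupp.lapply (incHead v) ∘ₗ consL 1) (g := 0)
    (fun w => by simp [consL_single, cons_one_ne_incHead]) x

theorem incL_one_apply_one_cons (x : List ℕ+ →₀ ℤ) (v : List ℕ+) :
    incL 1 x (1 :: v) = 0 :=
  words_hom_ext (f := Finsupp.lapply (1 :: v) ∘ₗ incL 1) (g := 0)
    (fun w => by
      rcases w with _ | ⟨b, w⟩
      · simp [incL_single_nil]
      · have := cons_one_ne_incHead v (b :: w)
        rw [incHead] at this
        rw [LinearMap.comp_apply, incL_single_cons, Finsupp.lapply_apply, Finsupp.single_apply,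
          if_neg this.symm, LinearMap.zero_apply]) x

theorem incL_one_apply_incHead (x : List ℕ+ →₀ ℤ) {v : List ℕ+} (hv : v ≠ []) :
    incL 1 x (incHead v) = x v :=
  words_hom_ext (f := Finsupp.lapply (incHead v) ∘ₗ incL 1) (g := Finsupp.lapply v)
    (fun w => by
      rcases w with _ | ⟨b, w⟩
      · simp [incL_single_nil, hv.symm]
      · have : (1 + b) :: w = incHead v ↔ b :: w = v :=
          ⟨fun h => incHead_injective (a₁ := b :: w) h, fun h => by rw [← h, incHead]⟩
        rw [LinearMap.comp_apply, incL_single_cons, Finsupp.lapply_apply, Finsupp.lapply_apply,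
          Finsupp.single_apply, Finsupp.single_apply]
        simp only [this]) x

/-- Both sums are computed together by induction on unit steps. At `incHead w` and `incHead u` they
are added: the second cancels the first exactly when w has a descent at 1 and u has none, which is
the extra condition in `meets_incHead`. -/
theorem sum_refinements_peakCoeff (w : List ℕ+) (hw : w ≠ []) : ∀ v, wt v = wt w →
    (∑ u ∈ refinements w, peakCoeff u) v = (if Meets w v then 2 ^ v.length else 0) ∧
    (∑ u ∈ refinements w, peakCoeff' u) v = if 1 ∈ descentSet w ∧ 1 ∉ descentSet v then
      -(if Meets w v then 2 ^ v.length else 0) else 0 := by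
  refine word_induction (p := fun w => ∀ v, wt v = wt w →
    (∑ u ∈ refinements w, peakCoeff u) v = (if Meets w v then 2 ^ v.length else 0) ∧
    (∑ u ∈ refinements w, peakCoeff' u) v = if 1 ∈ descentSet w ∧ 1 ∉ descentSet v then
      -(if Meets w v then 2 ^ v.length else 0) else 0) ?_ ?_ ?_ w hw
  · intro v hv
    have h0 : v ∈ refinements [1] := mem_refinements.2 ⟨hv, by simp [descentSet_singleton]⟩
    rw [refinements_one, Finset.mem_singleton] at h0
    subst h0
    have h1 : Meets [1] [1] := by
      intro p hp
      rw [mem_peakSet, descentSet_singleton] at hp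
      simp at hp
    rw [refinements_one, Finset.sum_singleton, Finset.sum_singleton, peakCoeff_one_cons,
      peakCoeff'_one_cons, if_pos h1]
    simp [peakCoeff, consL_single, incL_single_nil, descentSet_singleton]
  · intro w hw ih v hv
    rw [sum_refinements_one_cons _ hw, sum_refinements_one_cons _ hw]
    simp only [peakCoeff_one_cons, peakCoeff'_one_cons, Finset.sum_add_distrib, ← Finset.smul_sum,
      ← map_sum, Finset.sum_neg_distrib, Finsupp.add_apply, Finsupp.smul_apply, Finsupp.neg_apply]
    have hw' := wt_pos_of_ne_nil hw
    rw [wt_cons, PNat.one_coe] at hv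
    rcases word_cases (ne_nil_of_wt (by omega : 0 < wt v)) with rfl | ⟨u, hu, rfl⟩ | ⟨u, hu, rfl⟩
    · simp [wt] at hv hw'; omega
    · rw [wt_cons, PNat.one_coe] at hv
      rw [consL_one_apply_one_cons, incL_one_apply_one_cons, (ih u (by omega)).1]
      simp only [meets_one_cons hw hu, mem_descentSet_one_cons hu]
      simp [pow_succ, mul_comm]
    · rw [wt_incHead hu] at hv
      rw [consL_one_apply_incHead, incL_one_apply_incHead _ hu, (ih u (by omega)).1]
      simp only [meets_one_cons_incHead hw, mem_descentSet_one_cons hw,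
        one_notMem_descentSet_incHead, length_incHead]
      simp
  · intro w hw ih v hv
    rw [sum_refinements_incHead _ hw, sum_refinements_incHead _ hw]
    have e1 : ∑ u ∈ refinements w, peakCoeff (incHead u) =
        ∑ u ∈ refinements w, incL 1 (peakCoeff' u) :=
      Finset.sum_congr rfl fun u hu => peakCoeff_incHead (ne_nil_of_wt (by
        rw [(mem_refinements.1 hu).1]; exact wt_pos_of_ne_nil hw))
    have e2 : ∑ u ∈ refinements w, peakCoeff' (incHead u) =
        ∑ u ∈ refinements w, incL 1 (peakCoeff u) :=
      Finset.sum_congr rfl fun u hu => peakCoeff'_incHead (ne_nil_of_wt (by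
        rw [(mem_refinements.1 hu).1]; exact wt_pos_of_ne_nil hw))
    rw [e1, e2]
    simp only [peakCoeff_one_cons, peakCoeff'_one_cons, Finset.sum_add_distrib, ← Finset.smul_sum,
      ← map_sum, Finset.sum_neg_distrib, Finsupp.add_apply, Finsupp.smul_apply,
      neg_add_cancel, one_notMem_descentSet_incHead, false_and, if_false]
    have hw' := wt_pos_of_ne_nil hw
    rw [wt_incHead hw] at hv
    rcases word_cases (ne_nil_of_wt (by omega : 0 < wt v)) with rfl | ⟨u, hu, rfl⟩ | ⟨u, hu, rfl⟩
    · simp [wt] at hv hw'; omega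
    · rw [wt_cons, PNat.one_coe] at hv
      rw [consL_one_apply_one_cons, incL_one_apply_one_cons, incL_one_apply_one_cons,
        (ih u (by omega)).1]
      simp only [meets_incHead_one_cons hu]
      simp [pow_succ, mul_comm]
    · rw [wt_incHead hu] at hv
      rw [consL_one_apply_incHead, incL_one_apply_incHead _ hu, incL_one_apply_incHead _ hu,
        (ih u (by omega)).1, (ih u (by omega)).2]
      simp only [meets_incHead, length_incHead]
      by_cases h1 : 1 ∈ descentSet w <;> by_cases h2 : 1 ∈ descentSet u <;> simp [h1, h2]

/-! ## The peak functions in terms of monomial quasisymmetric functions -/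

/-- Each p halves the number of admissible subsets: if p or p - 1 is an element e of U, toggling e
reverses the condition at p, and it leaves the other conditions alone because P has no two
consecutive elements. If neither lies in U, no subset of U is admissible. -/
theorem card_filter_xor (U : Finset ℕ) (P : Finset ℕ) : (∀ p ∈ P, 1 ≤ p ∧ p - 1 ∉ P) →
    2 ^ P.card * (U.powerset.filter fun S => ∀ p ∈ P, ¬(p ∈ S ↔ p - 1 ∈ S)).card =
      if ∀ p ∈ P, p ∈ U ∨ p - 1 ∈ U then 2 ^ U.card else 0 := by
  induction P using Finset.induction_on with
  | empty => simp
  | insert p P hp ih =>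
    intro hP
    have ih := ih fun q hq => ⟨(hP q (Finset.mem_insert_of_mem hq)).1, fun h =>
      (hP q (Finset.mem_insert_of_mem hq)).2 (Finset.mem_insert_of_mem h)⟩
    by_cases hU : p ∈ U ∨ p - 1 ∈ U
    · obtain ⟨e, he, heU⟩ : ∃ e, (e = p ∨ e = p - 1) ∧ e ∈ U := by
        rcases hU with h | h
        · exact ⟨p, Or.inl rfl, h⟩
        · exact ⟨p - 1, Or.inr rfl, h⟩
      have hp1 := hP p (Finset.mem_insert_self _ _)
      have heP : ∀ q ∈ P, q ≠ e ∧ q - 1 ≠ e := by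
        intro q hq
        have h1 := hP q (Finset.mem_insert_of_mem hq)
        have h2 : q ≠ p := fun h => hp (h ▸ hq)
        have h3 : q - 1 ≠ p := fun h => h1.2 (h ▸ Finset.mem_insert_self _ _)
        have h4 : q ≠ p - 1 := fun h => hp1.2 (h ▸ Finset.mem_insert_of_mem hq)
        rcases he with rfl | rfl <;> omega
      let A := U.powerset.filter fun S => ∀ q ∈ P, ¬(q ∈ S ↔ q - 1 ∈ S)
      let τ : Finset ℕ → Finset ℕ := fun S => symmDiff S {e}
      have hτ : ∀ S, τ (τ S) = S := fun S => by simp [τ]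
      have hmem : ∀ S j, j ∈ τ S ↔ ¬(j ∈ S ↔ j = e) := by
        intro S j
        simp only [τ, Finset.mem_symmDiff, Finset.mem_singleton]
        tauto
      have hA : ∀ S ∈ A, τ S ∈ A := by
        intro S hS
        obtain ⟨h1, h2⟩ := Finset.mem_filter.1 hS
        refine Finset.mem_filter.2 ⟨Finset.mem_powerset.2 fun j hj => ?_, fun q hq => ?_⟩
        · rw [hmem] at hj
          by_cases hje : j = e
          · exact hje ▸ heU
          · by_contra hjU
            exact hj (iff_of_false (fun hjS => hjU (Finset.mem_powerset.1 h1 hjS)) hje)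
        · simp only [hmem, (heP q hq).1, (heP q hq).2, iff_false, not_not]
          exact h2 q hq
      have hpe : p - 1 ≠ p := by omega
      have hX : ∀ S, (p ∈ τ S ↔ p - 1 ∈ τ S) ↔ ¬(p ∈ S ↔ p - 1 ∈ S) := by
        intro S
        rw [hmem, hmem]
        rcases he with he | he <;> by_cases h1 : p ∈ S <;> by_cases h2 : p - 1 ∈ S <;>
          simp [he, h1, h2, hpe, hpe.symm]
      have hcard : (A.filter fun S => ¬(p ∈ S ↔ p - 1 ∈ S)).card =
          (A.filter fun S => (p ∈ S ↔ p - 1 ∈ S)).card := by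
        refine Finset.card_nbij' τ τ ?_ ?_ (fun S _ => hτ S) (fun S _ => hτ S)
        · intro S hS
          simp only [Finset.coe_filter, Set.mem_ofPred_eq] at hS ⊢
          exact ⟨hA S hS.1, (hX S).2 hS.2⟩
        · intro S hS
          simp only [Finset.coe_filter, Set.mem_ofPred_eq] at hS ⊢
          exact ⟨hA S hS.1, fun h => (hX S).1 h hS.2⟩
      have hsum := Finset.card_filter_add_card_filter_not (s := A) fun S => (p ∈ S ↔ p - 1 ∈ S)
      have hfil : (U.powerset.filter fun S => ∀ q ∈ insert p P, ¬(q ∈ S ↔ q - 1 ∈ S)) =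
          A.filter fun S => ¬(p ∈ S ↔ p - 1 ∈ S) := by
        ext S
        simp only [A, Finset.mem_filter, Finset.forall_mem_insert]
        exact ⟨fun h => ⟨⟨h.1, h.2.2⟩, h.2.1⟩, fun h => ⟨h.1.1, h.2, h.1.2⟩⟩
      have hif : (∀ q ∈ insert p P, q ∈ U ∨ q - 1 ∈ U) ↔ ∀ q ∈ P, q ∈ U ∨ q - 1 ∈ U := by
        rw [Finset.forall_mem_insert, and_iff_right hU]
      rw [hfil, Finset.card_insert_of_notMem hp, pow_succ]
      simp only [hif]
      rw [← ih]
      change _ = 2 ^ P.card * A.card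
      rw [← hsum, hcard]; ring
    · rw [if_neg fun h => hU (h p (Finset.mem_insert_self _ _)), Finset.filter_false_of_mem,
        Finset.card_empty, mul_zero]
      intro S hS h
      have h1 := Finset.mem_powerset.1 hS
      refine h p (Finset.mem_insert_self _ _) ⟨fun h2 => ?_, fun h2 => ?_⟩
      · exact absurd (Or.inl (h1 h2)) hU
      · exact absurd (Or.inr (h1 h2)) hU

theorem card_descentSet : ∀ {v : List ℕ+}, v ≠ [] → (descentSet v).card + 1 = v.length
  | [], h => absurd rfl h
  | a :: v, _ => by
    rcases eq_or_ne v [] with rfl | hv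
    · simp [descentSet_singleton]
    · have h : descentSet (a :: v) = insert (a : ℕ) ((descentSet v).image ((a : ℕ) + ·)) := by
        ext j
        rw [mem_descentSet_cons, Finset.mem_insert, Finset.mem_image]
        simp [hv, eq_comm]
      rw [h, Finset.card_insert_of_notMem, Finset.card_image_of_injective _ (add_right_injective _),
        card_descentSet hv, List.length_cons]
      intro h
      obtain ⟨i, hi, h⟩ := Finset.mem_image.1 h
      have := descentSet_pos v hi
      omega

/-- The F_u that contribute correspond to the subsets D(u) of D(v) that contain exactly one of p, p
- 1 for each peak p. When all peaks are met there are 2^(|D(v)| - |P|) of them; the prefactor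
2^(|P|+1) turns this into 2^(|D(v)|+1), and |D(v)| + 1 is the length of v. -/
theorem coeff_expo_peakK {w v : List ℕ+} (hw : w ≠ []) :
    MvPowerSeries.coeff (expo v) (peakK (wt w) (peakSet w)) =
      if wt v = wt w ∧ Meets w v then 2 ^ v.length else 0 := by
  rw [peakK, show (2 : PS) ^ ((peakSet w).card + 1) = ((2 ^ ((peakSet w).card + 1) : ℕ) : PS) by
    push_cast; rfl, ← nsmul_eq_mul, map_nsmul, map_sum]
  simp only [coeff_expo_fundamentalQ]
  by_cases hv : wt v = wt w
  · have hv0 : v ≠ [] := ne_nil_of_wt (by rw [hv]; exact wt_pos_of_ne_nil hw)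
    have hP : ∀ p ∈ peakSet w, 1 ≤ p ∧ p - 1 ∉ peakSet w := fun p hp => by
      have := isPeakSubset_peakSet w p hp
      exact ⟨by omega, this.2.2⟩
    rw [← Finset.sum_filter, Finset.sum_const, Finset.filter_filter]
    have hcard : ((comps (wt w)).filter fun u => peakSet w ⊆ symmDiff (descentSet u)
        ((descentSet u).image (· + 1)) ∧ wt v = wt u ∧ descentSet u ⊆ descentSet v).card =
        ((descentSet v).powerset.filter fun S => ∀ p ∈ peakSet w, ¬(p ∈ S ↔ p - 1 ∈ S)).card := by
      have hS : ∀ S : Finset ℕ, peakSet w ⊆ symmDiff S (S.image (· + 1)) ↔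
          ∀ p ∈ peakSet w, ¬(p ∈ S ↔ p - 1 ∈ S) := by
        intro S
        refine forall₂_congr fun p hp => ?_
        have h1 : p ∈ S.image (· + 1) ↔ p - 1 ∈ S := by
          rw [Finset.mem_image]
          have := (hP p hp).1
          constructor
          · rintro ⟨a, ha, rfl⟩; simpa using ha
          · exact fun h => ⟨p - 1, h, by omega⟩
        rw [Finset.mem_symmDiff, h1]; tauto
      refine Finset.card_bij (fun u _ => descentSet u) ?_ ?_ ?_
      · intro u hu
        obtain ⟨h1, h2, h3, h4⟩ := Finset.mem_filter.1 hu
        exact Finset.mem_filter.2 ⟨Finset.mem_powerset.2 h4, (hS _).1 h2⟩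
      · intro u hu u' hu' h
        obtain ⟨h1, -⟩ := Finset.mem_filter.1 hu
        obtain ⟨h2, -⟩ := Finset.mem_filter.1 hu'
        exact descentSet_injective ((mem_comps.1 h1).trans (mem_comps.1 h2).symm) h
      · intro S hS1
        obtain ⟨h1, h2⟩ := Finset.mem_filter.1 hS1
        rw [Finset.mem_powerset] at h1
        obtain ⟨u, hu, huS⟩ := exists_descentSet_eq (wt w) S fun i hi =>
          ⟨descentSet_pos v (h1 hi), hv ▸ descentSet_lt v (h1 hi)⟩
        exact ⟨u, Finset.mem_filter.2 ⟨mem_comps.2 hu, huS ▸ (hS _).2 h2, by rw [hv, hu],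
          huS ▸ h1⟩, huS⟩
    have key := card_filter_xor (descentSet v) (peakSet w) hP
    rw [hcard]
    change _ = if wt v = wt w ∧ ∀ p ∈ peakSet w, _ then _ else _
    simp only [nsmul_eq_mul, mul_one, hv, true_and]
    rw [← card_descentSet hv0, pow_succ, pow_succ]
    have key' := congrArg (fun k : ℕ => (k : ℤ)) key
    push_cast at key' ⊢
    rw [mul_right_comm, key']
    split_ifs <;> ring
  · rw [if_neg (fun h => hv h.1), Finset.sum_eq_zero, smul_zero]
    intro u hu
    rw [if_neg]
    rintro ⟨h, -⟩
    exact hv (h.trans (mem_comps.1 (Finset.mem_filter.1 hu).1))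

theorem eq_of_coeff_expo {f g : PS} (hf : f ∈ QSym) (hg : g ∈ QSym)
    (h : ∀ v, MvPowerSeries.coeff (expo v) f = MvPowerSeries.coeff (expo v) g) : f = g := by
  have hr : QSym = LinearMap.range monLin := (Finsupp.range_linearCombination ℤ).symm
  rw [hr] at hf hg
  obtain ⟨x, rfl⟩ := hf
  obtain ⟨y, rfl⟩ := hg
  congr 1
  ext v
  simpa only [coeff_expo_monLin] using h v

theorem monLin_mem (x : List ℕ+ →₀ ℤ) : monLin x ∈ QSym := by
  have hr : QSym = LinearMap.range monLin := (Finsupp.range_linearCombination ℤ).symm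
  rw [hr]
  exact ⟨x, rfl⟩

theorem peakCoeff_apply_of_wt : ∀ {u v : List ℕ+}, wt v ≠ wt u → peakCoeff u v = 0
  | [], v, h => by
    rw [peakCoeff, Finsupp.single_apply, if_neg]
    rintro rfl
    exact h rfl
  | a :: u, v, h => by
    have h1 : ∀ w ∈ (peakCoeff u).support, wt w = wt u := fun w hw => by
      by_contra h2
      exact Finsupp.mem_support_iff.1 hw (peakCoeff_apply_of_wt h2)
    rw [peakCoeff, Finsupp.add_apply, Finsupp.smul_apply, Finsupp.smul_apply, consL, incL,
      Finsupp.linearCombination_apply, Finsupp.linearCombination_apply, Finsupp.sum, Finsupp.sum,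
      Finsupp.finsetSum_apply, Finsupp.finsetSum_apply, Finset.sum_eq_zero, Finset.sum_eq_zero]
    · simp
    · intro w hw
      rcases w with _ | ⟨b, w⟩
      · simp
      · rw [Finsupp.smul_apply, Finsupp.single_apply, if_neg, smul_zero]
        rintro rfl
        have := h1 _ hw
        rw [wt_cons] at this
        rw [wt_cons, wt_cons, ← this, PNat.add_coe] at h
        exact h (by ring)
    · intro w hw
      rw [Finsupp.smul_apply, Finsupp.single_apply, if_neg, smul_zero]
      rintro rfl
      rw [wt_cons, wt_cons, h1 _ hw] at h
      exact h rfl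

theorem peakOf_eq_sum (w : List ℕ+) : (peakOf w : PS) = ∑ u ∈ refinements w, peakT u := by
  classical
  rcases eq_or_ne w [] with rfl | hw
  · have : refinements [] = {[]} := by
      ext v
      rw [mem_refinements, Finset.mem_singleton]
      constructor
      · rintro ⟨h, -⟩
        by_contra hv
        have := wt_pos_of_ne_nil hv
        simp [wt] at h this; omega
      · rintro rfl
        exact ⟨rfl, subset_rfl⟩
    rw [this, Finset.sum_singleton, peakT_isQMul.nil]
    simp [peakOf]
  have h1 : (peakOf w : PS) = peakK (wt w) (peakSet w) := by simp [peakOf, hw]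
  rw [h1]
  simp only [peakT, ← map_sum]
  refine eq_of_coeff_expo ?_ (monLin_mem _) fun v => ?_
  · rw [peakK, show (2 : PS) ^ ((peakSet w).card + 1) =
      ((2 ^ ((peakSet w).card + 1) : ℕ) : PS) by push_cast; rfl, ← nsmul_eq_mul]
    exact nsmul_mem (Submodule.sum_mem _ fun u _ => fundamentalQ_mem u) _
  · rw [coeff_expo_peakK hw, coeff_expo_monLin]
    by_cases hv : wt v = wt w
    · rw [(sum_refinements_peakCoeff w hw v hv).1]
      simp [hv]
    · rw [if_neg fun h => hv h.1, Finsupp.finsetSum_apply, Finset.sum_eq_zero]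
      intro u hu
      exact peakCoeff_apply_of_wt (by rwa [(mem_refinements.1 hu).1])

theorem peakOf_eq_sum_peakL (w : List ℕ+) : peakOf w = ∑ u ∈ refinements w, peakL u := by
  rw [← theta_fundamentalQ]
  simp only [peakL, ← map_sum]
  congr 1
  ext1
  rw [AddSubmonoidClass.coe_finsetSum]
  rfl

/-- Both families have the same sums over refinements, and these sums are unitriangular for
refinement. Induction from the finest compositions identifies the terms. -/
theorem coe_peakL (u : List ℕ+) : (peakL u : PS) = peakT u := by
  have hcard : ∀ v : List ℕ+, (descentSet v).card ≤ wt v := fun v => by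
    have : descentSet v ⊆ Finset.range (wt v) := fun j hj =>
      Finset.mem_range.2 (descentSet_lt v hj)
    simpa using Finset.card_le_card this
  induction hk : wt u - (descentSet u).card using Nat.strong_induction_on generalizing u with
  | _ k ih =>
    have hu : u ∈ refinements u := mem_refinements.2 ⟨rfl, subset_rfl⟩
    have h := peakOf_eq_sum u
    rw [peakOf_eq_sum_peakL, AddSubmonoidClass.coe_finsetSum, ← Finset.add_sum_erase _ _ hu,
      ← Finset.add_sum_erase _ _ hu, Finset.sum_congr rfl] at h
    · exact add_right_cancel h
    intro v hv
    obtain ⟨hvu, hv⟩ := Finset.mem_erase.1 hv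
    obtain ⟨hv1, hv2⟩ := mem_refinements.1 hv
    have hlt : (descentSet u).card < (descentSet v).card := by
      refine Finset.card_lt_card (hv2.ssubset_of_ne fun e => hvu ?_)
      exact descentSet_injective hv1 e.symm
    have := hcard v
    exact ih _ (by omega) v rfl

/-! ## The ring of peak quasisymmetric functions -/

theorem peakL_isQMul : IsQMul peakL := by
  refine ⟨Subtype.ext ?_, fun u w => Subtype.ext ?_⟩
  · rw [coe_peakL, peakT_isQMul.nil]; rfl
  · have h : ∀ l : List (List ℕ+), (((l.map peakL).sum : PQSym) : PS) = (l.map peakT).sum := by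
      intro l
      induction l with
      | nil => rfl
      | cons z l ih => simp only [List.map_cons, List.sum_cons, Subring.coe_add, ih, coe_peakL]
    rw [Subring.coe_mul, coe_peakL, coe_peakL, peakT_isQMul.mul, h]

theorem peakL_even_last {a : ℕ+} (ha : Even (a : ℕ)) (p : List ℕ+) : peakL (p ++ [a]) = 0 :=
  Subtype.ext (by rw [coe_peakL, peakT, peakCoeff_even_last ha, map_zero]; rfl)

theorem peakL_even {a : ℕ+} (ha : Even (a : ℕ)) (b : ℕ+) (u p : List ℕ+) :
    peakL (p ++ a :: b :: u) = -peakL (p ++ (a + b) :: u) :=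
  Subtype.ext (by
    rw [coe_peakL, peakT, peakCoeff_even ha, map_neg, Subring.coe_neg, coe_peakL, peakT])

/-- The words with odd letters. -/
abbrev OddWord : Type := {w : List ℕ+ // IsOdd w}

theorem exists_even_split {w : List ℕ+} (h : ¬ IsOdd w) :
    ∃ (p : List ℕ+) (a : ℕ+) (u : List ℕ+), Even (a : ℕ) ∧ w = p ++ a :: u := by
  simp only [IsOdd, not_forall, Nat.not_odd_iff_even] at h
  obtain ⟨a, ha, h⟩ := h
  obtain ⟨p, u, rfl⟩ := List.append_of_mem ha
  exact ⟨p, a, u, h, rfl⟩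

/-- Every `L_w` is plus or minus some `L_v` with `v` odd, or zero. -/
theorem peakL_induction {p : List ℕ+ → Prop} (hodd : ∀ w, IsOdd w → p w)
    (hlast : ∀ (a : ℕ+) (q : List ℕ+), Even (a : ℕ) → p (q ++ [a]))
    (hmerge : ∀ (a b : ℕ+) (q u : List ℕ+), Even (a : ℕ) → p (q ++ (a + b) :: u) →
      p (q ++ a :: b :: u)) (w : List ℕ+) : p w := by
  induction hn : w.length using Nat.strong_induction_on generalizing w with
  | _ n ih =>
    by_cases h : IsOdd w
    · exact hodd w h
    · obtain ⟨q, a, u, ha, rfl⟩ := exists_even_split h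
      rcases u with _ | ⟨b, u⟩
      · exact hlast a q ha
      · exact hmerge a b q u ha (ih _ (by simp at hn ⊢; omega) _ rfl)

/-- Merging an even letter shortens the word; the bound on the length is what leading-term estimates
need later. -/
theorem peakL_mem_span (w : List ℕ+) : peakL w ∈ Submodule.span ℤ
    (peakL '' {v | IsOdd v ∧ v.length ≤ w.length}) := by
  refine peakL_induction (p := fun w => peakL w ∈ Submodule.span ℤ
    (peakL '' {v | IsOdd v ∧ v.length ≤ w.length})) ?_ ?_ ?_ w
  · exact fun w hw => Submodule.subset_span ⟨w, ⟨hw, le_rfl⟩, rfl⟩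
  · intro a q ha
    rw [peakL_even_last ha]
    exact zero_mem _
  · intro a b q u ha h
    rw [peakL_even ha]
    refine neg_mem (Submodule.span_mono (Set.image_mono ?_) h)
    rintro v ⟨h1, h2⟩
    exact ⟨h1, h2.trans (by simp)⟩

/-- The span is closed under products by the quasi-shuffle rule followed by the elimination of even
letters, so it suffices that it contains the generators K_P. -/
theorem span_peakL : Submodule.span ℤ (Set.range fun w : OddWord => peakL w.1) = ⊤ := by
  have hmem : ∀ w, peakL w ∈ Submodule.span ℤ (Set.range fun w : OddWord => peakL w.1) := by
    intro w
    refine Submodule.span_mono ?_ (peakL_mem_span w)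
    rintro _ ⟨v, ⟨hv, -⟩, rfl⟩
    exact ⟨⟨v, hv⟩, rfl⟩
  have hsum : ∀ l : List (List ℕ+), (l.map peakL).sum ∈
      Submodule.span ℤ (Set.range fun w : OddWord => peakL w.1) := fun l =>
    list_sum_mem fun x hx => by
      obtain ⟨w, -, rfl⟩ := List.mem_map.1 hx
      exact hmem w
  let A : Subring PQSym :=
    { Submodule.span ℤ (Set.range fun w : OddWord => peakL w.1) with
      neg_mem' := fun {x} h => Submodule.neg_mem _ h
      one_mem' := by
        rw [← peakL_isQMul.nil]
        exact hmem []
      mul_mem' := by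
        intro x y hx hy
        refine Submodule.span_induction₂ (p := fun x y _ _ => x * y ∈
          Submodule.span ℤ (Set.range fun w : OddWord => peakL w.1)) ?_ ?_ ?_ ?_ ?_ ?_ ?_ hx hy
        · rintro _ _ ⟨u, rfl⟩ ⟨w, rfl⟩
          rw [peakL_isQMul.mul]
          exact hsum _
        · intro y _; rw [zero_mul]; exact zero_mem _
        · intro x _; rw [mul_zero]; exact zero_mem _
        · intro x y z _ _ _ h1 h2; rw [add_mul]; exact add_mem h1 h2
        · intro x y z _ _ _ h1 h2; rw [mul_add]; exact add_mem h1 h2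
        · intro r x y _ _ h; rw [smul_mul_assoc]; exact Submodule.smul_mem _ _ h
        · intro r x y _ _ h; rw [mul_smul_comm]; exact Submodule.smul_mem _ _ h }
  have hA : PQSym ≤ A.map PQSym.subtype := by
    refine Subring.closure_le.2 ?_
    rintro _ ⟨n, P, hn, hP, rfl⟩
    -- A peak subset has no two consecutive elements and does not contain 1, so the composition with
    -- descent set P also has peak set P.
    obtain ⟨w, rfl, hwP⟩ := exists_descentSet_eq n P fun i hi => by
      have := hP i hi; omega
    have hpk : peakSet w = P := by
      rw [peakSet, hwP, Finset.filter_eq_self]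
      exact fun i hi => ⟨(hP i hi).1, (hP i hi).2.2⟩
    refine ⟨peakOf w, ?_, ?_⟩
    · rw [peakOf_eq_sum_peakL]
      exact Submodule.sum_mem _ fun u _ => hmem u
    · have hw : w ≠ [] := ne_nil_of_wt (by omega)
      simp [peakOf, hw, hpk]
  rw [eq_top_iff]
  rintro x -
  obtain ⟨y, hy, hyx⟩ := hA x.2
  have : y = x := Subtype.ext hyx
  exact this ▸ hy

/-- For a longest word u in a relation, M_u occurs in L_u with coefficient 2^(length of u) and in no
other term of the relation. -/
theorem peakL_linearIndependent : LinearIndependent ℤ fun w : OddWord => peakL w.1 := by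
  rw [linearIndependent_iff]
  intro l hl
  by_contra hne
  obtain ⟨u, hu, hmax⟩ := Finset.exists_max_image l.support (fun w => w.1.length)
    (Finsupp.support_nonempty_iff.2 hne)
  have h1 : ∑ w ∈ l.support, l w * peakCoeff w.1 u.1 = 0 := by
    have := congrArg (fun f : PQSym => MvPowerSeries.coeff (expo u.1) (f : PS)) hl
    rw [Finsupp.linearCombination_apply, Finsupp.sum] at this
    simpa only [AddSubmonoidClass.coe_finsetSum, coe_peakL, map_sum, map_zsmul, peakT,
      AddSubgroupClass.coe_zsmul, coeff_expo_monLin, smul_eq_mul, Subring.coe_zero,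
      map_zero] using this
  rw [Finset.sum_eq_single u] at h1
  · rw [peakCoeff_apply_of_length u.2 _ le_rfl, if_pos rfl] at h1
    have := Finsupp.mem_support_iff.1 hu
    simp at h1; exact this h1
  · intro w hw hwu
    rw [peakCoeff_apply_of_length w.2 _ (hmax w hw), if_neg, mul_zero]
    exact fun h => hwu (Subtype.ext h.symm)
  · intro h; exact absurd hu h

/-- The basis of `PQSym` formed by the monomial peak functions of odd compositions. -/
def peakBasis : Module.Basis OddWord ℤ PQSym :=
  Module.Basis.mk peakL_linearIndependent span_peakL.ge

theorem peakBasis_apply (w : OddWord) : peakBasis w = peakL w.1 := by simp [peakBasis]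

/-! ## λ-operations and Adams operations -/

section Newton
variable {R : Type*} [CommRing R]

/-- The series `∑ (-1)^n c_{n+1} t^n`. -/
def powerSumSeries (c : ℕ → R) : PowerSeries R := PowerSeries.mk fun n => (-1) ^ n * c (n + 1)

/-- The sequence `l` has the power sums `c`, as elementary symmetric functions do. -/
structure IsNewton (l c : ℕ → R) : Prop where
  zero : l 0 = 1
  deriv : PowerSeries.derivative R (PowerSeries.mk l) = PowerSeries.mk l * powerSumSeries c

theorem coeff_mul_powerSumSeries (l c : ℕ → R) (n : ℕ) :
    PowerSeries.coeff n (PowerSeries.mk l * powerSumSeries c) =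
      ∑ i ∈ Finset.range (n + 1), (-1) ^ i * c (i + 1) * l (n - i) := by
  rw [mul_comm, PowerSeries.coeff_mul, Finset.Nat.sum_antidiagonal_eq_sum_range_succ_mk]
  simp [powerSumSeries]

theorem isNewton_iff {l c : ℕ → R} : IsNewton l c ↔ l 0 = 1 ∧ ∀ n : ℕ,
    ((n : R) + 1) * l (n + 1) = ∑ i ∈ Finset.range (n + 1), (-1) ^ i * c (i + 1) * l (n - i) := by
  constructor
  · refine fun h => ⟨h.zero, fun n => ?_⟩
    have := congrArg (PowerSeries.coeff n) h.deriv
    rw [coeff_mul_powerSumSeries, PowerSeries.coeff_derivative, PowerSeries.coeff_mk] at this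
    rw [← this]; ring
  · refine fun h => ⟨h.1, PowerSeries.ext fun n => ?_⟩
    rw [coeff_mul_powerSumSeries, PowerSeries.coeff_derivative, PowerSeries.coeff_mk, ← h.2 n]
    ring

theorem IsNewton.one {l c : ℕ → R} (h : IsNewton l c) : l 1 = c 1 := by
  simpa [h.zero] using (isNewton_iff.1 h).2 0

theorem IsNewton.congr {l c c' : ℕ → R} (h : IsNewton l c) (hc : ∀ n, 1 ≤ n → c n = c' n) :
    IsNewton l c' := by
  refine ⟨h.zero, ?_⟩
  rw [h.deriv]
  congr 1
  ext n
  simp [powerSumSeries, hc (n + 1) (by omega)]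

theorem IsNewton.map {l c : ℕ → R} (h : IsNewton l c) {S : Type*} [CommRing S] (φ : R →+* S) :
    IsNewton (fun n => φ (l n)) fun n => φ (c n) := by
  rw [isNewton_iff] at h ⊢
  refine ⟨by simp [h.1], fun n => ?_⟩
  have := congrArg φ (h.2 n)
  simpa using this

/-- Newton's identity determines (n + 1) l_{n+1} from earlier terms and the power sums, and n + 1
can be cancelled. The version up to N is needed because finitely many roots only give finitely many
correct power sums. -/
theorem IsNewton.eq_of_le [IsDomain R] [CharZero R] {l l' c c' : ℕ → R} (h : IsNewton l c)
    (h' : IsNewton l' c') (N : ℕ) (hc : ∀ n, 1 ≤ n → n ≤ N → c n = c' n) :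
    ∀ n ≤ N, l n = l' n := by
  intro n
  induction n using Nat.strong_induction_on with
  | _ n ih =>
    intro hn
    rcases n with _ | n
    · rw [h.zero, h'.zero]
    · have h1 := (isNewton_iff.1 h).2 n
      have h2 := (isNewton_iff.1 h').2 n
      rw [Finset.sum_congr rfl (g := fun i => (-1) ^ i * c' (i + 1) * l' (n - i)), ← h2] at h1
      · exact mul_left_cancel₀ (Nat.cast_add_one_ne_zero n) h1
      · intro i hi
        have := Finset.mem_range.1 hi
        rw [hc _ (by omega) (by omega), ih _ (by omega) (by omega)]

theorem IsNewton.unique [IsDomain R] [CharZero R] {l l' c : ℕ → R} (h : IsNewton l c)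
    (h' : IsNewton l' c) : l = l' :=
  funext fun n => h.eq_of_le h' n (fun _ _ _ => rfl) n le_rfl

/-- In this direction nothing is divided: c_{n+1} occurs in Newton's identity with coefficient ±1,
as l_0 = 1. The ring may be arbitrary. -/
theorem IsNewton.powerSum_eq_of_le {l l' c c' : ℕ → R} (h : IsNewton l c)
    (h' : IsNewton l' c') (N : ℕ) (hl : ∀ n ≤ N, l n = l' n) :
    ∀ n, 1 ≤ n → n ≤ N → c n = c' n := by
  intro n
  induction n using Nat.strong_induction_on with
  | _ n ih =>
    intro hn1 hn
    obtain ⟨n, rfl⟩ : ∃ k, n = k + 1 := ⟨n - 1, by omega⟩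
    have h1 := (isNewton_iff.1 h).2 n
    have h2 := (isNewton_iff.1 h').2 n
    rw [hl (n + 1) hn, h2, Finset.sum_range_succ, Finset.sum_range_succ,
      Finset.sum_congr rfl (g := fun i => (-1) ^ i * c (i + 1) * l (n - i)), add_right_inj,
      Nat.sub_self, h.zero, h'.zero, mul_one, mul_one] at h1
    · have h3 := congrArg ((-1) ^ n * ·) h1
      simpa [← mul_assoc, ← pow_add, ← two_mul] using h3.symm
    · intro i hi
      have := Finset.mem_range.1 hi
      rw [ih _ (by omega) (by omega) (by omega), hl _ (by omega)]

theorem IsNewton.mul {l l' c c' : ℕ → R} (h : IsNewton l c) (h' : IsNewton l' c') :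
    IsNewton (fun n => ∑ p ∈ Finset.HasAntidiagonal.antidiagonal n, l p.1 * l' p.2)
      fun n => c n + c' n := by
  have h1 : (PowerSeries.mk fun n => ∑ p ∈ Finset.HasAntidiagonal.antidiagonal n, l p.1 * l' p.2) =
      PowerSeries.mk l * PowerSeries.mk l' := by
    ext n
    rw [PowerSeries.coeff_mul]; simp
  have h2 : powerSumSeries (fun n => c n + c' n) = powerSumSeries c + powerSumSeries c' := by
    ext n
    simp [powerSumSeries, mul_add]
  refine ⟨by simp [h.zero, h'.zero], ?_⟩
  rw [h1, h2, Derivation.leibniz, h.deriv, h'.deriv]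
  simp only [smul_eq_mul]; ring

end Newton

/-! ### Elementary symmetric functions and their roots -/

section Esym

variable {ι S : Type*} [Fintype ι] [CommRing S]

theorem esym_eq_sum (x : ι → S) (k : ℕ) :
    esym x k = ∑ t ∈ Finset.powersetCard k Finset.univ, ∏ i ∈ t, x i :=
  Finset.esymm_map_val x Finset.univ k

theorem map_esym {S' : Type*} [CommRing S'] (φ : S →+* S') (x : ι → S) (k : ℕ) :
    φ (esym x k) = esym (fun i => φ (x i)) k := by
  simp only [esym_eq_sum, map_sum, map_prod]

/-- The generating function is the product of the 1 + x_i t, and the logarithmic derivative of each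
factor is a geometric series. -/
theorem esym_isNewton (x : ι → S) : IsNewton (esym x) fun n => ∑ i, x i ^ n := by
  classical
  have h1 : PowerSeries.mk (esym x) = ∏ i, (1 + PowerSeries.C (x i) * PowerSeries.X) := by
    ext k
    rw [Finset.prod_one_add, map_sum, PowerSeries.coeff_mk, esym_eq_sum, Finset.powersetCard_eq_filter,
      Finset.sum_filter]
    refine Finset.sum_congr rfl fun t _ => ?_
    rw [Finset.prod_mul_distrib, Finset.prod_const, ← map_prod, PowerSeries.coeff_C_mul,
      PowerSeries.coeff_X_pow]
    simp [eq_comm]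
  refine ⟨by simp [esym_eq_sum], ?_⟩
  have h2 : ∀ s : Finset ι, PowerSeries.derivative S
      (∏ i ∈ s, (1 + PowerSeries.C (x i) * PowerSeries.X)) =
      (∏ i ∈ s, (1 + PowerSeries.C (x i) * PowerSeries.X)) *
        powerSumSeries fun n => ∑ i ∈ s, x i ^ n := by
    intro s
    induction s using Finset.induction_on with
    | empty =>
      have : powerSumSeries (fun n => ∑ i ∈ (∅ : Finset ι), x i ^ n) = 0 := by
        ext n; simp [powerSumSeries]
      rw [this]; simp
    | insert a s ha ih =>
      have h3 : powerSumSeries (fun n => ∑ i ∈ insert a s, x i ^ n) =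
          powerSumSeries (fun n => x a ^ n) + powerSumSeries fun n => ∑ i ∈ s, x i ^ n := by
        ext n; simp [powerSumSeries, Finset.sum_insert ha, mul_add]
      have h4 : PowerSeries.derivative S (1 + PowerSeries.C (x a) * PowerSeries.X) =
          (1 + PowerSeries.C (x a) * PowerSeries.X) * powerSumSeries fun n => x a ^ n := by
        ext n
        rw [add_mul, one_mul, mul_assoc, map_add (PowerSeries.coeff n) (powerSumSeries _),
            PowerSeries.coeff_C_mul]
        rcases n with _ | n
        · simp [powerSumSeries, Derivation.leibniz]
        · rw [PowerSeries.coeff_succ_X_mul]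
          simp [powerSumSeries, Derivation.leibniz]
          ring
      rw [Finset.prod_insert ha, h3, Derivation.leibniz, ih, h4]
      simp only [smul_eq_mul]; ring
  rw [h1, h2]

/-- A sequence is, up to any given place, given by elementary symmetric functions over an
algebraically closed field. -/
theorem exists_esym_eq {K : Type*} [Field K] [IsAlgClosed K] (e : ℕ → K) (h0 : e 0 = 1) (n : ℕ) :
    ∃ r : Fin n → K, ∀ k ≤ n, esym r k = e k := by
  -- By Vieta, the roots of this monic polynomial have the prescribed elementary symmetric
  -- functions.
  let p : Polynomial K := ∑ k ∈ Finset.range (n + 1),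
    Polynomial.C ((-1) ^ (n - k) * e (n - k)) * Polynomial.X ^ k
  have hc : ∀ k ≤ n, p.coeff k = (-1) ^ (n - k) * e (n - k) := by
    intro k hk
    simp only [p, Polynomial.finsetSum_coeff, Polynomial.coeff_C_mul_X_pow]
    rw [Finset.sum_ite_eq, if_pos (Finset.mem_range.2 (by omega))]
  have hle : p.natDegree ≤ n := by
    refine Polynomial.natDegree_sum_le_of_forall_le _ _ fun k hk => ?_
    have := Finset.mem_range.1 hk
    exact (Polynomial.natDegree_C_mul_X_pow_le _ _).trans (by omega)
  have hn : p.coeff n = 1 := by rw [hc n le_rfl]; simp [h0]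
  have hd : p.natDegree = n :=
    Polynomial.natDegree_eq_of_le_of_coeff_ne_zero hle (by rw [hn]; exact one_ne_zero)
  have hl : p.leadingCoeff = 1 := by rw [Polynomial.leadingCoeff, hd, hn]
  have hs : p.roots.card = p.natDegree := Polynomial.splits_iff_card_roots.1 (IsAlgClosed.splits p)
  obtain ⟨L, hL⟩ : ∃ L : List K, (L : Multiset K) = p.roots := ⟨_, Multiset.coe_toList _⟩
  have hlen : L.length = n := by rw [← Multiset.coe_card, hL, hs, hd]
  subst hlen
  refine ⟨L.get, fun k hk => ?_⟩
  rw [esym, Fin.univ_val_map, List.ofFn_get, hL]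
  have h1 := Polynomial.coeff_eq_esymm_roots_of_card hs (k := L.length - k) (by omega)
  rw [hc _ (by omega), hl, hd, Nat.sub_sub_self hk, one_mul] at h1
  exact (mul_left_cancel₀ (pow_ne_zero _ (neg_ne_zero.2 one_ne_zero)) h1).symm

end Esym

/-! ### Adams operations and Newton's identities -/

section Adams
variable {R : Type*} [CommRing R]

theorem adams_of_isNewton {lam : ℕ → R → R} {a : R} {c : ℕ → R}
    (h : IsNewton (fun n => lam n a) c) {n : ℕ} (hn : 1 ≤ n) : adams lam n a = c n := by
  have h1 : lamSeries lam a * PowerSeries.invOfUnit (lamSeries lam a) 1 = 1 :=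
    PowerSeries.mul_invOfUnit _ _ (by simp [lamSeries, h.zero])
  obtain ⟨n, rfl⟩ : ∃ k, n = k + 1 := ⟨n - 1, by omega⟩
  rw [adams, lamSeries, h.deriv, mul_right_comm]
  rw [lamSeries] at h1
  rw [h1, one_mul, Nat.add_sub_cancel, powerSumSeries, PowerSeries.coeff_mk, ← mul_assoc, ← pow_add,
    ← two_mul]
  simp

theorem isNewton_adams {lam : ℕ → R → R} {a : R} (h0 : lam 0 a = 1) :
    IsNewton (fun n => lam n a) fun n => adams lam n a := by
  refine ⟨h0, ?_⟩
  have h1 : lamSeries lam a * PowerSeries.invOfUnit (lamSeries lam a) 1 = 1 :=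
    PowerSeries.mul_invOfUnit _ _ (by simp [lamSeries, h0])
  have h2 : powerSumSeries (fun n => adams lam n a) =
      PowerSeries.derivative R (lamSeries lam a) * PowerSeries.invOfUnit (lamSeries lam a) 1 := by
    ext n
    rw [powerSumSeries, PowerSeries.coeff_mk, adams, Nat.add_sub_cancel, ← mul_assoc, ← pow_add,
      ← two_mul]
    simp
  rw [h2]
  change PowerSeries.derivative R (lamSeries lam a) = lamSeries lam a * _
  rw [mul_left_comm, h1, mul_one]

/-- The Adams operations of a λ-ring are additive. -/
def adamsHom {lam : ℕ → R → R} (h : IsLambdaRing lam) (n : ℕ) (hn : 1 ≤ n) : R →+ R :=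
  AddMonoidHom.mk' (adams lam n) fun x y => by
    have h1 := (isNewton_adams (h.lam_zero x)).mul (isNewton_adams (h.lam_zero y))
    simp only [← h.lam_add] at h1
    exact adams_of_isNewton h1 hn

theorem isNewton_unit : IsNewton (fun n => if n ≤ 1 then (1 : R) else 0) fun _ => 1 := by
  have h := esym_isNewton fun _ : Unit => (1 : R)
  convert h using 1
  · funext n
    rw [esym_eq_sum]
    rcases n with _ | _ | n
    · simp
    · rw [Finset.powersetCard_one]; simp
    · rw [Finset.powersetCard_eq_empty.2 (by simp)]; simp
  · simp

theorem adams_one {lam : ℕ → R → R} (h : IsLambdaRing lam) {n : ℕ} (hn : 1 ≤ n) :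
    adams lam n 1 = 1 := by
  refine adams_of_isNewton (c := fun _ => 1) ?_ hn
  convert isNewton_unit (R := R) using 2 with n
  rcases n with _ | _ | n
  · simp [h.lam_zero]
  · simp [h.lam_one]
  · simp [h.lam_unit]

end Adams

/-! ### λ-rings from commuting ring endomorphisms -/

section LambdaOfAdams

variable {R : Type*} [CommRing R] [IsDomain R]

theorem map_aeval_int {σ A B : Type*} [CommRing A] [CommRing B] [Algebra ℤ A]
    [Algebra ℤ B] (φ : A →+* B) (f : σ → A)
    (P : MvPolynomial σ ℤ) :
    φ (MvPolynomial.aeval f P) = MvPolynomial.aeval (fun i => φ (f i)) P := by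
  rw [MvPolynomial.aeval_def, MvPolynomial.hom_eval₂, MvPolynomial.aeval_def]
  congr 1
  exact RingHom.ext_int _ _

/-- Operations with the ring endomorphisms `ψ n` as Adams operations. -/
structure IsLamOf (ψ : ℕ → R →+* R) (lam : ℕ → R → R) : Prop where
  one : ∀ a, ψ 1 a = a
  comp : ∀ m n a, 1 ≤ m → 1 ≤ n → ψ m (ψ n a) = ψ (m * n) a
  newton : ∀ a, IsNewton (fun n => lam n a) fun n => ψ n a

variable {ψ : ℕ → R →+* R} {lam : ℕ → R → R}

/-- An algebraically closed field of characteristic zero containing the given domain. -/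
abbrev SplitField (R : Type*) [CommRing R] [IsDomain R] : Type _ :=
  AlgebraicClosure (FractionRing R)

/-- The inclusion of a domain into an algebraically closed field. -/
def toSplit (R : Type*) [CommRing R] [IsDomain R] : R →+* SplitField R :=
  (algebraMap (FractionRing R) (SplitField R)).comp (algebraMap R (FractionRing R))

theorem toSplit_injective : Function.Injective (toSplit R) :=
  (algebraMap (FractionRing R) (SplitField R)).injective.comp
    (IsFractionRing.injective R (FractionRing R))

instance [CharZero R] : CharZero (SplitField R) := charZero_of_injective_ringHom (toSplit_injective (R := R))

/-- A splitting principle: up to degree n, x behaves like a sum of n elements r_i of rank one. -/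
theorem IsLamOf.exists_roots (H : IsLamOf ψ lam) (x : R) (n : ℕ) : ∃ r : Fin n → SplitField R,
    (∀ k ≤ n, esym r k = toSplit R (lam k x)) ∧
      ∀ k, 1 ≤ k → k ≤ n → ∑ i, r i ^ k = toSplit R (ψ k x) := by
  have h1 := (H.newton x).map (toSplit R)
  obtain ⟨r, hr⟩ := exists_esym_eq (fun k => toSplit R (lam k x)) h1.zero n
  exact ⟨r, hr, (esym_isNewton r).powerSum_eq_of_le h1 n hr⟩

variable [CharZero R]

/-- Both sides are Newton sequences in n with the power sums ψ_{mk}(x). -/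
theorem IsLamOf.psi_lam (H : IsLamOf ψ lam) (m n : ℕ) (hm : 1 ≤ m) (x : R) : ψ m (lam n x) = lam n (ψ m x) := by
  have h1 := (H.newton x).map (ψ m)
  refine h1.eq_of_le (H.newton (ψ m x)) n (fun k hk _ => ?_) n le_rfl
  rw [H.comp m k x hm hk, H.comp k m x hk hm, mul_comm]

/-- Elementary symmetric functions of powers of roots. -/
theorem IsLamOf.esym_pow (H : IsLamOf ψ lam) {x : R} {N : ℕ} {r : Fin N → SplitField R}
    (hr : ∀ k, 1 ≤ k → k ≤ N → ∑ i, r i ^ k = toSplit R (ψ k x)) {j n : ℕ} (hj : 1 ≤ j)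
    (hN : n * j ≤ N) : esym (fun i => r i ^ j) n = toSplit R (lam n (ψ j x)) := by
  refine (esym_isNewton fun i => r i ^ j).eq_of_le ((H.newton (ψ j x)).map (toSplit R)) n
    (fun k hk hkn => ?_) n le_rfl
  rw [H.comp k j x hk hj, ← hr _ (Nat.mul_pos hk hj) ((Nat.mul_le_mul_right j hkn).trans hN)]
  exact Finset.sum_congr rfl fun i _ => by rw [← pow_mul, mul_comm]

/-- Units and sums follow from uniqueness in Newton's identities. For products and compositions, the
defining identity of the universal polynomial is evaluated at roots of x and y; the resulting
families of products have the power sums required, since the ψ_k are multiplicative and commute with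
the λ^n. -/
theorem IsLamOf.isLambdaRing (H : IsLamOf ψ lam) : IsLambdaRing lam where
  lam_zero x := (H.newton x).zero
  lam_one x := (H.newton x).one.trans (H.one x)
  lam_unit n hn := by
    have h1 := (H.newton 1).congr (c' := fun _ => 1) fun n _ => map_one (ψ n)
    have h2 := congrFun (h1.unique isNewton_unit) n
    simpa [show ¬ n ≤ 1 by omega] using h2
  lam_add n x y := by
    have h1 := (H.newton (x + y)).congr (c' := fun n => ψ n x + ψ n y) fun n _ =>
      map_add (ψ n) x y
    exact congrFun (h1.unique ((H.newton x).mul (H.newton y))) n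
  lam_mul n P hP x y := by
    obtain ⟨r, hr1, hr2⟩ := H.exists_roots x n
    obtain ⟨s, hs1, hs2⟩ := H.exists_roots y n
    apply toSplit_injective
    have h1 : esym (fun k : Fin n × Fin n => r k.1 * s k.2) n = toSplit R (lam n (x * y)) := by
      refine (esym_isNewton fun k : Fin n × Fin n => r k.1 * s k.2).eq_of_le
        ((H.newton (x * y)).map (toSplit R)) n (fun k hk hkn => ?_) n le_rfl
      rw [map_mul, map_mul, ← hr2 k hk hkn, ← hs2 k hk hkn, Finset.sum_mul_sum,
        Fintype.sum_prod_type]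
      exact Finset.sum_congr rfl fun i _ => Finset.sum_congr rfl fun j _ => mul_pow _ _ _
    have h2 := congrArg (MvPolynomial.aeval (Sum.elim r s)) hP
    rw [← AlgHom.coe_toRingHom, map_esym] at h2
    simp only [AlgHom.coe_toRingHom, map_mul, MvPolynomial.aeval_X, Sum.elim_inl,
      Sum.elim_inr] at h2
    rw [← h1, ← h2, ← AlgHom.coe_toRingHom, map_aeval_int, map_aeval_int]
    congr 2
    funext i
    rcases i with i | i
    · simp only [Sum.elim_inl, map_esym, AlgHom.coe_toRingHom, MvPolynomial.aeval_X]
      exact hr1 _ i.2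
    · simp only [Sum.elim_inr, map_esym, AlgHom.coe_toRingHom, MvPolynomial.aeval_X]
      exact hs1 _ i.2
  lam_comp m n P hP x := by
    obtain ⟨r, hr1, hr2⟩ := H.exists_roots x (m * n)
    apply toSplit_injective
    have h1 : esym (fun s : {s : Finset (Fin (m * n)) // s.card = n} => ∏ k ∈ s.1, r k) m =
        toSplit R (lam m (lam n x)) := by
      refine (esym_isNewton _).eq_of_le ((H.newton (lam n x)).map (toSplit R)) m
        (fun k hk hkm => ?_) m le_rfl
      -- The k-th power sum of the products over n-subsets is e_n of the k-th powers of the roots.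
      -- It involves power sums up to degree nk ≤ mn, which mn roots represent correctly.
      rw [H.psi_lam k n hk, ← H.esym_pow hr2 hk (by rw [mul_comm]; exact Nat.mul_le_mul_right n hkm),
        esym_eq_sum, Finset.powersetCard_eq_filter, Finset.powerset_univ,
        ← Finset.sum_subtype_eq_sum_filter]
      simp only [Finset.prod_pow]
      rw [Finset.subtype_univ]
    have h2 := congrArg (MvPolynomial.aeval r) hP
    rw [← AlgHom.coe_toRingHom, map_esym] at h2
    simp only [AlgHom.coe_toRingHom, map_prod, MvPolynomial.aeval_X] at h2
    rw [← h1, ← h2, ← AlgHom.coe_toRingHom, map_aeval_int, map_aeval_int]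
    congr 2
    funext i
    simp only [map_esym, AlgHom.coe_toRingHom, MvPolynomial.aeval_X]
    exact hr1 _ i.2

/-- The polynomial e_k(X_1^m, X_2^m, …) in km variables is symmetric, hence an integral polynomial
in the elementary symmetric ones; it is evaluated at roots of x. This later places λ^k(L_{m·u}) in
Γ_u. -/
theorem IsLamOf.lam_psi_mem (H : IsLamOf ψ lam) (k m : ℕ) (hm : 1 ≤ m) (x : R) :
    lam k (ψ m x) ∈ Subring.closure {f | ∃ n, 1 ≤ n ∧ f = lam n x} := by
  obtain ⟨r, hr1, hr2⟩ := H.exists_roots x (k * m)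
  let Q : MvPolynomial (Fin (k * m)) ℤ :=
    MvPolynomial.aeval (fun i => MvPolynomial.X i ^ m) (MvPolynomial.esymm (Fin (k * m)) ℤ k)
  have hQ : Q.IsSymmetric := by
    intro e
    have h1 : ∀ p : MvPolynomial (Fin (k * m)) ℤ,
        MvPolynomial.rename e (MvPolynomial.aeval
          (fun i => (MvPolynomial.X i ^ m : MvPolynomial (Fin (k * m)) ℤ)) p) =
        MvPolynomial.aeval (fun i => (MvPolynomial.X i ^ m : MvPolynomial (Fin (k * m)) ℤ))
          (MvPolynomial.rename e p) := by
      intro p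
      rw [MvPolynomial.aeval_rename, ← AlgHom.comp_apply, MvPolynomial.comp_aeval]
      simp [Function.comp_def]
    rw [h1, MvPolynomial.rename_esymm]
  obtain ⟨P, hP⟩ := MvPolynomial.esymmAlgHom_surjective (σ := Fin (k * m)) (R := ℤ)
    (n := k * m) (by simp) ⟨Q, hQ⟩
  have hP' := congrArg Subtype.val hP
  rw [MvPolynomial.esymmAlgHom_apply] at hP'
  have h2 : lam k (ψ m x) = MvPolynomial.aeval (fun i : Fin (k * m) => lam (i + 1) x) P := by
    apply toSplit_injective
    rw [← H.esym_pow hr2 hm le_rfl]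
    have h3 := congrArg (MvPolynomial.aeval r) hP'
    have h4 : MvPolynomial.aeval r Q = esym (fun i => r i ^ m) k := by
      simp only [Q]
      rw [← AlgHom.comp_apply, MvPolynomial.comp_aeval, MvPolynomial.aeval_esymm_eq_multiset_esymm]
      simp [esym]
    rw [← h4]
    change _ = (MvPolynomial.aeval r) Q at h3
    rw [← h3, ← AlgHom.coe_toRingHom, map_aeval_int, map_aeval_int]
    congr 2
    funext i
    rw [AlgHom.coe_toRingHom, MvPolynomial.aeval_esymm_eq_multiset_esymm]
    exact hr1 _ i.2
  have hmem : ∀ i : Fin (k * m),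
      lam (i + 1) x ∈ Subring.closure {f | ∃ n, 1 ≤ n ∧ f = lam n x} := fun i =>
    Subring.subset_closure ⟨(i : ℕ) + 1, by omega, rfl⟩
  rw [h2, MvPolynomial.aeval_def, MvPolynomial.eval₂_eq]
  refine Subring.sum_mem _ fun d _ => Subring.mul_mem _ ?_ (Subring.prod_mem _ fun i _ =>
    Subring.pow_mem _ (hmem i) _)
  rw [algebraMap_int_eq, eq_intCast]
  exact intCast_mem _ _

end LambdaOfAdams

/-! ## Integrality of the λ-operations -/

section Integrality
variable {R : Type*} [CommRing R]

/-- Coprime integers remain comaximal in any commutative ring, so divisibility by n can be tested on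
prime powers. -/
theorem natCast_dvd_of_prime_pow {n : ℕ} (hn : n ≠ 0) {x : R}
    (h : ∀ p k : ℕ, p.Prime → 0 < k → p ^ k ∣ n → ((p ^ k : ℕ) : R) ∣ x) : (n : R) ∣ x := by
  suffices H : ∀ m, m ∣ n → (m : R) ∣ x from H n dvd_rfl
  intro m
  induction m using Nat.recOnPosPrimePosCoprime with
  | prime_pow p k hp hk => exact h p k hp hk
  | zero => exact fun h0 => absurd (zero_dvd_iff.1 h0) hn
  | one => simp
  | coprime a b _ _ hab iha ihb =>
    intro hm
    rw [Nat.cast_mul]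
    exact (Nat.isCoprime_iff_coprime.2 hab).intCast (R := R) |> fun h1 => by
      simp only [Int.cast_natCast] at h1
      exact h1.mul_dvd (iha ((dvd_mul_right a b).trans hm)) (ihb ((dvd_mul_left b a).trans hm))

/-- If x ≡ y modulo p, then their p^j-th powers agree modulo p^(j+1). The factor p^k of de splits as
p^i dividing d and p^j dividing e. -/
theorem prime_pow_dvd_mul_sub {p : ℕ} (hp : p.Prime) {x y : R} (hxy : (p : R) ∣ x - y)
    {k d e : ℕ} (h : p ^ k ∣ d * e) :
    ((p ^ (k + 1) : ℕ) : R) ∣ d * (x ^ e - y ^ e) := by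
  obtain ⟨a, b, ha, hb, hab⟩ := exists_dvd_and_dvd_of_dvd_mul h
  obtain ⟨i, -, rfl⟩ := (Nat.dvd_prime_pow hp).1 (Dvd.intro b hab.symm)
  obtain ⟨j, -, rfl⟩ := (Nat.dvd_prime_pow hp).1 (Dvd.intro_left _ hab.symm)
  have hij : k = i + j := Nat.pow_right_injective hp.two_le (by simpa [pow_add] using hab)
  obtain ⟨d, rfl⟩ := ha
  obtain ⟨e, rfl⟩ := hb
  have h1 : ((p : R) ^ (j + 1)) ∣ x ^ (p ^ j * e) - y ^ (p ^ j * e) := by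
    rw [pow_mul, pow_mul]
    exact (dvd_sub_pow_of_dvd_sub hxy j).trans (sub_dvd_pow_sub_pow _ _ e)
  rw [hij, show i + j + 1 = i + (j + 1) by ring, pow_add]
  push_cast
  exact mul_dvd_mul (dvd_mul_right _ _) h1

open scoped Classical in
/-- The Witt coordinates of a sequence of ghost components. -/
def wittCoord (c : ℕ → R) (n : ℕ) : R :=
  -- The division by n need not be possible for arbitrary c; 0 is only a default value for that
  -- case.
  if h : ∃ w, (n : R) * w = c n - ∑ d : n.properDivisors, (d.1 : R) * wittCoord c d.1 ^ (n / d.1)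
  then h.choose else 0
termination_by n
decreasing_by exact (Nat.mem_properDivisors.1 d.2).2

theorem sum_wittCoord {c : ℕ → R} {n : ℕ} (hn : n ≠ 0)
    (h : (n : R) ∣ c n - ∑ d ∈ n.properDivisors, (d : R) * wittCoord c d ^ (n / d)) :
    c n = ∑ d ∈ n.divisors, (d : R) * wittCoord c d ^ (n / d) := by
  have h1 : ∃ w, (n : R) * w =
      c n - ∑ d : n.properDivisors, (d.1 : R) * wittCoord c d.1 ^ (n / d.1) := by
    obtain ⟨w, hw⟩ := h
    refine ⟨w, ?_⟩
    rw [← hw, Finset.sum_coe_sort n.properDivisors fun d => (d : R) * wittCoord c d ^ (n / d)]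
  have h2 : (n : R) * wittCoord c n =
      c n - ∑ d ∈ n.properDivisors, (d : R) * wittCoord c d ^ (n / d) := by
    rw [wittCoord, dif_pos h1, h1.choose_spec,
      Finset.sum_coe_sort n.properDivisors fun d => (d : R) * wittCoord c d ^ (n / d)]
  rw [← Nat.insert_self_properDivisors hn, Finset.sum_insert Nat.self_notMem_properDivisors,
    Nat.div_self (Nat.pos_of_ne_zero hn), pow_one, h2]
  ring

/-- Dwork's lemma: Frobenius lifts give sequences of ghost components. -/
theorem eq_sum_wittCoord {ψ : ℕ → R →+* R}
    (hcomp : ∀ m n a, 1 ≤ m → 1 ≤ n → ψ m (ψ n a) = ψ (m * n) a)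
    (hfrob : ∀ p : ℕ, p.Prime → ∀ a, (p : R) ∣ ψ p a - a ^ p) (a : R) :
    ∀ n, n ≠ 0 → ψ n a = ∑ d ∈ n.divisors, (d : R) * wittCoord (fun n => ψ n a) d ^ (n / d) := by
  intro n
  induction n using Nat.strong_induction_on with
  | _ n ih =>
    intro hn
    refine sum_wittCoord (c := fun n => ψ n a) hn (natCast_dvd_of_prime_pow hn ?_)
    intro p k hp hk hpk
    set w := wittCoord (fun n => ψ n a)
    obtain ⟨k, rfl⟩ : ∃ j, k = j + 1 := ⟨k - 1, by omega⟩
    obtain ⟨m, rfl⟩ := (dvd_pow_self p hk.ne').trans hpk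
    have hp0 := hp.pos
    have hm : m ≠ 0 := by rintro rfl; simp at hn
    have hkm : p ^ k ∣ m := by
      rw [pow_succ, mul_comm] at hpk
      exact Nat.dvd_of_mul_dvd_mul_left hp0 hpk
    have hmn : m < p * m := by
      have := hp.two_le
      nlinarith [Nat.pos_of_ne_zero hm]
    -- With n = pm, ψ_n(a) = ψ_p(ψ_m(a)) is expanded by the induction hypothesis. Its terms pair
    -- with the divisors d of m, where ψ_p is congruent to the p-th power; the other proper divisors
    -- of n are multiples of p^(k+1).
    rw [← hcomp p m a hp.one_le (by omega), ih m hmn hm, map_sum,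
      ← Finset.sum_filter_add_sum_filter_not (p * m).properDivisors (· ∣ m)]
    have hf : (p * m).properDivisors.filter (· ∣ m) = m.divisors := by
      ext d
      rw [Finset.mem_filter, Nat.mem_properDivisors, Nat.mem_divisors]
      constructor
      · exact fun h => ⟨h.2, hm⟩
      · exact fun h => ⟨⟨h.1.trans (dvd_mul_left _ _),
          (Nat.le_of_dvd (Nat.pos_of_ne_zero hm) h.1).trans_lt hmn⟩, h.1⟩
    rw [hf, ← sub_sub, ← Finset.sum_sub_distrib]
    refine dvd_sub (Finset.dvd_sum fun d hd => ?_) (Finset.dvd_sum fun d hd => ?_)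
    · have hdm := (Nat.mem_divisors.1 hd).1
      rw [map_mul, map_natCast, map_pow, ← mul_sub, Nat.mul_div_assoc p hdm, pow_mul]
      refine prime_pow_dvd_mul_sub hp (hfrob p hp _) ?_
      rwa [Nat.mul_div_cancel' hdm]
    · obtain ⟨h1, h2⟩ := Finset.mem_filter.1 hd
      obtain ⟨e, he⟩ := (Nat.mem_properDivisors.1 h1).1
      refine dvd_mul_of_dvd_left (Nat.cast_dvd_cast ?_) _
      rw [he] at hpk
      refine (Nat.Coprime.pow_left (k + 1) ((Nat.Prime.coprime_iff_not_dvd hp).2 ?_)).dvd_of_dvd_mul_right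
        hpk
      rintro ⟨e', rfl⟩
      refine h2 ⟨e', Nat.eq_of_mul_eq_mul_left hp0 ?_⟩
      rw [he]; ring

/-- The series `1 - w (-t)^d`. -/
def wittFactor (w : R) (d : ℕ) : PowerSeries R :=
  1 - PowerSeries.C (w * (-1) ^ d) * PowerSeries.X ^ d

/-- The sign in `wittFactor` is chosen so that the power sums are the terms of the ghost components.
-/
theorem deriv_wittFactor (w : R) {d : ℕ} (hd : d ≠ 0) :
    PowerSeries.derivative R (wittFactor w d) = wittFactor w d *
      powerSumSeries fun n : ℕ => if d ∣ n then (d : R) * w ^ (n / d) else 0 := by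
  ext n
  rw [wittFactor, sub_mul, one_mul, mul_assoc, map_sub (PowerSeries.coeff n) (powerSumSeries _),
    PowerSeries.coeff_C_mul, PowerSeries.coeff_X_pow_mul', PowerSeries.coeff_derivative, map_sub,
    PowerSeries.coeff_C_mul, PowerSeries.coeff_X_pow, PowerSeries.coeff_one,
    if_neg (Nat.succ_ne_zero n), powerSumSeries, PowerSeries.coeff_mk]
  rcases lt_trichotomy (n + 1) d with h | rfl | h
  · have h1 : ¬ d ∣ n + 1 := fun h1 => by
      have := Nat.le_of_dvd (by omega) h1
      omega
    rw [if_neg h.ne, if_neg h1, if_neg (by omega)]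
    simp
  · rw [if_pos rfl, if_pos dvd_rfl, if_neg (by omega), Nat.div_self (by omega)]
    push_cast; ring
  · obtain ⟨m, rfl⟩ : ∃ m, n = m + d := ⟨n - d, by omega⟩
    have e1 : m + d + 1 = (m + 1) + d := by ring
    rw [if_neg h.ne', if_pos (c := d ≤ m + d) (by omega), PowerSeries.coeff_mk,
      Nat.add_sub_cancel, e1]
    simp only [Nat.dvd_add_self_right]
    rw [Nat.add_div_right _ (by omega)]
    split_ifs
    · rw [pow_succ, pow_add]; ring
    · simp

/-- The sequence consists of the coefficients of the infinite product of the factors 1 - w_d (-t)^d,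
which needs no division. The partial product up to N has the right power sums up to N, so its
coefficients up to N no longer change. -/
theorem exists_isNewton_of_sum [IsDomain R] [CharZero R] (c w : ℕ → R)
    (h : ∀ n : ℕ, n ≠ 0 → c n = ∑ d ∈ n.divisors, (d : R) * w d ^ (n / d)) : ∃ l, IsNewton l c := by
  let G : ℕ → PowerSeries R := fun N => ∏ d ∈ Finset.Icc 1 N, wittFactor (w d) d
  have hG : ∀ N, IsNewton (fun n => PowerSeries.coeff n (G N)) fun n : ℕ =>
      ∑ d ∈ Finset.Icc 1 N, if d ∣ n then (d : R) * w d ^ (n / d) else 0 := by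
    intro N
    have hmk : ∀ f : PowerSeries R, (PowerSeries.mk fun n => PowerSeries.coeff n f) = f :=
      fun f => PowerSeries.ext fun n => by rw [PowerSeries.coeff_mk]
    refine ⟨?_, ?_⟩
    · rw [PowerSeries.coeff_zero_eq_constantCoeff_apply, map_prod]
      refine Finset.prod_eq_one fun d hd => ?_
      have := Finset.mem_Icc.1 hd
      simp [wittFactor, show d ≠ 0 by omega]
    · rw [hmk]
      induction N with
      | zero =>
        have h0 : powerSumSeries (fun n : ℕ => ∑ d ∈ Finset.Icc 1 0,
            if d ∣ n then (d : R) * w d ^ (n / d) else 0) = 0 := by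
          ext n; simp [powerSumSeries]
        rw [h0]; simp [G]
      | succ N ih =>
        have h1 : G (N + 1) = G N * wittFactor (w (N + 1)) (N + 1) :=
          Finset.prod_Icc_succ_top (by omega) _
        have h2 : powerSumSeries (fun n : ℕ => ∑ d ∈ Finset.Icc 1 (N + 1),
            if d ∣ n then (d : R) * w d ^ (n / d) else 0) =
            powerSumSeries (fun n : ℕ => ∑ d ∈ Finset.Icc 1 N,
              if d ∣ n then (d : R) * w d ^ (n / d) else 0) +
            powerSumSeries fun n : ℕ => if N + 1 ∣ n then ((N + 1 : ℕ) : R) *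
              w (N + 1) ^ (n / (N + 1)) else 0 := by
          ext n
          simp only [powerSumSeries, PowerSeries.coeff_mk, map_add]
          rw [Finset.sum_Icc_succ_top (by omega), mul_add]
        rw [h1, h2, Derivation.leibniz, ih, deriv_wittFactor _ (Nat.succ_ne_zero N)]
        simp only [smul_eq_mul]; ring
  have hc : ∀ N n : ℕ, 1 ≤ n → n ≤ N →
      ∑ d ∈ Finset.Icc 1 N, (if d ∣ n then (d : R) * w d ^ (n / d) else 0) = c n := by
    intro N n hn hnN
    rw [h n (by omega), ← Finset.sum_filter]
    congr 1
    ext d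
    rw [Finset.mem_filter, Finset.mem_Icc, Nat.mem_divisors]
    constructor
    · exact fun h => ⟨h.2, by omega⟩
    · exact fun h => ⟨⟨Nat.pos_of_dvd_of_pos h.1 hn, (Nat.le_of_dvd hn h.1).trans hnN⟩, h.1⟩
  refine ⟨fun n => PowerSeries.coeff n (G n), isNewton_iff.2 ⟨(hG 0).zero, fun n => ?_⟩⟩
  rw [(isNewton_iff.1 (hG (n + 1))).2 n]
  refine Finset.sum_congr rfl fun i hi => ?_
  have hi' := Finset.mem_range.1 hi
  rw [hc _ _ (by omega) (by omega)]
  congr 1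
  refine (hG (n + 1)).eq_of_le (hG (n - i)) (n - i) (fun k hk hk' => ?_) _ le_rfl
  rw [hc _ _ hk (by omega), hc _ _ hk hk']

/-- Commuting Frobenius lifts on a domain of characteristic zero come from λ-operations. -/
theorem exists_isLamOf [IsDomain R] [CharZero R] {ψ : ℕ → R →+* R} (hone : ∀ a, ψ 1 a = a)
    (hcomp : ∀ m n a, 1 ≤ m → 1 ≤ n → ψ m (ψ n a) = ψ (m * n) a)
    (hfrob : ∀ p : ℕ, p.Prime → ∀ a, (p : R) ∣ ψ p a - a ^ p) :
    ∃ lam : ℕ → R → R, IsLamOf ψ lam := by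
  choose l hl using fun a => exists_isNewton_of_sum (fun n => ψ n a) _
    (eq_sum_wittCoord hcomp hfrob a)
  exact ⟨fun n a => l a n, hone, hcomp, hl⟩

end Integrality

/-! ## The λ-ring structure of `PQSym` -/

theorem scale_append (n : ℕ+) (u w : List ℕ+) : scale n (u ++ w) = scale n u ++ scale n w :=
  List.map_append

theorem scale_cons (n a : ℕ+) (w : List ℕ+) : scale n (a :: w) = n * a :: scale n w := rfl

theorem scale_nil (n : ℕ+) : scale n [] = [] := rfl

theorem scale_scale (m n : ℕ+) (w : List ℕ+) : scale m (scale n w) = scale (m * n) w := by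
  simp [scale, mul_assoc]

theorem scale_one (w : List ℕ+) : scale 1 w = w := by simp [scale]

theorem even_mul_coe (n : ℕ+) {a : ℕ+} (ha : Even (a : ℕ)) : Even ((n * a : ℕ+) : ℕ) := by
  rw [PNat.mul_coe]; exact ha.mul_left _

/-- The additive map `L_w ↦ L_{n·w}`. -/
def psiLin (n : ℕ+) : PQSym →ₗ[ℤ] PQSym := peakBasis.constr ℤ fun w => peakL (scale n w.1)

/-- The map is prescribed on odd words only; the formula extends to all words because the relations
for even letters are preserved by scaling. -/
theorem psiLin_peakL (n : ℕ+) (w : List ℕ+) : psiLin n (peakL w) = peakL (scale n w) := by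
  refine peakL_induction (p := fun w => psiLin n (peakL w) = peakL (scale n w)) ?_ ?_ ?_ w
  · intro w hw
    rw [psiLin, ← peakBasis_apply ⟨w, hw⟩, Module.Basis.constr_basis]
  · intro a q ha
    rw [peakL_even_last ha, map_zero, scale_append, scale_cons, scale_nil,
      peakL_even_last (even_mul_coe n ha)]
  · intro a b q u ha h
    rw [peakL_even ha, map_neg, h, scale_append, scale_append, scale_cons, scale_cons, scale_cons,
      peakL_even (even_mul_coe n ha), mul_add]

theorem peakL_scale_even {n : ℕ+} (hn : Even (n : ℕ)) {w : List ℕ+} (hw : w ≠ []) :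
    peakL (scale n w) = 0 := by
  obtain ⟨q, a, rfl⟩ := List.eq_nil_or_concat' w |>.resolve_left hw
  rw [scale_append, scale_cons, scale_nil, peakL_even_last]
  rw [PNat.mul_coe]; exact hn.mul_right _

theorem peakL_span_induction {p : PQSym → Prop} (hL : ∀ w, IsOdd w → p (peakL w)) (h0 : p 0)
    (hadd : ∀ x y, p x → p y → p (x + y)) (hneg : ∀ x, p x → p (-x)) (x : PQSym) : p x := by
  let A : AddSubgroup PQSym :=
    { carrier := {x | p x}
      add_mem' := fun {x y} => hadd x y
      zero_mem' := h0
      neg_mem' := fun {x} => hneg x }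
  have h : Submodule.span ℤ (Set.range fun w : OddWord => peakL w.1) ≤
      AddSubgroup.toIntSubmodule A := Submodule.span_le.2 <| by
    rintro _ ⟨w, rfl⟩
    exact hL w.1 w.2
  rw [span_peakL] at h
  exact h (Submodule.mem_top (x := x))

theorem psiLin_mul (n : ℕ+) (x y : PQSym) : psiLin n (x * y) = psiLin n x * psiLin n y := by
  refine peakL_span_induction (p := fun x => psiLin n (x * y) = psiLin n x * psiLin n y)
    (fun u _ => ?_) (by simp) (fun x y h1 h2 => ?_) (fun x h => ?_) x
  · refine peakL_span_induction
      (p := fun y => psiLin n (peakL u * y) = psiLin n (peakL u) * psiLin n y)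
      (fun w _ => ?_) (by simp) (fun x y h1 h2 => ?_) (fun x h => ?_) y
    · rw [psiLin_peakL, psiLin_peakL, peakL_isQMul.mul, peakL_isQMul.mul, map_list_sum,
        qsh_scale, List.map_map, List.map_map]
      congr 1
      exact List.map_congr_left fun z _ => psiLin_peakL n z
    · rw [mul_add, map_add, h1, h2, map_add, mul_add]
    · rw [mul_neg, map_neg, h, map_neg, mul_neg]
  · rw [add_mul, map_add, h1, h2, map_add, add_mul]
  · rw [neg_mul, map_neg, h, map_neg, neg_mul]

/-- The ring endomorphism `L_w ↦ L_{n·w}` of `PQSym`, for `n ≥ 1`. -/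
def psiHom (n : ℕ) : PQSym →+* PQSym :=
  { psiLin n.toPNat' with
    map_one' := by
      have := psiLin_peakL n.toPNat' []
      rwa [scale_nil, peakL_isQMul.nil] at this
    map_zero' := map_zero (psiLin n.toPNat')
    map_mul' := psiLin_mul _ }

theorem psiHom_peakL (n : ℕ+) (w : List ℕ+) : psiHom n (peakL w) = peakL (scale n w) := by
  have h := psiLin_peakL (n : ℕ).toPNat' w
  rw [PNat.coe_toPNat'] at h
  change psiLin (n : ℕ).toPNat' (peakL w) = _
  rw [PNat.coe_toPNat', h]

theorem psiHom_one (x : PQSym) : psiHom 1 x = x := by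
  refine peakL_span_induction (p := fun x => psiHom 1 x = x)
    (fun u _ => ?_) (by simp) (fun x y h1 h2 => ?_) (fun x h => ?_) x
  · exact (psiHom_peakL 1 u).trans (by rw [scale_one])
  · rw [map_add, h1, h2]
  · rw [map_neg, h]

theorem psiHom_psiHom (m n : ℕ) (x : PQSym) (hm : 1 ≤ m) (hn : 1 ≤ n) :
    psiHom m (psiHom n x) = psiHom (m * n) x := by
  refine peakL_span_induction (p := fun x => psiHom m (psiHom n x) = psiHom (m * n) x)
    (fun u _ => ?_) (by simp) (fun x y h1 h2 => ?_) (fun x h => ?_) x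
  · lift m to ℕ+ using hm
    lift n to ℕ+ using hn
    rw [← PNat.mul_coe, psiHom_peakL, psiHom_peakL, psiHom_peakL, scale_scale]
  · simp only [map_add, h1, h2]
  · simp only [map_neg, h]

theorem dvd_psiHom_sub_pow {p : ℕ} (hp : p.Prime) (x : PQSym) :
    (p : PQSym) ∣ psiHom p x - x ^ p := by
  have key : ∀ x y : PQSym, (p : PQSym) ∣ (x + y) ^ p - (x ^ p + y ^ p) := fun x y => by
    obtain ⟨r, hr⟩ := exists_add_pow_prime_eq hp x y
    exact ⟨x * y * r, by rw [hr]; ring⟩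
  refine peakL_span_induction (p := fun x => (p : PQSym) ∣ psiHom p x - x ^ p)
    (fun u _ => ?_) ?_ (fun x y h1 h2 => ?_) (fun x h => ?_) x
  · have h := peakL_isQMul.pow_prime (p := ⟨p, hp.pos⟩) hp u
    have h' : psiHom p (peakL u) = peakL (scale ⟨p, hp.pos⟩ u) := psiHom_peakL ⟨p, hp.pos⟩ u
    rw [h', dvd_sub_comm]
    exact h
  · simp [hp.ne_zero]
  · have h3 := (h1.add h2).sub (key x y)
    rw [map_add]
    convert h3 using 1
    ring
  -- Additivity modulo p, applied to x and -x, treats p = 2 along with the odd primes.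
  · have h3 := (key x (-x)).sub h
    rw [add_neg_cancel, zero_pow hp.ne_zero] at h3
    rw [map_neg]
    convert h3 using 1
    ring

instance : IsDomain PS := NoZeroDivisors.to_isDomain _

instance : CharZero PQSym := by
  refine ⟨fun m n h => ?_⟩
  have h1 := congrArg (fun f : PQSym => MvPowerSeries.constantCoeff (σ := ℕ) (R := ℤ) (f : PS)) h
  simpa using h1

theorem exists_isLamOf_psiHom : ∃ lam : ℕ → PQSym → PQSym, IsLamOf psiHom lam :=
  exists_isLamOf psiHom_one (fun m n x hm hn => psiHom_psiHom m n x hm hn)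
    fun _ hp x => dvd_psiHom_sub_pow hp x

/-- The λ-operations of `PQSym`. -/
def peakLam : ℕ → PQSym → PQSym := exists_isLamOf_psiHom.choose

theorem peakLam_isLamOf : IsLamOf psiHom peakLam := exists_isLamOf_psiHom.choose_spec

theorem peakLam_newton (w : List ℕ+) : IsNewton (fun n => peakLam n (peakL w))
    fun n => psiHom n (peakL w) := peakLam_isLamOf.newton _

theorem peakLam_isPeakLambda : IsPeakLambda peakLam := by
  refine ⟨peakLam_isLamOf.isLambdaRing, fun n w hw _ => ?_⟩
  rw [adams_of_isNewton (peakLam_newton w) n.pos, psiHom_peakL]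
  split_ifs with h
  · rfl
  · exact peakL_scale_even (Nat.not_odd_iff_even.1 h) hw

/-- Adams operations are additive, so their values on a basis fix them, and they fix the λ^n by
Newton's identities. The empty word is not covered by the hypothesis, but Adams operations send 1 to
1 in any λ-ring. -/
theorem IsPeakLambda.eq_peakLam {lam : ℕ → PQSym → PQSym} (h : IsPeakLambda lam) :
    lam = peakLam := by
  have key : ∀ n (hn : 1 ≤ n) x, adams lam n x = psiHom n x := by
    intro n hn x
    change adamsHom h.1 n hn x = psiHom n x
    refine peakL_span_induction (p := fun x => adamsHom h.1 n hn x = psiHom n x)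
      (fun w hw => ?_) (by simp) (fun x y h1 h2 => ?_) (fun x h => ?_) x
    · change adams lam n (peakL w) = _
      rcases eq_or_ne w [] with rfl | hw0
      · rw [peakL_isQMul.nil, adams_one h.1 hn, map_one]
      · lift n to ℕ+ using hn
        rw [h.2 n w hw0 hw, psiHom_peakL]
        split_ifs with h'
        · rfl
        · exact (peakL_scale_even (Nat.not_odd_iff_even.1 h') hw0).symm
    · simp only [map_add, h1, h2]
    · simp only [map_neg, h]
  funext n x
  exact congrFun (((isNewton_adams (h.1.lam_zero x)).congr fun n hn => key n hn x).unique
    (peakLam_isLamOf.newton x)) n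

/-! ## Lyndon words -/

section Lex

theorem append_lt_append_iff (p : List ℕ+) {a b : List ℕ+} : p ++ a < p ++ b ↔ a < b := by
  induction p with
  | nil => rfl
  | cons x p ih => rw [List.cons_append, List.cons_append, List.cons_lt_cons_iff, ih]; simp

theorem append_le_append_iff (p : List ℕ+) {a b : List ℕ+} : p ++ a ≤ p ++ b ↔ a ≤ b := by
  rw [← not_lt, append_lt_append_iff, not_lt]

theorem nil_lt_of_ne_nil {a : List ℕ+} (h : a ≠ []) : [] < a := by
  cases a with
  | nil => exact absurd rfl h
  | cons x a => exact List.nil_lt_cons x a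

theorem lt_append {a b : List ℕ+} (h : b ≠ []) : a < a ++ b := by
  have := (append_lt_append_iff a).2 (nil_lt_of_ne_nil h)
  rwa [List.append_nil] at this

theorem le_append (a b : List ℕ+) : a ≤ a ++ b := by
  rcases eq_or_ne b [] with rfl | h
  · rw [List.append_nil]
  · exact (lt_append h).le

/-- Either `a` is a proper prefix of `b`, or `a < b` is decided by a letter. -/
theorem lt_dichotomy {a b : List ℕ+} (h : a < b) :
    (∃ c, c ≠ [] ∧ b = a ++ c) ∨ ∀ s t, a ++ s < b ++ t := by
  induction a generalizing b with
  | nil => exact Or.inl ⟨b, by rintro rfl; exact lt_irrefl _ h, rfl⟩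
  | cons x a ih =>
    cases b with
    | nil => exact absurd h (List.not_lt_nil _)
    | cons y b =>
      rcases List.cons_lt_cons_iff.1 h with h | ⟨rfl, h'⟩
      · exact Or.inr fun s t => List.cons_lt_cons_iff.2 (Or.inl h)
      · rcases ih h' with ⟨c, hc, rfl⟩ | h
        · exact Or.inl ⟨c, hc, rfl⟩
        · exact Or.inr fun s t => List.cons_lt_cons_iff.2 (Or.inr ⟨rfl, h s t⟩)

theorem append_lt_append_of_length {a b : List ℕ+} (h : a < b) (hl : b.length ≤ a.length)
    (s t : List ℕ+) : a ++ s < b ++ t := by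
  rcases lt_dichotomy h with ⟨c, hc, rfl⟩ | h
  · have := List.length_pos_iff.2 hc
    rw [List.length_append] at hl
    omega
  · exact h s t

/-- A nonempty word that is smaller than its proper tails. -/
def IsLyn (w : List ℕ+) : Prop := w ≠ [] ∧ IsLyndon w

theorem IsLyn.lt {p s : List ℕ+} (h : IsLyn (p ++ s)) (hp : p ≠ []) (hs : s ≠ []) :
    p ++ s < s := by
  have h1 := h.2 p.length (List.length_pos_iff.2 hp) (by simpa using List.length_pos_iff.2 hs)
  rwa [List.drop_left] at h1

theorem isLyn_of_lt {w : List ℕ+} (h0 : w ≠ [])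
    (h : ∀ p s, w = p ++ s → p ≠ [] → s ≠ [] → w < s) : IsLyn w := by
  refine ⟨h0, fun i hi hiw => h (w.take i) (w.drop i) (List.take_append_drop i w).symm ?_ ?_⟩
  · rw [Ne, List.take_eq_nil_iff]
    rintro (h | h)
    · omega
    · exact h0 h
  · rw [Ne, List.drop_eq_nil_iff]; omega

/-- If a letter decides p < g, it also decides the claim. Otherwise g = pc, and after cancelling p
the claim reduces to g < c. -/
theorem IsLyn.append_lt_append {p g : List ℕ+} (hg : IsLyn g) (hp : p ≠ []) (h : p < g) :
    p ++ g < g ++ p := by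
  rcases lt_dichotomy h with ⟨c, hc, rfl⟩ | h
  · rw [List.append_assoc, append_lt_append_iff]
    have hlt := hg.lt hp hc
    have := append_lt_append_of_length hlt (by simp) [] p
    rwa [List.append_nil] at this
  · exact h g p

end Lex

/-! ### The Chen–Fox–Lyndon factorization -/

section Word

theorem multiset_max_induction {α : Type*} [LinearOrder α] {p : Multiset α → Prop} (h0 : p 0)
    (h : ∀ a S, (∀ b ∈ S, b ≤ a) → p S → p (a ::ₘ S)) (S : Multiset α) : p S := by
  induction hn : Multiset.card S generalizing S with
  | zero => rw [Multiset.card_eq_zero.1 hn]; exact h0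
  | succ n ih =>
    have hS : S ≠ 0 := by rintro rfl; simp at hn
    obtain ⟨a, ha, hmax⟩ := Finset.exists_max_image S.toFinset id (by simpa using hS)
    obtain ⟨T, rfl⟩ := Multiset.exists_cons_of_mem (Multiset.mem_toFinset.1 ha)
    refine h a T (fun b hb => hmax b (Multiset.mem_toFinset.2 (Multiset.mem_cons_of_mem hb))) ?_
    exact ih T (by simpa using hn)

theorem exists_max_cons {α : Type*} [LinearOrder α] {S : Multiset α} (hS : S ≠ 0) :
    ∃ a T, S = a ::ₘ T ∧ ∀ b ∈ T, b ≤ a := by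
  revert hS
  refine multiset_max_induction (p := fun S => S ≠ 0 → ∃ a T, S = a ::ₘ T ∧ ∀ b ∈ T, b ≤ a)
    (fun h => absurd rfl h) (fun a T h _ _ => ⟨a, T, rfl, h⟩) S

/-- The product of the words in a multiset, in nonincreasing order. -/
def word (S : Multiset (List ℕ+)) : List ℕ+ := (S.sort (· ≥ ·)).flatten

theorem word_zero : word 0 = [] := by simp [word]

theorem word_cons {a : List ℕ+} {S : Multiset (List ℕ+)} (h : ∀ b ∈ S, b ≤ a) :
    word (a ::ₘ S) = a ++ word S := by
  rw [word, Multiset.sort_cons a S (· ≥ ·) h, List.flatten_cons, word]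

theorem word_add {S T : Multiset (List ℕ+)} (h : ∀ a ∈ S, ∀ b ∈ T, b ≤ a) :
    word (S + T) = word S ++ word T := by
  revert h
  refine multiset_max_induction (p := fun S => (∀ a ∈ S, ∀ b ∈ T, b ≤ a) →
    word (S + T) = word S ++ word T) ?_ ?_ S
  · intro _; simp [word_zero]
  · intro a S ha ih h
    rw [Multiset.cons_add, word_cons, word_cons ha, ih, List.append_assoc]
    · exact fun x hx => h x (Multiset.mem_cons_of_mem hx)
    · intro b hb
      rcases Multiset.mem_add.1 hb with hb | hb
      · exact ha b hb
      · exact h a (Multiset.mem_cons_self _ _) b hb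

theorem word_singleton (a : List ℕ+) : word {a} = a := by
  have := word_cons (a := a) (S := 0) (by simp)
  rwa [word_zero, List.append_nil] at this

theorem word_perm (S : Multiset (List ℕ+)) : ∀ a, a ∈ word S ↔ ∃ v ∈ S, a ∈ v := by
  intro a
  simp [word, List.mem_flatten]

theorem length_word (S : Multiset (List ℕ+)) :
    (word S).length = (S.map List.length).sum := by
  refine multiset_max_induction (p := fun S => (word S).length = (S.map List.length).sum)
    (by simp [word_zero]) (fun a S h ih => ?_) S
  rw [word_cons h, List.length_append, ih]; simp

theorem length_word_add (S T : Multiset (List ℕ+)) :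
    (word (S + T)).length = (word S).length + (word T).length := by
  simp [length_word]

theorem length_word_cons (a : List ℕ+) (T : Multiset (List ℕ+)) :
    (word (a ::ₘ T)).length = a.length + (word T).length := by
  simp [length_word]

theorem word_ne_nil {S : Multiset (List ℕ+)} (hS : ∀ v ∈ S, IsLyn v) (h : S ≠ 0) :
    word S ≠ [] := by
  obtain ⟨a, T, rfl, hT⟩ := exists_max_cons h
  rw [word_cons hT]
  intro h
  exact (hS a (Multiset.mem_cons_self _ _)).1 (List.append_eq_nil_iff.1 h).1

/-- Every factor of a nonincreasing product of Lyndon words has the least factor as lower bound. -/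
theorem le_suffix_word {S : Multiset (List ℕ+)} (hS : ∀ v ∈ S, IsLyn v) {f : List ℕ+}
    (hf : ∀ v ∈ S, f ≤ v) : ∀ p s, word S = p ++ s → s ≠ [] → f ≤ s := by
  revert hS hf
  refine multiset_max_induction (p := fun S => (∀ v ∈ S, IsLyn v) → (∀ v ∈ S, f ≤ v) →
    ∀ p s, word S = p ++ s → s ≠ [] → f ≤ s) ?_ ?_ S
  · intro _ _ p s h hs
    rw [word_zero] at h
    exact absurd (List.append_eq_nil_iff.1 h.symm).2 hs
  · intro a S ha ih hS hf p s h hs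
    rw [word_cons ha] at h
    rcases List.append_eq_append_iff.1 h with ⟨q, rfl, h1⟩ | ⟨q, rfl, rfl⟩
    · exact ih (fun v hv => hS v (Multiset.mem_cons_of_mem hv))
        (fun v hv => hf v (Multiset.mem_cons_of_mem hv)) q s h1 hs
    · have hfa := hf _ (Multiset.mem_cons_self _ _)
      have hL := hS _ (Multiset.mem_cons_self _ _)
      rcases eq_or_ne q [] with rfl | hq
      · exact ih (fun v hv => hS v (Multiset.mem_cons_of_mem hv))
          (fun v hv => hf v (Multiset.mem_cons_of_mem hv)) [] (word S) rfl (by simpa using hs)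
      · refine hfa.trans (le_trans ?_ (le_append q (word S)))
        rcases eq_or_ne p [] with rfl | hp
        · exact le_rfl
        · exact (hL.lt hp hq).le

theorem exists_min_cons {α : Type*} [LinearOrder α] {S : Multiset α} (hS : S ≠ 0) :
    ∃ a T, S = T + {a} ∧ ∀ b ∈ T, a ≤ b := by
  obtain ⟨a, T, h1, h2⟩ := exists_max_cons (α := αᵒᵈ) (S := S) hS
  exact ⟨a, T, by rw [h1, ← Multiset.singleton_add, add_comm]; rfl, h2⟩

theorem word_add_singleton {f : List ℕ+} {S : Multiset (List ℕ+)} (h : ∀ b ∈ S, f ≤ b) :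
    word (S + {f}) = word S ++ f := by
  rw [word_add fun a ha b hb => (Multiset.mem_singleton.1 hb).symm ▸ h a ha, word_singleton]

/-- The Chen–Fox–Lyndon factorization: uniqueness. -/
theorem word_injOn {S T : Multiset (List ℕ+)} (hS : ∀ v ∈ S, IsLyn v) (hT : ∀ v ∈ T, IsLyn v)
    (h : word S = word T) : S = T := by
  induction hn : Multiset.card S generalizing S T with
  | zero =>
    rw [Multiset.card_eq_zero.1 hn] at h ⊢
    by_contra hT0
    exact word_ne_nil hT (Ne.symm hT0) (by rw [← h, word_zero])
  | succ n ih =>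
    have hS0 : S ≠ 0 := by rintro rfl; simp at hn
    have hT0 : T ≠ 0 := by
      rintro rfl
      exact word_ne_nil hS hS0 (by rw [h, word_zero])
    obtain ⟨f, S, rfl, hf⟩ := exists_min_cons hS0
    obtain ⟨g, T, rfl, hg⟩ := exists_min_cons hT0
    have hle : ∀ {f : List ℕ+} {S : Multiset (List ℕ+)}, (∀ b ∈ S, f ≤ b) →
        ∀ v ∈ S + {f}, f ≤ v := fun {f S} h v hv => by
      rcases Multiset.mem_add.1 hv with hv | hv
      · exact h v hv
      · rw [Multiset.mem_singleton.1 hv]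
    have hfS : IsLyn f := hS f (by simp)
    have hgT : IsLyn g := hT g (by simp)
    -- The least factor is itself a suffix and a lower bound for all nonempty suffixes, so it is
    -- determined by the word.
    have h1 : f ≤ g := le_suffix_word hS (hle hf) (word T) g
      (by rw [h, word_add_singleton hg]) hgT.1
    have h2 : g ≤ f := le_suffix_word hT (hle hg) (word S) f
      (by rw [← h, word_add_singleton hf]) hfS.1
    obtain rfl := le_antisymm h1 h2
    rw [word_add_singleton hf, word_add_singleton hg] at h
    rw [ih (fun v hv => hS v (Multiset.mem_add.2 (Or.inl hv)))
      (fun v hv => hT v (Multiset.mem_add.2 (Or.inl hv))) (List.append_cancel_right h)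
      (by simpa using hn)]

theorem exists_min_suffix {w : List ℕ+} (hw : w ≠ []) : ∃ p f, w = p ++ f ∧ f ≠ [] ∧
    ∀ q s, w = q ++ s → s ≠ [] → f ≤ s := by
  have hne : (w.tails.toFinset.filter (· ≠ [])).Nonempty := ⟨w, by simp [hw]⟩
  obtain ⟨f, hf, hmin⟩ := Finset.exists_min_image _ id hne
  simp only [Finset.mem_filter, List.mem_toFinset, List.mem_tails, id] at hf hmin
  obtain ⟨p, hp⟩ := hf.1
  exact ⟨p, f, hp.symm, hf.2, fun q s h hs => hmin s ⟨⟨q, h.symm⟩, hs⟩⟩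

/-- The Chen–Fox–Lyndon factorization: existence. -/
theorem exists_word_eq (w : List ℕ+) : ∃ S, (∀ v ∈ S, IsLyn v) ∧ word S = w := by
  induction hn : w.length using Nat.strong_induction_on generalizing w with
  | _ n ih =>
    rcases eq_or_ne w [] with rfl | hw
    · exact ⟨0, by simp, word_zero⟩
    obtain ⟨p, f, rfl, hf, hmin⟩ := exists_min_suffix hw
    have hfpos := List.length_pos_iff.2 hf
    obtain ⟨S, hS, rfl⟩ := ih p.length (by simp at hn; omega) p rfl
    have hfL : IsLyn f := by
      refine isLyn_of_lt hf ?_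
      rintro q s rfl hq hs
      refine lt_of_le_of_ne (hmin (word S ++ q) s (by simp) hs) fun h => hq ?_
      have := congrArg List.length h
      simpa using this
    have hle : ∀ b ∈ S, f ≤ b := by
      rcases eq_or_ne S 0 with rfl | hS0
      · simp
      obtain ⟨g, S, rfl, hg⟩ := exists_min_cons hS0
      -- If g < f, then the suffix gf satisfies f ≤ gf by minimality of f. This excludes that a
      -- letter decides g < f, so f = gc; cancelling g gives c ≤ f, and minimality gives f ≤ c,
      -- hence g would be empty.
      have hfg : f ≤ g := by
        by_contra hgf
        rw [not_le] at hgf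
        rw [word_add_singleton hg] at hmin
        have h1 : f ≤ g ++ f := hmin (word S) (g ++ f) (by simp) (by simp [hf])
        rcases lt_dichotomy hgf with ⟨c, hc, rfl⟩ | h
        · rw [append_le_append_iff] at h1
          have h2 := hmin (word S ++ g ++ g) c (by simp) hc
          have h3 := le_antisymm h1 h2
          have := congrArg List.length h3
          have hg0 := (hS g (by simp)).1
          simp at this; exact hg0 this
        · have := h f []
          rw [List.append_nil] at this
          exact absurd h1 (not_le.2 this)
      intro b hb
      rcases Multiset.mem_add.1 hb with hb | hb
      · exact hfg.trans (hg b hb)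
      · rwa [Multiset.mem_singleton.1 hb]
    refine ⟨S + {f}, fun v hv => ?_, word_add_singleton hle⟩
    rcases Multiset.mem_add.1 hv with hv | hv
    · exact hS v hv
    · rwa [Multiset.mem_singleton.1 hv]

/-- The proper tail of a Lyndon word is a product of larger Lyndon words. -/
theorem IsLyn.exists_tail {c : ℕ+} {u : List ℕ+} (h : IsLyn (c :: u)) :
    ∃ F, (∀ f ∈ F, IsLyn f ∧ c :: u < f) ∧ word F = u := by
  obtain ⟨F, hF, rfl⟩ := exists_word_eq u
  refine ⟨F, fun f hf => ⟨hF f hf, ?_⟩, rfl⟩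
  obtain ⟨g, F, rfl, hg⟩ := exists_min_cons (S := F) (by rintro rfl; simp at hf)
  have hgL : IsLyn g := hF g (by simp)
  have h1 : c :: word (F + {g}) < g := by
    have h2 : c :: word (F + {g}) = (c :: word F) ++ g := by
      rw [word_add_singleton hg, List.cons_append]
    rw [h2] at h ⊢
    exact h.lt (List.cons_ne_nil _ _) hgL.1
  rcases Multiset.mem_add.1 hf with hf | hf
  · exact h1.trans_le (hg f hf)
  · rwa [Multiset.mem_singleton.1 hf]

/-- Moving a beginning of `v` to the right past larger Lyndon words. -/
theorem append_word_le {v : List ℕ+} {U : Multiset (List ℕ+)}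
    (hU : ∀ g ∈ U, IsLyn g ∧ v < g) : ∀ (F : Multiset (List ℕ+)) (p : List ℕ+), p ≠ [] →
      p ++ word F = v →
      p ++ word (F + U) ≤ word U ++ v ∧ (U ≠ 0 → p ++ word (F + U) < word U ++ v) := by
  intro F
  induction hn : Multiset.card (F + U) generalizing F U with
  | zero =>
    intro p _ hpv
    rw [Multiset.card_eq_zero, add_eq_zero] at hn
    obtain ⟨rfl, rfl⟩ := hn
    simp only [add_zero, word_zero, List.append_nil, List.nil_append] at hpv ⊢
    exact ⟨hpv.le, by simp⟩
  | succ n ih =>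
    intro p hp hpv
    obtain ⟨a, X, hX, ha⟩ := exists_max_cons (S := F + U) (by intro h; simp [h] at hn)
    have hcard : Multiset.card X = n := by rw [hX] at hn; simpa using hn
    have hmem : a ∈ F + U := by rw [hX]; simp
    rw [hX, word_cons ha, ← List.append_assoc]
    -- The largest factor a comes next on the left. If it belongs to F, it is absorbed into the
    -- beginning p of v. Otherwise p ≤ v < a, and pa < ap moves a in front.
    by_cases haF : a ∈ F
    · obtain ⟨F, rfl⟩ := Multiset.exists_cons_of_mem haF
      rw [Multiset.cons_add, Multiset.cons_inj_right] at hX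
      subst hX
      have hF : ∀ b ∈ F, b ≤ a := fun b hb => ha b (Multiset.mem_add.2 (Or.inl hb))
      refine ih hU F hcard (p ++ a) (by simp [hp]) ?_
      rw [List.append_assoc, ← word_cons hF, hpv]
    · obtain ⟨U, rfl⟩ := Multiset.exists_cons_of_mem
        ((Multiset.mem_add.1 hmem).resolve_left haF)
      rw [Multiset.add_cons, Multiset.cons_inj_right] at hX
      subst hX
      have hUa : ∀ b ∈ U, b ≤ a := fun b hb => ha b (Multiset.mem_add.2 (Or.inr hb))
      obtain ⟨haL, hva⟩ := hU a (Multiset.mem_cons_self _ _)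
      have hpa : p < a := by
        refine lt_of_le_of_lt ?_ hva
        rw [← hpv]; exact le_append _ _
      have h1 := append_lt_append_of_length (haL.append_lt_append hp hpa) (by simp; omega)
        (word (F + U)) (word (F + U))
      have h2 := (ih (fun g hg => hU g (Multiset.mem_cons_of_mem hg)) F hcard p hp hpv).1
      rw [word_cons hUa]
      have h3 : p ++ a ++ word (F + U) < a ++ word U ++ v := by
        refine h1.trans_le ?_
        rw [List.append_assoc, List.append_assoc, append_le_append_iff]
        exact h2
      exact ⟨h3.le, fun _ => h3⟩

/-- Taking the first letter c out of the factor v = c · `word F` too early cannot give a larger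
word, and gives a smaller one if some factor exceeds v. The factors of U that are at most v end both
words; `append_word_le` handles the larger ones. -/
theorem cons_word_le {c : ℕ+} {F U : Multiset (List ℕ+)} (hU : ∀ g ∈ U, IsLyn g)
    (hF : ∀ f ∈ F, c :: word F < f) : c :: word (F + U) ≤ word ((c :: word F) ::ₘ U) ∧
      ((∃ g ∈ U, c :: word F < g) → c :: word (F + U) < word ((c :: word F) ::ₘ U)) := by
  set v := c :: word F with hv
  have hU' := Multiset.filter_add_not (fun g => v < g) U
  set U₁ := U.filter fun g => v < g
  set U₂ := U.filter fun g => ¬ v < g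
  have h1 : ∀ g ∈ U₁, IsLyn g ∧ v < g := fun g hg => by
    obtain ⟨h1, h2⟩ := Multiset.mem_filter.1 hg
    exact ⟨hU g h1, h2⟩
  have h2 : ∀ g ∈ U₂, g ≤ v := fun g hg => not_lt.1 (Multiset.mem_filter.1 hg).2
  have e1 : c :: word (F + U) = ([c] ++ word (F + U₁)) ++ word U₂ := by
    rw [← hU', ← add_assoc, word_add]
    · rfl
    · intro a ha b hb
      rcases Multiset.mem_add.1 ha with ha | ha
      · exact (h2 b hb).trans (hF a ha).le
      · exact (h2 b hb).trans (h1 a ha).2.le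
  have e2 : word (v ::ₘ U) = (word U₁ ++ v) ++ word U₂ := by
    rw [← hU', ← Multiset.add_cons, word_add, word_cons h2, List.append_assoc]
    intro a ha b hb
    rcases Multiset.mem_cons.1 hb with rfl | hb
    · exact (h1 a ha).2.le
    · exact (h2 b hb).trans (h1 a ha).2.le
  obtain ⟨h3, h4⟩ := append_word_le h1 F [c] (by simp) rfl
  have hlen : (word U₁ ++ v).length ≤ ([c] ++ word (F + U₁)).length := by
    simp [hv, length_word_add]; omega
  rw [e1, e2]
  have hlt : [c] ++ word (F + U₁) < word U₁ ++ v →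
      ([c] ++ word (F + U₁)) ++ word U₂ < (word U₁ ++ v) ++ word U₂ := fun h =>
    append_lt_append_of_length h hlen _ _
  constructor
  · rcases h3.eq_or_lt with h | h
    · rw [h]
    · exact (hlt h).le
  · rintro ⟨g, hg, hvg⟩
    refine hlt (h4 fun h => ?_)
    have : g ∈ U₁ := Multiset.mem_filter.2 ⟨hg, hvg⟩
    rw [h] at this
    simp at this

end Word

/-! ## Shuffles -/

section Shuffle

/-- The list of all shuffles of two words. -/
def sh : List ℕ+ → List ℕ+ → List (List ℕ+)
  | [], w => [w]
  | a :: u, [] => [a :: u]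
  | a :: u, b :: w => (sh u (b :: w)).map (a :: ·) ++ (sh (a :: u) w).map (b :: ·)
termination_by u w => u.length + w.length

theorem sh_nil_left (w : List ℕ+) : sh [] w = [w] := by rw [sh]

theorem sh_nil_right (w : List ℕ+) : sh w [] = [w] := by cases w <;> rw [sh]

theorem sh_cons (a b : ℕ+) (u w : List ℕ+) : sh (a :: u) (b :: w) =
    (sh u (b :: w)).map (a :: ·) ++ (sh (a :: u) w).map (b :: ·) := by rw [sh]

/-- The quasi-shuffles of maximal length are the shuffles. -/
theorem exists_qsh_perm : ∀ u w : List ℕ+, ∃ r, (qsh u w).Perm (sh u w ++ r) ∧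
    ∀ z ∈ r, z.length < u.length + w.length
  | [], w => ⟨[], by simp [qsh_nil_left, sh_nil_left], by simp⟩
  | a :: u, [] => ⟨[], by simp [qsh_nil_right, sh_nil_right], by simp⟩
  | a :: u, b :: w => by
    obtain ⟨r₁, h₁, l₁⟩ := exists_qsh_perm u (b :: w)
    obtain ⟨r₂, h₂, l₂⟩ := exists_qsh_perm (a :: u) w
    obtain ⟨r₃, h₃, l₃⟩ := exists_qsh_perm u w
    have hle : ∀ z ∈ qsh u w, z.length ≤ u.length + w.length := by
      intro z hz
      rcases List.mem_append.1 (h₃.mem_iff.1 hz) with hz | hz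
      · have : ∀ (u w z : List ℕ+), z ∈ sh u w → z.length = u.length + w.length := by
          intro u w
          induction u, w using sh.induct with
          | case1 w => intro z hz; simp [sh_nil_left] at hz; simp [hz]
          | case2 a u => intro z hz; simp [sh_nil_right] at hz; simp [hz]
          | case3 a u b w ih1 ih2 =>
            intro z hz
            rw [sh_cons, List.mem_append, List.mem_map, List.mem_map] at hz
            rcases hz with ⟨y, hy, rfl⟩ | ⟨y, hy, rfl⟩
            · have := ih1 y hy; simp at this ⊢; omega
            · have := ih2 y hy; simp at this ⊢; omega
        exact (this u w z hz).le
      · exact (l₃ z hz).le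
    refine ⟨r₁.map (a :: ·) ++ (r₂.map (b :: ·) ++ (qsh u w).map ((a + b) :: ·)), ?_, ?_⟩
    · rw [qsh_cons, sh_cons]
      have e₁ := h₁.map (a :: ·)
      have e₂ := h₂.map (b :: ·)
      rw [List.map_append] at e₁ e₂
      refine ((e₁.append e₂).append_right _).trans ?_
      rw [← Multiset.coe_eq_coe]
      simp only [← Multiset.coe_add]
      abel
    · intro z hz
      simp only [List.mem_append, List.mem_map] at hz
      simp only [List.length_cons]
      rcases hz with ⟨y, hy, rfl⟩ | ⟨y, hy, rfl⟩ | ⟨y, hy, rfl⟩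
      · have := l₁ y hy; simp at this ⊢; omega
      · have := l₂ y hy; simp at this ⊢; omega
      · have := hle y hy; simp at this ⊢; omega
termination_by u w => u.length + w.length

theorem perm_of_mem_sh : ∀ (u w z : List ℕ+), z ∈ sh u w → z.Perm (u ++ w) := by
  intro u w
  induction u, w using sh.induct with
  | case1 w => intro z hz; simp [sh_nil_left] at hz; simp [hz]
  | case2 a u => intro z hz; simp [sh_nil_right] at hz; simp [hz]
  | case3 a u b w ih1 ih2 =>
    intro z hz
    rw [sh_cons, List.mem_append, List.mem_map, List.mem_map] at hz
    rcases hz with ⟨y, hy, rfl⟩ | ⟨y, hy, rfl⟩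
    · exact (ih1 y hy).cons a
    · exact ((ih2 y hy).cons b).trans List.perm_middle.symm

theorem length_of_mem_sh {u w z : List ℕ+} (h : z ∈ sh u w) :
    z.length = u.length + w.length := by
  rw [(perm_of_mem_sh u w z h).length_eq, List.length_append]

theorem sh_ne_nil : ∀ u w : List ℕ+, sh u w ≠ []
  | [], w => by simp [sh_nil_left]
  | a :: u, [] => by simp [sh_nil_right]
  | a :: u, b :: w => by simp [sh_cons, sh_ne_nil u (b :: w)]

/-- Shuffling with a larger word gives larger shuffles. -/
theorem exists_lt_mem_sh : ∀ (v x w : List ℕ+), x < w → x.length = w.length →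
    ∀ z ∈ sh v x, ∃ z' ∈ sh v w, z < z' := by
  intro v x
  induction v, x using sh.induct with
  | case1 x =>
    intro w hxw _ z hz
    simp only [sh_nil_left, List.mem_singleton] at hz
    subst hz
    exact ⟨w, by simp [sh_nil_left], hxw⟩
  | case2 a u =>
    intro w hxw hl
    have : w = [] := List.length_eq_zero_iff.1 hl.symm
    subst this
    exact absurd hxw (lt_irrefl _)
  | case3 a u b x ih1 ih2 =>
    intro w hxw hl z hz
    rcases w with _ | ⟨d, w⟩
    · simp at hl
    rw [sh_cons, List.mem_append, List.mem_map, List.mem_map] at hz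
    rcases hz with ⟨y, hy, rfl⟩ | ⟨y, hy, rfl⟩
    · obtain ⟨y', hy', h⟩ := ih1 _ hxw hl y hy
      refine ⟨a :: y', ?_, List.cons_lt_cons_iff.2 (Or.inr ⟨rfl, h⟩)⟩
      rw [sh_cons]
      exact List.mem_append_left _ (List.mem_map_of_mem hy')
    · rcases List.cons_lt_cons_iff.1 hxw with h | ⟨rfl, h⟩
      · obtain ⟨y', hy'⟩ := List.exists_mem_of_ne_nil _ (sh_ne_nil (a :: u) w)
        refine ⟨d :: y', ?_, List.cons_lt_cons_iff.2 (Or.inl h)⟩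
        rw [sh_cons]
        exact List.mem_append_right _ (List.mem_map_of_mem hy')
      · obtain ⟨y', hy', h'⟩ := ih2 w h (by simpa using hl) y hy
        refine ⟨b :: y', ?_, List.cons_lt_cons_iff.2 (Or.inr ⟨rfl, h'⟩)⟩
        rw [sh_cons]
        exact List.mem_append_right _ (List.mem_map_of_mem hy')

theorem word_head {c : ℕ+} {F S : Multiset (List ℕ+)} (hF : ∀ f ∈ F, c :: word F < f)
    (hS : ∀ b ∈ S, b ≤ c :: word F) : word ((c :: word F) ::ₘ S) = c :: word (F + S) := by
  rw [word_cons hS, word_add fun a ha b hb => (hS b hb).trans (hF a ha).le, List.cons_append]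

theorem exists_head {S : Multiset (List ℕ+)} (hS : ∀ v ∈ S, IsLyn v) (h0 : S ≠ 0) :
    ∃ (c : ℕ+) (F S' : Multiset (List ℕ+)), S = (c :: word F) ::ₘ S' ∧
      (∀ b ∈ S', b ≤ c :: word F) ∧ (∀ f ∈ F, IsLyn f) ∧ ∀ f ∈ F, c :: word F < f := by
  obtain ⟨v, S, rfl, hv⟩ := exists_max_cons h0
  have hvL := hS v (Multiset.mem_cons_self _ _)
  rcases v with _ | ⟨c, u⟩
  · exact absurd rfl hvL.1
  · obtain ⟨F, hF, rfl⟩ := hvL.exists_tail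
    exact ⟨c, F, S, rfl, hv, fun f hf => (hF f hf).1, fun f hf => (hF f hf).2⟩

/-- The largest shuffle of two nonincreasing products of Lyndon words is their merge. -/
theorem le_word_add {S T : Multiset (List ℕ+)} (hS : ∀ v ∈ S, IsLyn v) (hT : ∀ v ∈ T, IsLyn v) :
    ∀ z ∈ sh (word S) (word T), z ≤ word (S + T) := by
  induction hn : (word (S + T)).length using Nat.strong_induction_on generalizing S T with
  | _ n ih =>
    rcases eq_or_ne S 0 with rfl | hS0
    · simp [word_zero, sh_nil_left]
    rcases eq_or_ne T 0 with rfl | hT0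
    · simp [word_zero, sh_nil_right]
    obtain ⟨c, F, S, rfl, hSc, hFL, hF⟩ := exists_head hS hS0
    obtain ⟨d, G, T, rfl, hTd, hGL, hG⟩ := exists_head hT hT0
    intro z hz
    have hS' : ∀ v ∈ S, IsLyn v := fun v hv => hS v (Multiset.mem_cons_of_mem hv)
    have hT' : ∀ v ∈ T, IsLyn v := fun v hv => hT v (Multiset.mem_cons_of_mem hv)
    simp only [length_word_add, length_word_cons, List.length_cons] at hn
    rw [word_head hF hSc, word_head hG hTd, sh_cons, List.mem_append, List.mem_map,
      List.mem_map] at hz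
    -- The first letter comes from the largest factor of S or of T. Induction bounds the rest of the
    -- shuffle, with the tail of that factor refactored into Lyndon words, and `cons_word_le`
    -- restores the letter.
    rcases hz with ⟨y, hy, rfl⟩ | ⟨y, hy, rfl⟩
    · rw [← word_head hG hTd] at hy
      have h1 := ih _ (by simp only [length_word_add, length_word_cons, List.length_cons]; omega)
        (S := F + S) (fun v hv => (Multiset.mem_add.1 hv).elim (hFL v) (hS' v)) hT rfl y hy
      rw [Multiset.cons_add]
      refine le_trans ?_ (cons_word_le (fun g hg => (Multiset.mem_add.1 hg).elim (hS' g) (hT g))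
        hF).1
      rw [← add_assoc]
      exact (append_le_append_iff [c]).2 h1
    · rw [← word_head hF hSc] at hy
      have h1 := ih _ (by simp only [length_word_add, length_word_cons, List.length_cons]; omega)
        (T := G + T) hS (fun v hv => (Multiset.mem_add.1 hv).elim (hGL v) (hT' v)) rfl y hy
      rw [Multiset.add_cons]
      refine le_trans ?_ (cons_word_le (fun g hg => (Multiset.mem_add.1 hg).elim (hS g) (hT' g))
        hG).1
      rw [add_left_comm]
      exact (append_le_append_iff [d]).2 h1

/-- The multiplicity of the largest shuffle. -/
def mult (S T : Multiset (List ℕ+)) : ℕ := (sh (word S) (word T)).count (word (S + T))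

theorem mult_zero_left (T : Multiset (List ℕ+)) : mult 0 T = 1 := by
  simp [mult, word_zero, sh_nil_left]

theorem mult_zero_right (T : Multiset (List ℕ+)) : mult T 0 = 1 := by
  simp [mult, word_zero, sh_nil_right]

/-- The largest shuffles that begin with a given letter. -/
theorem count_map_cons {c : ℕ+} {F U : Multiset (List ℕ+)} (l : List (List ℕ+))
    (hU : ∀ g ∈ U, IsLyn g) (hF : ∀ f ∈ F, c :: word F < f) (hl : ∀ z ∈ l, z ≤ word (F + U)) :
    ((∃ g ∈ U, c :: word F < g) →
      (l.map (c :: ·)).count (word ((c :: word F) ::ₘ U)) = 0) ∧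
    ((∀ g ∈ U, g ≤ c :: word F) →
      (l.map (c :: ·)).count (word ((c :: word F) ::ₘ U)) = l.count (word (F + U))) := by
  constructor
  · intro h
    rw [List.count_eq_zero, List.mem_map]
    rintro ⟨z, hz, h1⟩
    have h2 := (cons_word_le hU hF).2 h
    rw [← h1] at h2
    exact absurd ((append_le_append_iff [c]).2 (hl z hz)) (not_le.2 h2)
  · intro h
    rw [word_head hF h]
    exact List.count_map_of_injective l _ (List.cons_injective) _

theorem mult_head {c d : ℕ+} {F S G T : Multiset (List ℕ+)} (hF : ∀ f ∈ F, c :: word F < f)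
    (hS : ∀ b ∈ S, b ≤ c :: word F) (hG : ∀ f ∈ G, d :: word G < f)
    (hT : ∀ b ∈ T, b ≤ d :: word G) :
    mult ((c :: word F) ::ₘ S) ((d :: word G) ::ₘ T) =
      ((sh (word (F + S)) (word ((d :: word G) ::ₘ T))).map (c :: ·)).count
        (word ((c :: word F) ::ₘ (S + (d :: word G) ::ₘ T))) +
      ((sh (word ((c :: word F) ::ₘ S)) (word (G + T))).map (d :: ·)).count
        (word ((d :: word G) ::ₘ ((c :: word F) ::ₘ S + T))) := by
  have e : (d :: word G) ::ₘ ((c :: word F) ::ₘ S + T) =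
      (c :: word F) ::ₘ (S + (d :: word G) ::ₘ T) := by
    rw [Multiset.cons_add, Multiset.cons_swap, Multiset.add_cons]
  rw [mult, word_head hF hS, word_head hG hT, sh_cons, List.count_append, Multiset.cons_add, e]

theorem mult_branch {c : ℕ+} {F S T : Multiset (List ℕ+)} (hFL : ∀ f ∈ F, IsLyn f)
    (hSL : ∀ f ∈ S, IsLyn f) (hTL : ∀ f ∈ T, IsLyn f) (hF : ∀ f ∈ F, c :: word F < f)
    (hS : ∀ b ∈ S, b ≤ c :: word F) :
    ((∃ g ∈ T, c :: word F < g) → ((sh (word (F + S)) (word T)).map (c :: ·)).count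
      (word ((c :: word F) ::ₘ (S + T))) = 0) ∧
    ((∀ g ∈ T, g ≤ c :: word F) → ((sh (word (F + S)) (word T)).map (c :: ·)).count
      (word ((c :: word F) ::ₘ (S + T))) = mult (F + S) T) := by
  have h := count_map_cons (U := S + T) (sh (word (F + S)) (word T))
    (fun g hg => (Multiset.mem_add.1 hg).elim (hSL g) (hTL g)) hF (by
      rw [← add_assoc]
      exact le_word_add (fun g hg => (Multiset.mem_add.1 hg).elim (hFL g) (hSL g)) hTL)
  refine ⟨fun ⟨g, hg, hlt⟩ => h.1 ⟨g, Multiset.mem_add.2 (Or.inr hg), hlt⟩, fun hT => ?_⟩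
  rw [h.2 fun g hg => (Multiset.mem_add.1 hg).elim (hS g) (hT g), mult, add_assoc]

theorem sh_count_comm : ∀ (u w z : List ℕ+), (sh u w).count z = (sh w u).count z
  | [], w, z => by rw [sh_nil_left, sh_nil_right]
  | a :: u, [], z => by rw [sh_nil_left, sh_nil_right]
  | a :: u, b :: w, z => by
    have h1 : (sh u (b :: w)).Perm (sh (b :: w) u) :=
      List.perm_iff_count.2 fun z => sh_count_comm u (b :: w) z
    have h2 : (sh (a :: u) w).Perm (sh w (a :: u)) :=
      List.perm_iff_count.2 fun z => sh_count_comm (a :: u) w z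
    rw [sh_cons, sh_cons, List.count_append, List.count_append, (h1.map _).count_eq,
      (h2.map _).count_eq, add_comm]
termination_by u w => u.length + w.length

/-- The recursion for the multiplicity of the largest shuffle. -/
theorem mult_cons {c d : ℕ+} {F S G T : Multiset (List ℕ+)} (hFL : ∀ f ∈ F, IsLyn f)
    (hSL : ∀ f ∈ (c :: word F) ::ₘ S, IsLyn f) (hF : ∀ f ∈ F, c :: word F < f)
    (hS : ∀ b ∈ S, b ≤ c :: word F) (hGL : ∀ f ∈ G, IsLyn f)
    (hTL : ∀ f ∈ (d :: word G) ::ₘ T, IsLyn f) (hG : ∀ f ∈ G, d :: word G < f)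
    (hT : ∀ b ∈ T, b ≤ d :: word G) :
    mult ((c :: word F) ::ₘ S) ((d :: word G) ::ₘ T) =
      (if d :: word G ≤ c :: word F then mult (F + S) ((d :: word G) ::ₘ T) else 0) +
      (if c :: word F ≤ d :: word G then mult ((c :: word F) ::ₘ S) (G + T) else 0) := by
  have hSL' : ∀ f ∈ S, IsLyn f := fun f hf => hSL f (Multiset.mem_cons_of_mem hf)
  have hTL' : ∀ f ∈ T, IsLyn f := fun f hf => hTL f (Multiset.mem_cons_of_mem hf)
  have h1 := mult_branch hFL hSL' hTL hF hS
  have h2 := mult_branch hGL hTL' hSL hG hT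
  rw [mult_head hF hS hG hT]
  congr 1
  · split_ifs with h
    · refine h1.2 fun g hg => ?_
      rcases Multiset.mem_cons.1 hg with rfl | hg
      · exact h
      · exact (hT g hg).trans h
    · exact h1.1 ⟨_, Multiset.mem_cons_self _ _, not_le.1 h⟩
  · have hperm : (sh (word ((c :: word F) ::ₘ S)) (word (G + T))).Perm
        (sh (word (G + T)) (word ((c :: word F) ::ₘ S))) :=
      List.perm_iff_count.2 fun z => sh_count_comm _ _ z
    have hm : mult ((c :: word F) ::ₘ S) (G + T) = mult (G + T) ((c :: word F) ::ₘ S) := by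
      rw [mult, mult, sh_count_comm, add_comm (G + T)]
    rw [(hperm.map _).count_eq, add_comm _ T, hm]
    split_ifs with h
    · refine h2.2 fun g hg => ?_
      rcases Multiset.mem_cons.1 hg with rfl | hg
      · exact h
      · exact (hS g hg).trans h
    · exact h2.1 ⟨_, Multiset.mem_cons_self _ _, not_le.1 h⟩

/-- The first letter must come from S. The condition persists, because the Lyndon factors of the
remaining tail are even larger. -/
theorem mult_eq_one {S T : Multiset (List ℕ+)} (hS : ∀ v ∈ S, IsLyn v) (hT : ∀ v ∈ T, IsLyn v)
    (h : ∀ s ∈ S, ∀ t ∈ T, t < s) : mult S T = 1 := by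
  induction hn : (word S).length using Nat.strong_induction_on generalizing S with
  | _ n ih =>
    rcases eq_or_ne S 0 with rfl | hS0
    · exact mult_zero_left T
    rcases eq_or_ne T 0 with rfl | hT0
    · exact mult_zero_right S
    obtain ⟨c, F, S, rfl, hSc, hFL, hF⟩ := exists_head hS hS0
    obtain ⟨d, G, T, rfl, hTd, hGL, hG⟩ := exists_head hT hT0
    have hlt := h _ (Multiset.mem_cons_self _ _) _ (Multiset.mem_cons_self _ _)
    rw [mult_cons hFL hS hF hSc hGL hT hG hTd, if_pos hlt.le, if_neg (not_le.2 hlt), add_zero]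
    refine ih _ ?_ ?_ ?_ rfl
    · simp only [length_word_add, length_word_cons, List.length_cons] at hn ⊢; omega
    · exact fun v hv => (Multiset.mem_add.1 hv).elim (hFL v)
        fun hv => hS v (Multiset.mem_cons_of_mem hv)
    · intro s hs t ht
      rcases Multiset.mem_add.1 hs with hs | hs
      · exact (h _ (Multiset.mem_cons_self _ _) t ht).trans (hF s hs)
      · exact h s (Multiset.mem_cons_of_mem hs) t ht

/-- As long as factors larger than v are left, the first letter must come from them, so G is used up
without any choice. -/
theorem mult_singleton_add {v : List ℕ+} {G T : Multiset (List ℕ+)} (hv : IsLyn v)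
    (hG : ∀ g ∈ G, IsLyn g ∧ v < g) (hT : ∀ t ∈ T, IsLyn t ∧ t ≤ v) :
    mult {v} (G + T) = mult {v} T := by
  induction hn : (word G).length using Nat.strong_induction_on generalizing G with
  | _ n ih =>
    rcases eq_or_ne G 0 with rfl | hG0
    · rw [zero_add]
    obtain ⟨d, D, G, rfl, hGd, hDL, hD⟩ := exists_head (fun g hg => (hG g hg).1) hG0
    obtain ⟨c, F, S, hvS, hSc, hFL, hF⟩ := exists_head (S := {v}) (by simpa using hv) (by simp)
    obtain ⟨rfl, rfl⟩ : v = c :: word F ∧ S = 0 := by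
      have hS : S = 0 := by
        have := congrArg Multiset.card hvS
        simpa using this
      subst hS
      exact ⟨Multiset.singleton_inj.1 hvS, rfl⟩
    have hlt := (hG _ (Multiset.mem_cons_self _ _)).2
    have hGT : ∀ g ∈ G + T, IsLyn g ∧ g ≤ d :: word D := fun g hg => by
      rcases Multiset.mem_add.1 hg with hg | hg
      · exact ⟨(hG g (Multiset.mem_cons_of_mem hg)).1, hGd g hg⟩
      · exact ⟨(hT g hg).1, (hT g hg).2.trans hlt.le⟩
    have hGT' : ∀ g ∈ (d :: word D) ::ₘ (G + T), IsLyn g := fun g hg => by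
      rcases Multiset.mem_cons.1 hg with rfl | hg
      · exact (hG _ (Multiset.mem_cons_self _ _)).1
      · exact (hGT g hg).1
    rw [Multiset.cons_add, hvS, mult_cons hFL (by simpa using hv) hF hSc hDL hGT' hD
      fun g hg => (hGT g hg).2, if_neg (not_le.2 hlt), if_pos hlt.le, zero_add, ← add_assoc, ← hvS]
    refine ih _ ?_ ?_ rfl
    · simp only [length_word_add, length_word_cons, List.length_cons] at hn ⊢; omega
    · intro g hg
      rcases Multiset.mem_add.1 hg with hg | hg
      · exact ⟨hDL g hg, hlt.trans (hD g hg)⟩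
      · exact hG g (Multiset.mem_cons_of_mem hg)

/-- Either copy of v may begin. Starting with the single v leaves one way by `mult_eq_one`; starting
with a copy on the other side leads, by `mult_singleton_add`, to the same problem with one copy
less. -/
theorem mult_replicate {v : List ℕ+} {T : Multiset (List ℕ+)} (hv : IsLyn v)
    (hT : ∀ t ∈ T, IsLyn t ∧ t < v) (m : ℕ) :
    mult {v} (Multiset.replicate m v + T) = m + 1 := by
  have hv1 : ∀ w ∈ ({v} : Multiset (List ℕ+)), IsLyn w := by simpa using hv
  induction m with
  | zero =>
    rw [Multiset.replicate_zero, zero_add]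
    exact mult_eq_one hv1 (fun t ht => (hT t ht).1) (by simpa using fun t ht => (hT t ht).2)
  | succ m ih =>
    have hmT : ∀ m, ∀ t ∈ Multiset.replicate m v + T, IsLyn t ∧ t ≤ v := by
      intro m t ht
      rcases Multiset.mem_add.1 ht with ht | ht
      · rw [Multiset.eq_of_mem_replicate ht]
        exact ⟨hv, le_rfl⟩
      · exact ⟨(hT t ht).1, (hT t ht).2.le⟩
    obtain ⟨c, u⟩ := List.exists_cons_of_ne_nil hv.1
    obtain ⟨u, rfl⟩ := u
    obtain ⟨F, hF, rfl⟩ := hv.exists_tail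
    have hm1 : ∀ t ∈ (c :: word F) ::ₘ (Multiset.replicate m (c :: word F) + T),
        IsLyn t ∧ t ≤ c :: word F := fun t ht => by
      rcases Multiset.mem_cons.1 ht with rfl | ht
      · exact ⟨hv, le_rfl⟩
      · exact hmT m t ht
    rw [Multiset.replicate_succ, Multiset.cons_add, ← Multiset.cons_zero,
      mult_cons (fun f hf => (hF f hf).1) hv1 (fun f hf => (hF f hf).2) (by simp)
        (fun f hf => (hF f hf).1) (fun t ht => (hm1 t ht).1) (fun f hf => (hF f hf).2)
        (fun t ht => (hmT m t ht).2), if_pos le_rfl, if_pos le_rfl, add_zero,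
      mult_eq_one (fun f hf => (hF f hf).1) (fun t ht => (hm1 t ht).1)
        (fun s hs t ht => (hm1 t ht).2.trans_lt (hF s hs).2), Multiset.cons_zero,
      mult_singleton_add hv hF (hmT m), ih, add_comm]

end Shuffle

/-! ## Leading terms -/

section Triangular

/-- A family that is unitriangular with respect to a basis is a basis. -/
theorem unitriangular {ι γ M : Type*} [AddCommGroup M] [LinearOrder γ] (b : Module.Basis ι ℤ M)
    (B : ι → M) (f : ι → γ) (hwf : WellFounded fun i j => f i < f j)
    (h : ∀ i, B i - b i ∈ Submodule.span ℤ (b '' {j | f j < f i})) :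
    LinearIndependent ℤ B ∧ ⊤ ≤ Submodule.span ℤ (Set.range B) := by
  constructor
  · have hrepr : ∀ i j, f i ≤ f j → b.repr (B i) j = b.repr (b i) j := by
      intro i j hij
      have h1 := b.mem_span_image.1 (h i)
      rw [← sub_eq_zero, ← Finsupp.sub_apply, ← map_sub]
      by_contra h2
      have h3 := h1 (Finsupp.mem_support_iff.2 h2)
      exact absurd h3 (not_lt.2 hij)
    rw [linearIndependent_iff]
    intro l hl
    by_contra hne
    obtain ⟨u, hu, hmax⟩ := Finset.exists_max_image l.support f
      (Finsupp.support_nonempty_iff.2 hne)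
    have h1 : ∑ w ∈ l.support, l w * b.repr (B w) u = 0 := by
      have := congrArg (fun x => b.repr x u) hl
      rw [Finsupp.linearCombination_apply, Finsupp.sum] at this
      simpa only [map_sum, map_zsmul, map_zero, Finsupp.finsetSum_apply, Finsupp.smul_apply,
        smul_eq_mul, Finsupp.coe_zero, Pi.zero_apply] using this
    rw [Finset.sum_eq_single u] at h1
    · rw [hrepr u u le_rfl, b.repr_self, Finsupp.single_eq_same, mul_one] at h1
      exact Finsupp.mem_support_iff.1 hu h1
    · intro w hw hwu
      rw [hrepr w u (hmax w hw), b.repr_self, Finsupp.single_eq_of_ne hwu.symm, mul_zero]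
    · intro h; exact absurd hu h
  · have key : ∀ i, b i ∈ Submodule.span ℤ (Set.range B) := fun i => by
      induction i using hwf.induction with
      | _ i ih =>
        have h1 : b i = B i - (B i - b i) := by abel
        rw [h1]
        refine sub_mem (Submodule.subset_span ⟨i, rfl⟩) (Submodule.span_le.2 ?_ (h i))
        rintro _ ⟨j, hj, rfl⟩
        exact ih j hj
    rw [← b.span_eq]
    refine Submodule.span_le.2 ?_
    rintro _ ⟨i, rfl⟩
    exact key i

end Triangular

/-- The length-lexicographic rank of a word. -/
def rank (w : List ℕ+) : ℕ ×ₗ List ℕ+ := toLex (w.length, w)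

theorem rank_lt_rank {a b : List ℕ+} :
    rank a < rank b ↔ a.length < b.length ∨ a.length = b.length ∧ a < b :=
  Prod.Lex.toLex_lt_toLex

theorem rank_wf : WellFounded fun a b : List ℕ+ => rank a < rank b := by
  refine Subrelation.wf (r := List.Shortlex (· < ·)) ?_ (List.Shortlex.wf wellFounded_lt)
  intro a b h
  rw [List.shortlex_def]
  exact rank_lt_rank.1 h

/-- The span of the `L_z`, `z` odd and smaller than `w`. -/
def low (w : List ℕ+) : Submodule ℤ PQSym :=
  Submodule.span ℤ (peakBasis '' {z | rank z.1 < rank w})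

/-- The span of the `L_z`, `z` of length at most `n`. -/
def lengthLE (n : ℕ) : Submodule ℤ PQSym :=
  Submodule.span ℤ (peakL '' {z | z.length ≤ n})

theorem peakL_mem_lengthLE {n : ℕ} {z : List ℕ+} (h : z.length ≤ n) : peakL z ∈ lengthLE n :=
  Submodule.subset_span ⟨z, h, rfl⟩

theorem peakL_mem_low {w z : List ℕ+} (hz : IsOdd z) (h : rank z < rank w) :
    peakL z ∈ low w :=
  Submodule.subset_span ⟨⟨z, hz⟩, h, peakBasis_apply _⟩

theorem lengthLE_le_low {n : ℕ} {w : List ℕ+} (h : n < w.length) : lengthLE n ≤ low w := by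
  refine Submodule.span_le.2 ?_
  rintro _ ⟨z, hz, rfl⟩
  refine Submodule.span_le.2 ?_ (peakL_mem_span z)
  rintro _ ⟨v, ⟨hv, hvz⟩, rfl⟩
  exact peakL_mem_low hv (rank_lt_rank.2 (Or.inl (hvz.trans_lt (lt_of_le_of_lt hz h))))

theorem low_le_lengthLE (w : List ℕ+) : low w ≤ lengthLE w.length := by
  refine Submodule.span_le.2 ?_
  rintro _ ⟨z, hz, rfl⟩
  rw [peakBasis_apply]
  refine peakL_mem_lengthLE ?_
  rcases rank_lt_rank.1 hz with h | h
  · exact h.le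
  · exact h.1.le

/-- The submodule is spanned by part of a ℤ-basis, hence saturated. This permits the division in
Newton's identity. -/
theorem mem_low_of_mul {w : List ℕ+} {n : ℕ} (hn : n ≠ 0) {x : PQSym}
    (h : (n : PQSym) * x ∈ low w) : x ∈ low w := by
  rw [low, Module.Basis.mem_span_image] at h ⊢
  intro j hj
  refine h ?_
  simp only [Finset.mem_coe, Finsupp.mem_support_iff] at hj ⊢
  rw [← nsmul_eq_mul, map_nsmul, Finsupp.smul_apply, nsmul_eq_mul]
  exact mul_ne_zero (by exact_mod_cast hn) hj

theorem peakL_mul_mem_lengthLE {u : List ℕ+} {n : ℕ} {x : PQSym} (hx : x ∈ lengthLE n) :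
    peakL u * x ∈ lengthLE (u.length + n) := by
  have h : lengthLE n ≤ (lengthLE (u.length + n)).comap (LinearMap.mulLeft ℤ (peakL u)) := by
    refine Submodule.span_le.2 ?_
    rintro _ ⟨z, hz, rfl⟩
    change peakL u * peakL z ∈ lengthLE (u.length + n)
    rw [peakL_isQMul.mul]
    obtain ⟨r, hr, hl⟩ := exists_qsh_perm u z
    apply list_sum_mem
    intro y hy
    obtain ⟨v, hv, rfl⟩ := List.mem_map.1 hy
    refine peakL_mem_lengthLE ?_
    have hz' : z.length ≤ n := hz
    rcases List.mem_append.1 (hr.mem_iff.1 hv) with hv | hv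
    · rw [length_of_mem_sh hv]; omega
    · have := hl v hv; omega
  exact h hx

theorem IsOdd.append {u w : List ℕ+} (hu : IsOdd u) (hw : IsOdd w) : IsOdd (u ++ w) :=
  fun a ha => (List.mem_append.1 ha).elim (hu a) (hw a)

theorem IsOdd.of_mem_sh {u w z : List ℕ+} (hu : IsOdd u) (hw : IsOdd w) (hz : z ∈ sh u w) :
    IsOdd z := fun a ha => hu.append hw a ((perm_of_mem_sh u w z hz).mem_iff.1 ha)

theorem sum_peakL_sub_mem_low (t : List ℕ+) (l : List (List ℕ+))
    (hl : ∀ z ∈ l, IsOdd z ∧ z.length = t.length ∧ z ≤ t) :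
    (l.map peakL).sum - (l.count t : PQSym) * peakL t ∈ low t := by
  induction l with
  | nil => simp
  | cons z l ih =>
    have ih := ih fun y hy => hl y (List.mem_cons_of_mem _ hy)
    obtain ⟨h1, h2, h3⟩ := hl z List.mem_cons_self
    rw [List.map_cons, List.sum_cons, List.count_cons]
    rcases h3.eq_or_lt with rfl | h3
    · convert ih using 1
      simp; ring
    · have h4 := add_mem (peakL_mem_low h1 (rank_lt_rank.2 (Or.inr ⟨h2, h3⟩))) ih
      convert h4 using 1
      rw [if_neg (by simpa using h3.ne)]
      push_cast; ring

/-- Multiplication by `L_v` when the largest shuffles are known. -/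
theorem peakL_mul_sub_mem_low {v w : List ℕ+} (hv : IsOdd v) (hw : IsOdd w)
    (hmax : ∀ z ∈ sh v w, z ≤ v ++ w) {x : PQSym} (hx : x - peakL w ∈ low w) :
    peakL v * x - ((sh v w).count (v ++ w) : PQSym) * peakL (v ++ w) ∈ low (v ++ w) := by
  have hr : ∀ z : List ℕ+, z.length ≤ w.length → ∀ y ∈ (((sh v z).map peakL).sum - peakL v * peakL z :
      PQSym) :: [], y ∈ low (v ++ w) := by
    intro z hz y hy
    rw [List.mem_singleton.1 hy]
    obtain ⟨r, hr, hl⟩ := exists_qsh_perm v z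
    rw [peakL_isQMul.mul, (hr.map peakL).sum_eq, List.map_append, List.sum_append, ← sub_sub,
      sub_self, zero_sub]
    apply neg_mem
    apply list_sum_mem
    intro y hy
    obtain ⟨u, hu, rfl⟩ := List.mem_map.1 hy
    refine lengthLE_le_low (n := u.length) ?_ (peakL_mem_lengthLE le_rfl)
    have := hl u hu
    rw [List.length_append]; omega
  -- Shorter words give shorter products. For a smaller word of the same length, each shuffle with v
  -- lies below some shuffle of v and w, and proper quasi-shuffles are shorter.
  have hlow : low w ≤ (low (v ++ w)).comap (LinearMap.mulLeft ℤ (peakL v)) := by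
    refine Submodule.span_le.2 ?_
    rintro _ ⟨z, hz, rfl⟩
    rw [peakBasis_apply]
    change peakL v * peakL z.1 ∈ low (v ++ w)
    rcases rank_lt_rank.1 hz with h | ⟨h1, h2⟩
    · refine lengthLE_le_low (n := v.length + z.1.length) ?_
        (peakL_mul_mem_lengthLE (peakL_mem_lengthLE le_rfl))
      rw [List.length_append]; omega
    · have h3 := hr z.1 h1.le _ (List.mem_singleton_self _)
      have h4 : ((sh v z.1).map peakL).sum ∈ low (v ++ w) := by
        apply list_sum_mem
        intro y hy
        obtain ⟨u, hu, rfl⟩ := List.mem_map.1 hy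
        refine peakL_mem_low (hv.of_mem_sh z.2 hu) (rank_lt_rank.2 (Or.inr ⟨?_, ?_⟩))
        · rw [length_of_mem_sh hu, List.length_append, h1]
        · obtain ⟨z', hz', hlt⟩ := exists_lt_mem_sh v z.1 w h2 h1 u hu
          exact hlt.trans_le (hmax z' hz')
      have h5 := sub_mem h4 h3
      rwa [sub_sub_cancel] at h5
  have h1 : peakL v * (x - peakL w) ∈ low (v ++ w) := hlow hx
  have h2 := hr w le_rfl _ (List.mem_singleton_self _)
  have h3 := sum_peakL_sub_mem_low (v ++ w) (sh v w) fun z hz =>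
    ⟨hv.of_mem_sh hw hz, by rw [length_of_mem_sh hz, List.length_append], hmax z hz⟩
  have h4 := add_mem (sub_mem h1 h2) h3
  convert h4 using 1
  ring

theorem isOdd_word {S : Multiset (List ℕ+)} (h : ∀ v ∈ S, IsOdd v) : IsOdd (word S) :=
  fun a ha => by
    obtain ⟨v, hv, hav⟩ := (word_perm S a).1 ha
    exact h v hv a hav

theorem psiHom_peakL_even {n : ℕ} (hn : Even n) (hn1 : 1 ≤ n) {w : List ℕ+} (hw : w ≠ []) :
    psiHom n (peakL w) = 0 := by
  lift n to ℕ+ using hn1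
  rw [psiHom_peakL, peakL_scale_even hn hw]

/-- The Newton recursion for `λ^n(L_w)`. -/
theorem peakLam_succ (w : List ℕ+) (n : ℕ) :
    ((n : PQSym) + 1) * peakLam (n + 1) (peakL w) =
      ∑ i ∈ Finset.range (n + 1), (-1) ^ i * psiHom (i + 1) (peakL w) *
        peakLam (n - i) (peakL w) :=
  (isNewton_iff.1 (peakLam_newton w)).2 n

theorem peakLam_zero (x : PQSym) : peakLam 0 x = 1 := (peakLam_isLamOf.newton x).zero

theorem length_scale (n : ℕ+) (w : List ℕ+) : (scale n w).length = w.length := by simp [scale]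

/-- The leading term of `λ^j(L_v) x`, when `v` is larger than the factors of the leading term
of `x`. -/
theorem peakLam_mul_sub_mem_low {v : List ℕ+} {T : Multiset (List ℕ+)} (hv : IsLyn v)
    (hvo : IsOdd v) (hT : ∀ t ∈ T, IsLyn t ∧ t < v) (hTo : ∀ t ∈ T, IsOdd t) {x : PQSym}
    (hx : x - peakL (word T) ∈ low (word T)) (j : ℕ) :
    peakLam j (peakL v) * x - peakL (word (Multiset.replicate j v + T)) ∈
      low (word (Multiset.replicate j v + T)) := by
  induction j using Nat.strong_induction_on with
  | _ j ih =>
    rcases j with _ | j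
    · simpa [peakLam_zero] using hx
    have hmT : ∀ m, ∀ t ∈ Multiset.replicate m v + T, IsLyn t ∧ t ≤ v := by
      intro m t ht
      rcases Multiset.mem_add.1 ht with ht | ht
      · rw [Multiset.eq_of_mem_replicate ht]
        exact ⟨hv, le_rfl⟩
      · exact ⟨(hT t ht).1, (hT t ht).2.le⟩
    have hmo : ∀ m, IsOdd (word (Multiset.replicate m v + T)) := fun m => isOdd_word fun t ht => by
      rcases Multiset.mem_add.1 ht with ht | ht
      · rwa [Multiset.eq_of_mem_replicate ht]
      · exact hTo t ht
    have hw : word (Multiset.replicate (j + 1) v + T) =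
        v ++ word (Multiset.replicate j v + T) := by
      rw [Multiset.replicate_succ, Multiset.cons_add, word_cons fun t ht => (hmT j t ht).2]
    have hsing : ({v} : Multiset (List ℕ+)) + (Multiset.replicate j v + T) =
        Multiset.replicate (j + 1) v + T := by
      rw [Multiset.replicate_succ, Multiset.cons_add, Multiset.singleton_add]
    have hmax : ∀ z ∈ sh v (word (Multiset.replicate j v + T)),
        z ≤ v ++ word (Multiset.replicate j v + T) := by
      have := le_word_add (S := {v}) (by simpa using hv) fun t ht => (hmT j t ht).1
      rwa [hsing, word_singleton, hw] at this
    have hcount : (sh v (word (Multiset.replicate j v + T))).count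
        (v ++ word (Multiset.replicate j v + T)) = j + 1 := by
      have := mult_replicate hv hT j
      rwa [mult, hsing, word_singleton, hw] at this
    have h1 := peakL_mul_sub_mem_low hvo (hmo j) hmax (ih j (Nat.lt_succ_self j))
    rw [hcount, ← hw] at h1
    have hlen : ∀ m, (word (Multiset.replicate m v + T)).length =
        m * v.length + (word T).length := by
      intro m; rw [length_word_add, length_word]; simp
    have hvpos := List.length_pos_iff.2 hv.1
    -- In the later terms of Newton's identity, one word of the length of v replaces at least two
    -- copies of v, so these terms are shorter than the leading word.
    have h2 : ∀ i ∈ Finset.range j, (-1) ^ (i + 1) * psiHom (i + 1 + 1) (peakL v) *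
        peakLam (j - (i + 1)) (peakL v) * x ∈ low (word (Multiset.replicate (j + 1) v + T)) := by
      intro i hi
      have hi := Finset.mem_range.1 hi
      have h3 := ih (j - (i + 1)) (by omega)
      set W := word (Multiset.replicate (j - (i + 1)) v + T)
      have h4 : peakLam (j - (i + 1)) (peakL v) * x ∈ lengthLE W.length := by
        have := add_mem (low_le_lengthLE _ h3) (peakL_mem_lengthLE (le_refl W.length))
        rwa [sub_add_cancel] at this
      have h5 : psiHom (i + 1 + 1) (peakL v) = peakL (scale (i + 1).succPNat v) :=
        psiHom_peakL (i + 1).succPNat v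
      have h6 : psiHom (i + 1 + 1) (peakL v) * (peakLam (j - (i + 1)) (peakL v) * x) ∈
          low (word (Multiset.replicate (j + 1) v + T)) := by
        rw [h5]
        refine lengthLE_le_low ?_ (peakL_mul_mem_lengthLE h4)
        rw [length_scale, hlen, hlen]
        have : (j - (i + 1)) + 1 < j + 1 := by omega
        nlinarith
      rw [mul_assoc, mul_assoc]
      rcases neg_one_pow_eq_or PQSym (i + 1) with h7 | h7
      · rwa [h7, one_mul]
      · rw [h7, neg_one_mul]
        exact neg_mem h6
    have h6 := sum_mem h2
    -- The multiplicity j + 1 of the leading shuffle matches the factor j + 1 of Newton's identity,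
    -- so the leading coefficient of λ^{j+1} is 1.
    refine mem_low_of_mul (n := j + 1) (Nat.succ_ne_zero j) ?_
    convert add_mem h1 h6 using 1
    rw [mul_sub, ← mul_assoc]
    push_cast
    rw [peakLam_succ, Finset.sum_range_succ', add_mul, Finset.sum_mul]
    simp only [pow_zero, zero_add, psiHom_one, one_mul, Nat.sub_zero]
    ring

/-! ## Bases of `PQSym` -/

/-- The Lyndon words with odd letters. -/
abbrev LynOdd : Type := {v : List ℕ+ // IsLyn v ∧ IsOdd v}

/-- The multiset of words given by the multiplicities of odd Lyndon words. -/
def factors (k : LynOdd →₀ ℕ) : Multiset (List ℕ+) := (Finsupp.toMultiset k).map Subtype.val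

theorem mem_factors {k : LynOdd →₀ ℕ} {v : List ℕ+} (h : v ∈ factors k) :
    ∃ c ∈ k.support, c.1 = v := by
  obtain ⟨c, hc, rfl⟩ := Multiset.mem_map.1 h
  exact ⟨c, (Finsupp.mem_toMultiset k c).1 hc, rfl⟩

theorem factors_single_add (a : LynOdd) (n : ℕ) (k : LynOdd →₀ ℕ) :
    factors (Finsupp.single a n + k) = Multiset.replicate n a.1 + factors k := by
  rw [factors, map_add, Multiset.map_add, Finsupp.toMultiset_single, Multiset.map_nsmul,
    Multiset.map_singleton, Multiset.nsmul_singleton, factors]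

/-- Products of the `λ^n(L_v)`, `v` an odd Lyndon word. -/
def lynProd (k : LynOdd →₀ ℕ) : PQSym := k.prod fun v n => peakLam n (peakL v.1)

/-- The Lyndon words are taken in increasing order, so that each new one exceeds all factors of the
leading word so far. -/
theorem lynProd_sub_mem_low (k : LynOdd →₀ ℕ) :
    lynProd k - peakL (word (factors k)) ∈ low (word (factors k)) := by
  induction k using Finsupp.induction_on_max with
  | zero => simp [lynProd, factors, word_zero, peakL_isQMul.nil]
  | single_add a n k hk hn ih =>
    have h1 : lynProd (Finsupp.single a n + k) = peakLam n (peakL a.1) * lynProd k := by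
      rw [lynProd, Finsupp.prod_add_index_of_disjoint, Finsupp.prod_single_index, lynProd]
      · exact peakLam_zero _
      · rw [Finset.disjoint_left]
        intro x hx hxk
        have h2 := Finsupp.support_single_subset hx
        rw [Finset.mem_singleton] at h2
        subst h2
        exact lt_irrefl _ (hk x hxk)
    rw [h1, factors_single_add]
    refine peakLam_mul_sub_mem_low a.2.1 a.2.2 (fun t ht => ?_) (fun t ht => ?_) ih n
    · obtain ⟨c, hc, rfl⟩ := mem_factors ht
      exact ⟨c.2.1, hk c hc⟩
    · obtain ⟨c, -, rfl⟩ := mem_factors ht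
      exact c.2.2

/-- The Chen–Fox–Lyndon factorization of odd words. -/
def oddWordEquiv : (LynOdd →₀ ℕ) ≃ OddWord :=
  Equiv.ofBijective (fun k => ⟨word (factors k), isOdd_word fun v hv => by
    obtain ⟨c, -, rfl⟩ := mem_factors hv
    exact c.2.2⟩) <| by
    constructor
    · intro k l h
      have h1 := word_injOn (S := factors k) (T := factors l) (fun v hv => by
        obtain ⟨c, -, rfl⟩ := mem_factors hv
        exact c.2.1) (fun v hv => by
        obtain ⟨c, -, rfl⟩ := mem_factors hv
        exact c.2.1) (congrArg Subtype.val h)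
      have h2 := congrArg Multiset.toFinsupp (Multiset.map_injective Subtype.val_injective h1)
      rwa [Finsupp.toMultiset_toFinsupp, Finsupp.toMultiset_toFinsupp] at h2
    · rintro ⟨w, hw⟩
      obtain ⟨S, hS, rfl⟩ := exists_word_eq w
      have hS' : ∀ v ∈ S, IsLyn v ∧ IsOdd v := fun v hv =>
        ⟨hS v hv, fun a ha => hw a ((word_perm S a).2 ⟨v, hv, ha⟩)⟩
      lift S to Multiset LynOdd using hS'
      refine ⟨S.toFinsupp, Subtype.ext ?_⟩
      change word (factors _) = _
      rw [factors, Multiset.toFinsupp_toMultiset]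

/-- The basis of `PQSym` formed by the products of the `λ^n(L_v)`, `v` an odd Lyndon word. -/
def lynBasis : Module.Basis (LynOdd →₀ ℕ) ℤ PQSym :=
  have h := unitriangular peakBasis (fun w => lynProd (oddWordEquiv.symm w)) (fun w => rank w.1)
    (InvImage.wf Subtype.val rank_wf) fun w => by
      obtain ⟨k, rfl⟩ := oddWordEquiv.surjective w
      rw [Equiv.symm_apply_apply, peakBasis_apply]
      exact lynProd_sub_mem_low k
  (Module.Basis.mk h.1 h.2).reindex oddWordEquiv.symm

theorem lynBasis_apply (k : LynOdd →₀ ℕ) : lynBasis k = lynProd k := by simp [lynBasis]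

/-! ## Elementary words -/

theorem scale_lt_scale (m : ℕ+) : ∀ {a b : List ℕ+}, scale m a < scale m b ↔ a < b
  | [], [] => Iff.rfl
  | [], y :: b => by simp [scale]
  | x :: a, [] => by simp [scale]
  | x :: a, y :: b => by
    rw [scale_cons, scale_cons, List.cons_lt_cons_iff, List.cons_lt_cons_iff, scale_lt_scale m,
      mul_lt_mul_iff_left, mul_right_inj]

theorem isLyn_scale {m : ℕ+} {w : List ℕ+} : IsLyn (scale m w) ↔ IsLyn w := by
  have h : ∀ i, (scale m w).drop i = scale m (w.drop i) := fun i => (List.map_drop).symm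
  simp only [IsLyn, IsLyndon, length_scale, h, scale_lt_scale]
  simp [scale]

theorem isOdd_scale {m : ℕ+} {w : List ℕ+} (hm : Odd (m : ℕ)) (hw : IsOdd w) :
    IsOdd (scale m w) := by
  intro a ha
  obtain ⟨b, hb, rfl⟩ := List.mem_map.1 ha
  rw [PNat.mul_coe]
  exact hm.mul (hw b hb)

theorem odd_of_isOdd_scale {m : ℕ+} {w : List ℕ+} (hw : w ≠ []) (h : IsOdd (scale m w)) :
    Odd (m : ℕ) ∧ IsOdd w := by
  have h1 : ∀ a ∈ w, Odd (m : ℕ) ∧ Odd (a : ℕ) := fun a ha => by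
    have := h (m * a) (List.mem_map_of_mem ha)
    rwa [PNat.mul_coe, Nat.odd_mul] at this
  obtain ⟨a, ha⟩ := List.exists_mem_of_ne_nil w hw
  exact ⟨(h1 a ha).1, fun b hb => (h1 b hb).2⟩

/-- The greatest common divisor of the letters. -/
def gcdWord (w : List ℕ+) : ℕ := (w.map fun a : ℕ+ => (a : ℕ)).foldr Nat.gcd 0

theorem gcdWord_cons (a : ℕ+) (w : List ℕ+) : gcdWord (a :: w) = Nat.gcd a (gcdWord w) := rfl

theorem gcdWord_scale (m : ℕ+) (w : List ℕ+) : gcdWord (scale m w) = m * gcdWord w := by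
  induction w with
  | nil => simp [gcdWord, scale]
  | cons a w ih => rw [scale_cons, gcdWord_cons, gcdWord_cons, ih, PNat.mul_coe, Nat.gcd_mul_left]

theorem gcdWord_pos {w : List ℕ+} (hw : w ≠ []) : 0 < gcdWord w := by
  obtain ⟨a, u, rfl⟩ := List.exists_cons_of_ne_nil hw
  exact Nat.gcd_pos_of_pos_left _ a.pos

theorem gcdWord_dvd {w : List ℕ+} : ∀ a ∈ w, gcdWord w ∣ a := by
  induction w with
  | nil => simp
  | cons b w ih =>
    intro a ha
    rw [gcdWord_cons]
    rcases List.mem_cons.1 ha with rfl | ha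
    · exact Nat.gcd_dvd_left _ _
    · exact (Nat.gcd_dvd_right _ _).trans (ih a ha)

theorem exists_scale_eq {g : ℕ+} : ∀ {w : List ℕ+}, (∀ a ∈ w, (g : ℕ) ∣ a) → ∃ u, scale g u = w
  | [], _ => ⟨[], rfl⟩
  | a :: w, h => by
    obtain ⟨u, rfl⟩ := exists_scale_eq fun b hb => h b (List.mem_cons_of_mem _ hb)
    obtain ⟨c, rfl⟩ := PNat.dvd_iff.2 (h a List.mem_cons_self)
    exact ⟨c :: u, rfl⟩

theorem scale_injective (m : ℕ+) : Function.Injective (scale m) :=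
  List.map_injective_iff.2 fun _ _ h => mul_left_cancel h

/-- The odd positive integers. -/
abbrev OddPos : Type := {m : ℕ+ // Odd (m : ℕ)}

theorem ELodd.ne_nil (u : ELodd) : u.1 ≠ [] := by
  intro h
  have := u.2.2.1
  rw [h] at this
  simp [IsElementary] at this

theorem ELodd.isLyn (u : ELodd) : IsLyn u.1 := ⟨u.ne_nil, u.2.1⟩

/-- Every odd Lyndon word is a multiple of an elementary one. -/
def lynOddEquiv : ELodd × OddPos ≃ LynOdd :=
  Equiv.ofBijective (fun p => ⟨scale p.2.1 p.1.1, isLyn_scale.2 p.1.isLyn,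
    isOdd_scale p.2.2 p.1.2.2.2⟩) <| by
    constructor
    · rintro ⟨u, m⟩ ⟨v, n⟩ h
      have h1 : scale m.1 u.1 = scale n.1 v.1 := congrArg Subtype.val h
      have h2 := congrArg gcdWord h1
      have hu : gcdWord u.1 = 1 := u.2.2.1
      have hv : gcdWord v.1 = 1 := v.2.2.1
      rw [gcdWord_scale, gcdWord_scale, hu, hv, mul_one, mul_one] at h2
      have h3 : m = n := Subtype.ext (PNat.coe_injective h2)
      subst h3
      rw [Subtype.ext (scale_injective _ h1)]
    · rintro ⟨w, hw, ho⟩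
      obtain ⟨u, hu⟩ := exists_scale_eq (g := ⟨gcdWord w, gcdWord_pos hw.1⟩) gcdWord_dvd
      have hu0 : u ≠ [] := by
        rintro rfl
        exact hw.1 hu.symm
      set m : ℕ+ := ⟨gcdWord w, gcdWord_pos hw.1⟩ with hm
      have hgu : gcdWord u = 1 := by
        have h1 := congrArg gcdWord hu
        rw [gcdWord_scale] at h1
        exact Nat.eq_of_mul_eq_mul_left m.pos (by rw [h1, mul_one]; rfl)
      rw [← hu] at hw ho
      obtain ⟨h1, h2⟩ := odd_of_isOdd_scale hu0 ho
      exact ⟨(⟨u, (isLyn_scale.1 hw).2, hgu, h2⟩, ⟨m, h1⟩), Subtype.ext hu⟩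

/-- Products of the `λ^n(L_{m·u})`, `m` odd. -/
def gammaProd (u : List ℕ+) (k : OddPos →₀ ℕ) : PQSym :=
  k.prod fun m n => peakLam n (peakL (scale m.1 u))

theorem gammaProd_zero (u : List ℕ+) : gammaProd u 0 = 1 := Finsupp.prod_zero_index

/-- The basis of `PQSym` adapted to the subrings `Γ_u`. -/
def prodBasis : Module.Basis (ELodd →₀ OddPos →₀ ℕ) ℤ PQSym :=
  lynBasis.reindex ((Finsupp.domCongr lynOddEquiv.symm).toEquiv.trans Finsupp.curryEquiv)

theorem prodBasis_apply (K : ELodd →₀ OddPos →₀ ℕ) :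
    prodBasis K = K.prod fun u k => gammaProd u.1 k := by
  rw [prodBasis, Module.Basis.reindex_apply, lynBasis_apply]
  change (Finsupp.equivMapDomain lynOddEquiv K.uncurry).prod _ = _
  rw [Finsupp.prod_equivMapDomain]
  simp only [Finsupp.prod, Finsupp.uncurry, Finset.prod_disjiUnion, Finset.prod_map, gammaProd]
  rfl

/-! ## The subrings `Γ_u` -/

section Family

theorem gammaProd_linearCombination (u : ELodd) (x : (OddPos →₀ ℕ) →₀ ℤ) :
    prodBasis.repr (Finsupp.linearCombination ℤ (gammaProd u.1) x) =
      x.mapDomain (Finsupp.single u) := by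
  have h : Finsupp.linearCombination ℤ (gammaProd u.1) x =
      Finsupp.linearCombination ℤ prodBasis (x.mapDomain (Finsupp.single u)) := by
    rw [Finsupp.linearCombination_mapDomain]
    congr 2
    funext k
    rw [Function.comp_apply, prodBasis_apply]
    exact (Finsupp.prod_single_index (h := fun (u : ELodd) k => gammaProd u.1 k)
      (gammaProd_zero _)).symm
  rw [h, Module.Basis.repr_linearCombination]

theorem repr_single_linearCombination (u : ELodd) (x : (OddPos →₀ ℕ) →₀ ℤ) (k : OddPos →₀ ℕ) :
    prodBasis.repr (Finsupp.linearCombination ℤ (gammaProd u.1) x) (Finsupp.single u k) = x k := by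
  rw [gammaProd_linearCombination, Finsupp.mapDomain_apply (Finsupp.single_injective u)]

/-- The families of elements of `PQSym` indexed by the elementary odd Lyndon words. -/
abbrev Fam : Type := ELodd → PQSym

/-- The family of the `L_{m·u}`. -/
def famL (m : OddPos) : Fam := fun u => peakL (scale m.1 u.1)

/-- The λ-operations on families. -/
def famLam (n : ℕ) (F : Fam) : Fam := fun u => peakLam n (F u)

/-- The Adams operations on families. -/
def famPsi (n : ℕ) : Fam →+* Fam := RingHom.pi fun u => (psiHom n).comp (Pi.evalRingHom _ u)

theorem famPsi_apply (n : ℕ) (F : Fam) (u : ELodd) : famPsi n F u = psiHom n (F u) := rfl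

theorem famLam_isNewton (F : Fam) : IsNewton (fun n => famLam n F) fun n => famPsi n F := by
  rw [isNewton_iff]
  refine ⟨funext fun u => peakLam_zero _, fun n => funext fun u => ?_⟩
  have := (isNewton_iff.1 (peakLam_isLamOf.newton (F u))).2 n
  simp only [Pi.mul_apply, Pi.add_apply, Pi.natCast_apply, Pi.one_apply, Finset.sum_apply,
    Pi.pow_apply, Pi.neg_apply, famPsi_apply]
  exact this

/-- Neither the alternative nor m' depends on the elementary word u. This uniformity is the reason
why all the Γ_u are isomorphic. -/
theorem famPsi_famL (n : ℕ) (hn : 1 ≤ n) (m : OddPos) :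
    (∃ m', famPsi n (famL m) = famL m') ∨ famPsi n (famL m) = 0 := by
  rcases Nat.even_or_odd n with h | h
  · refine Or.inr (funext fun u => psiHom_peakL_even h hn ?_)
    exact (isLyn_scale.2 u.isLyn).1
  · lift n to ℕ+ using hn
    refine Or.inl ⟨⟨n * m.1, by rw [PNat.mul_coe]; exact h.mul m.2⟩, funext fun u => ?_⟩
    rw [famPsi_apply, famL, psiHom_peakL, scale_scale]; rfl

/-- The family of the basis elements with index `k`. -/
def gammaFam (k : OddPos →₀ ℕ) : Fam := fun u => gammaProd u.1 k

theorem gammaFam_zero : gammaFam 0 = 1 := funext fun u => gammaProd_zero u.1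

theorem gammaFam_single_add (m : OddPos) (n : ℕ) {f : OddPos →₀ ℕ} (hf : f m = 0) :
    gammaFam (Finsupp.single m n + f) = famLam n (famL m) * gammaFam f := by
  funext u
  rw [Pi.mul_apply, gammaFam, gammaProd, Finsupp.prod_add_index_of_disjoint,
    Finsupp.prod_single_index]
  · rfl
  · exact peakLam_zero _
  · rw [Finset.disjoint_left]
    intro x hx hxf
    have h2 := Finsupp.support_single_subset hx
    rw [Finset.mem_singleton] at h2
    subst h2
    exact Finsupp.mem_support_iff.1 hxf hf

/-- The span of the families of basis elements. -/
def famSpan : Submodule ℤ Fam := Submodule.span ℤ (Set.range gammaFam)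

theorem gammaFam_mem (k : OddPos →₀ ℕ) : gammaFam k ∈ famSpan := Submodule.subset_span ⟨k, rfl⟩

theorem linearCombination_gammaFam (x : (OddPos →₀ ℕ) →₀ ℤ) (u : ELodd) :
    Finsupp.linearCombination ℤ gammaFam x u = Finsupp.linearCombination ℤ (gammaProd u.1) x := by
  simp [Finsupp.linearCombination_apply, Finsupp.sum, gammaFam]

/-- The coefficients of nF can be read off in the single component (1), where the products belong to
a ℤ-basis of `PQSym`; they are divisible by n there, and the quotients serve in every component. -/
theorem mem_famSpan_of_mul {n : ℕ} (hn : n ≠ 0) {F : Fam} (h : (n : Fam) * F ∈ famSpan) :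
    F ∈ famSpan := by
  obtain ⟨x, hx⟩ := Finsupp.mem_span_range_iff_exists_finsupp.1 h
  change Finsupp.linearCombination ℤ gammaFam x = _ at hx
  have hdvd : ∀ k, (n : ℤ) ∣ x k := by
    intro k
    have h1 := congrArg (fun y => prodBasis.repr y (Finsupp.single one1 k)) (congrFun hx one1)
    simp only [linearCombination_gammaFam, repr_single_linearCombination] at h1
    rw [h1, Pi.mul_apply, Pi.natCast_apply, ← nsmul_eq_mul, map_nsmul, Finsupp.smul_apply,
      nsmul_eq_mul]
    exact dvd_mul_right _ _
  let y : (OddPos →₀ ℕ) →₀ ℤ := x.mapRange (· / (n : ℤ)) (by simp)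
  have hxy : x = (n : ℤ) • y := by
    ext k
    rw [Finsupp.smul_apply, smul_eq_mul]
    exact (Int.mul_ediv_cancel' (hdvd k)).symm
  refine Finsupp.mem_span_range_iff_exists_finsupp.2 ⟨y, ?_⟩
  change Finsupp.linearCombination ℤ gammaFam y = _
  rw [hxy, map_smul, natCast_zsmul, nsmul_eq_mul] at hx
  funext u
  have h1 := congrFun hx u
  rw [Pi.mul_apply, Pi.mul_apply, Pi.natCast_apply] at h1
  exact mul_left_cancel₀ (Nat.cast_ne_zero.2 hn) h1

/-- Newton's identity is solved for the product of L with λ^n(L). The other terms contain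
ψ_{i+2}(L), which is again such a family or zero, times a product of smaller degree. -/
theorem famL_mul_gammaFam_mem (m : OddPos) (k : OddPos →₀ ℕ) :
    famL m * gammaFam k ∈ famSpan := by
  induction hN : k.degree using Nat.strong_induction_on generalizing m k with
  | _ N ih =>
    obtain ⟨f, n, hf, rfl⟩ : ∃ f n, f m = 0 ∧ k = Finsupp.single m n + f :=
      ⟨k.erase m, k m, Finsupp.erase_same, (Finsupp.single_add_erase m k).symm⟩
    have h1 := (isNewton_iff.1 (famLam_isNewton (famL m))).2 n
    rw [Finset.sum_range_succ'] at h1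
    have h2 := congrArg (· * gammaFam f) h1
    simp only [add_mul (_ : Fam), Finset.sum_mul, pow_zero, one_mul, Nat.sub_zero, zero_add] at h2
    have hψ : famPsi 1 (famL m) = famL m := funext fun u => psiHom_one _
    have h3 : famL m * gammaFam (Finsupp.single m n + f) =
        ((n + 1 : ℕ) : Fam) * gammaFam (Finsupp.single m (n + 1) + f) -
        ∑ i ∈ Finset.range n, (-1) ^ (i + 1) * (famPsi (i + 1 + 1) (famL m) *
          gammaFam (Finsupp.single m (n - (i + 1)) + f)) := by
      simp only [gammaFam_single_add m _ hf]
      rw [eq_sub_iff_add_eq, ← mul_assoc, ← mul_assoc, ← hψ]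
      rw [hψ]
      push_cast
      rw [hψ] at h2
      rw [add_mul, add_mul, one_mul, h2, add_comm]
      congr 1
      exact Finset.sum_congr rfl fun i _ => by ring
    rw [h3, ← nsmul_eq_mul]
    refine sub_mem (nsmul_mem (gammaFam_mem _) _) (sum_mem fun i hi => ?_)
    have hi := Finset.mem_range.1 hi
    have h4 : famPsi (i + 1 + 1) (famL m) * gammaFam (Finsupp.single m (n - (i + 1)) + f) ∈
        famSpan := by
      rcases famPsi_famL (i + 1 + 1) (by omega) m with ⟨m', h⟩ | h
      · rw [h]
        refine ih _ ?_ m' _ rfl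
        rw [← hN]
        simp only [map_add, Finsupp.degree_single]
        omega
      · rw [h, zero_mul]
        exact zero_mem _
    rcases neg_one_pow_eq_or Fam (i + 1) with h7 | h7
    · rwa [h7, one_mul]
    · rw [h7, neg_one_mul]
      exact neg_mem h4

/-- A saturated subring that contains the power sums contains the elementary symmetric
functions. -/
theorem IsNewton.mem {R : Type*} [CommRing R] {A : Subring R}
    (hA : ∀ n : ℕ, n ≠ 0 → ∀ x, (n : R) * x ∈ A → x ∈ A) {l c : ℕ → R} (h : IsNewton l c)
    (hc : ∀ n, 1 ≤ n → c n ∈ A) (n : ℕ) : l n ∈ A := by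
  induction n using Nat.strong_induction_on with
  | _ n ih =>
    rcases n with _ | n
    · rw [h.zero]; exact one_mem A
    · refine hA (n + 1) (Nat.succ_ne_zero n) _ ?_
      push_cast
      rw [(isNewton_iff.1 h).2 n]
      refine sum_mem fun i hi => mul_mem (mul_mem ?_ (hc _ (by omega))) (ih _ (by omega))
      exact pow_mem (neg_mem (one_mem A)) i

/-- The families that multiply `famSpan` into itself. -/
def famIdealizer : Subring Fam where
  carrier := {F | ∀ G ∈ famSpan, F * G ∈ famSpan}
  mul_mem' {F F'} h h' G hG := by rw [mul_assoc]; exact h _ (h' G hG)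
  one_mem' G hG := by rwa [one_mul]
  add_mem' {F F'} h h' G hG := by rw [add_mul]; exact add_mem (h G hG) (h' G hG)
  zero_mem' G _ := by rw [zero_mul]; exact zero_mem _
  neg_mem' {F} h G hG := by rw [neg_mul]; exact neg_mem (h G hG)

theorem famL_mem_famIdealizer (m : OddPos) : famL m ∈ famIdealizer := by
  have h : famSpan ≤ famSpan.comap (LinearMap.mulLeft ℤ (famL m)) := by
    refine Submodule.span_le.2 ?_
    rintro _ ⟨k, rfl⟩
    exact famL_mul_gammaFam_mem m k
  exact fun G hG => h hG

theorem famPsi_famL_mem {A : Subring Fam} (hA : ∀ m, famL m ∈ A) (m : OddPos) (n : ℕ)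
    (hn : 1 ≤ n) : famPsi n (famL m) ∈ A := by
  rcases famPsi_famL n hn m with ⟨m', h⟩ | h
  · rw [h]; exact hA m'
  · rw [h]; exact zero_mem A

theorem gammaFam_mem_of_famLam_mem {A : Subring Fam} (hA : ∀ n m, famLam n (famL m) ∈ A)
    (k : OddPos →₀ ℕ) : gammaFam k ∈ A := by
  have h : gammaFam k = ∏ m ∈ k.support, famLam (k m) (famL m) := by
    funext u
    rw [Finset.prod_apply]; rfl
  rw [h]
  exact prod_mem fun m _ => hA _ m

/-- This makes the span a ring. The multipliers of the span form a saturated subring containing the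
families L, hence by Newton their λ^n, hence all products of these. -/
theorem mem_famIdealizer_iff {F : Fam} : F ∈ famIdealizer ↔ F ∈ famSpan := by
  constructor
  · intro h
    have := h 1 (gammaFam_zero ▸ gammaFam_mem 0)
    rwa [mul_one] at this
  · have h1 : ∀ n m, famLam n (famL m) ∈ famIdealizer := fun n m => by
      refine (famLam_isNewton (famL m)).mem (A := famIdealizer) (fun n hn x hx G hG => ?_)
        (famPsi_famL_mem famL_mem_famIdealizer m) n
      refine mem_famSpan_of_mul hn ?_
      rw [← mul_assoc]
      exact hx G hG
    have h2 : famSpan ≤ AddSubgroup.toIntSubmodule famIdealizer.toAddSubgroup := by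
      refine Submodule.span_le.2 ?_
      rintro _ ⟨k, rfl⟩
      exact gammaFam_mem_of_famLam_mem h1 k
    exact fun h => h2 h

/-- The subring of the families that depend uniformly on the elementary word. -/
def famRing : Subring Fam := famIdealizer

theorem mem_famRing {F : Fam} : F ∈ famRing ↔ F ∈ famSpan := mem_famIdealizer_iff

theorem mem_famRing_of_mul (n : ℕ) (hn : n ≠ 0) (F : Fam) (h : (n : Fam) * F ∈ famRing) :
    F ∈ famRing := mem_famRing.2 (mem_famSpan_of_mul hn (mem_famRing.1 h))

theorem famPsi_mem {n : ℕ} (hn : 1 ≤ n) {F : Fam} (hF : F ∈ famRing) : famPsi n F ∈ famRing := by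
  have h1 : ∀ j m, famLam j (famL m) ∈ famRing.comap (famPsi n) := fun j m => by
    rw [Subring.mem_comap]
    have hN := (famLam_isNewton (famL m)).map (famPsi n)
    refine hN.mem mem_famRing_of_mul (fun i hi => ?_) j
    have h2 : famPsi n (famPsi i (famL m)) = famPsi (n * i) (famL m) :=
      funext fun u => psiHom_psiHom n i _ hn hi
    rw [h2]
    exact famPsi_famL_mem (A := famRing) famL_mem_famIdealizer m _ (Nat.mul_pos hn hi)
  have h2 : famSpan ≤ AddSubgroup.toIntSubmodule (famRing.comap (famPsi n)).toAddSubgroup := by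
    refine Submodule.span_le.2 ?_
    rintro _ ⟨k, rfl⟩
    exact gammaFam_mem_of_famLam_mem h1 k
  exact h2 (mem_famRing.1 hF)

theorem famLam_mem (n : ℕ) {F : Fam} (hF : F ∈ famRing) : famLam n F ∈ famRing :=
  (famLam_isNewton F).mem mem_famRing_of_mul (fun _ hi => famPsi_mem hi hF) n

/-- The coefficients of a family are visible in any one component, by independence of the products
there. -/
theorem eq_zero_of_apply_eq_zero {F : Fam} (hF : F ∈ famRing) {u : ELodd} (h : F u = 0) :
    F = 0 := by
  obtain ⟨x, rfl⟩ := Finsupp.mem_span_range_iff_exists_finsupp.1 (mem_famRing.1 hF)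
  change Finsupp.linearCombination ℤ gammaFam x u = 0 at h
  rw [linearCombination_gammaFam] at h
  have hx : x = 0 := by
    ext k
    rw [← repr_single_linearCombination u x k, h, map_zero]; rfl
  rw [hx, Finsupp.sum_zero_index]

/-- For one inclusion, λ^n(L_{m·u}) = λ^n(ψ_m(L_u)) is an integral polynomial in the λ^i(L_u). For
the other, the generators are the values of the families with m = 1. -/
theorem map_famRing (u : ELodd) :
    famRing.map (Pi.evalRingHom (fun _ => PQSym) u) = GammaAt peakLam u.1 := by
  apply le_antisymm
  · rintro _ ⟨F, hF, rfl⟩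
    have h2 : famSpan ≤ AddSubgroup.toIntSubmodule
        ((GammaAt peakLam u.1).comap (Pi.evalRingHom (fun _ => PQSym) u)).toAddSubgroup := by
      refine Submodule.span_le.2 ?_
      rintro _ ⟨k, rfl⟩
      refine gammaFam_mem_of_famLam_mem
        (A := (GammaAt peakLam u.1).comap (Pi.evalRingHom (fun _ => PQSym) u)) (fun n m => ?_) k
      have := peakLam_isLamOf.lam_psi_mem n m.1 m.1.pos (peakL u.1)
      rw [psiHom_peakL] at this
      exact this
    exact h2 (mem_famRing.1 hF)
  · refine Subring.closure_le.2 ?_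
    rintro _ ⟨n, -, rfl⟩
    refine ⟨famLam n (famL ⟨1, odd_one⟩), famLam_mem n (famL_mem_famIdealizer _), ?_⟩
    change peakLam n (peakL (scale 1 u.1)) = _
    rw [scale_one]; rfl

/-- Evaluation of families is an isomorphism onto `Γ_u`. -/
def famEquiv (u : ELodd) : famRing ≃+* GammaAt peakLam u.1 :=
  RingEquiv.ofBijective (((Pi.evalRingHom (fun _ => PQSym) u).comp famRing.subtype).codRestrict
    (GammaAt peakLam u.1) fun F => map_famRing u ▸ ⟨F.1, F.2, rfl⟩) <| by
    constructor
    · rw [injective_iff_map_eq_zero]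
      intro F hF
      exact Subtype.ext (eq_zero_of_apply_eq_zero F.2 (congrArg Subtype.val hF))
    · rintro ⟨x, hx⟩
      rw [← map_famRing] at hx
      obtain ⟨F, hF, rfl⟩ := hx
      exact ⟨⟨F, hF⟩, rfl⟩

theorem famEquiv_lam {u v : ELodd} {n : ℕ} {x y : GammaAt peakLam u.1}
    (h : (y : PQSym) = peakLam n x) :
    (famEquiv v ((famEquiv u).symm y) : PQSym) = peakLam n (famEquiv v ((famEquiv u).symm x)) := by
  obtain ⟨F, rfl⟩ := (famEquiv u).surjective x
  have hy : y = famEquiv u ⟨famLam n F.1, famLam_mem n F.2⟩ := Subtype.ext h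
  rw [hy, RingEquiv.symm_apply_apply, RingEquiv.symm_apply_apply]
  rfl

theorem famEquiv_qAt (u v : ELodd) {n : ℕ} (hn : 1 ≤ n) :
    (famEquiv v ((famEquiv u).symm ⟨qAt peakLam u.1 n, qAt_mem peakLam u.1 hn⟩) : PQSym) =
      qAt peakLam v.1 n := by
  have h1 : ∀ w : ELodd, famEquiv w ⟨famLam n (famL ⟨1, odd_one⟩),
      famLam_mem n (famL_mem_famIdealizer _)⟩ = ⟨qAt peakLam w.1 n, qAt_mem peakLam w.1 hn⟩ := by
    intro w
    apply Subtype.ext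
    change peakLam n (peakL (scale 1 w.1)) = _
    rw [scale_one]; rfl
  rw [← h1 u, RingEquiv.symm_apply_apply, h1 v]

theorem gammaAt_isLambdaSubring (u : ELodd) :
    IsLambdaSubring peakLam (GammaAt peakLam u.1) := by
  intro n x hx
  rw [← map_famRing] at hx ⊢
  obtain ⟨F, hF, rfl⟩ := hx
  exact ⟨famLam n F, famLam_mem n hF, rfl⟩

theorem mem_gammaAt_iff {u : ELodd} {x : PQSym} : x ∈ GammaAt peakLam u.1 ↔
    x ∈ Submodule.span ℤ (Set.range (gammaProd u.1)) := by
  rw [← map_famRing, Finsupp.mem_span_range_iff_exists_finsupp]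
  constructor
  · rintro ⟨F, hF, rfl⟩
    obtain ⟨x, rfl⟩ := Finsupp.mem_span_range_iff_exists_finsupp.1 (mem_famRing.1 hF)
    exact ⟨x, (linearCombination_gammaFam x u).symm⟩
  · rintro ⟨x, rfl⟩
    exact ⟨Finsupp.linearCombination ℤ gammaFam x, mem_famRing.2
      (Finsupp.mem_span_range_iff_exists_finsupp.2 ⟨x, rfl⟩), linearCombination_gammaFam x u⟩

end Family

/-! ## The ring `Γ` -/

section Gamma

theorem coeff_monomialQ_singleton (a : ℕ+) (b : ℕ →₀ ℕ) (S : Finset ℕ)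
    (hS : ∀ j, b j ≠ 0 → j ∈ S) : MvPowerSeries.coeff b (monomialQ [a]) =
      MvPowerSeries.coeff b (∑ j ∈ S, (MvPowerSeries.X j ^ (a : ℕ) : PS)) := by
  classical
  have h1 : Occ 0 [a] b ↔ ∃ j, b = Finsupp.single j (a : ℕ) := by
    rw [occ_cons]
    simp [occ_nil]
  rw [← monFrom_zero, coeff_monFrom, map_sum]
  simp only [MvPowerSeries.coeff_X_pow]
  by_cases h : ∃ j, b = Finsupp.single j (a : ℕ)
  · rw [if_pos (h1.2 h)]
    obtain ⟨j, rfl⟩ := h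
    rw [Finset.sum_eq_single j, if_pos rfl]
    · intro i _ hij
      rw [if_neg]
      intro h
      exact hij ((Finsupp.single_left_inj a.ne_zero).1 h).symm
    · intro hj
      exact absurd (hS j (by simp)) hj
  · rw [if_neg (fun h2 => h (h1.1 h2)), Finset.sum_eq_zero]
    intro j _
    rw [if_neg fun h2 => h ⟨j, h2⟩]

/-- M_(a) is the infinite power sum, but only variables that occur in d can affect the coefficient
at d. -/
theorem coeff_monomialQ_singleton_mul (a : ℕ+) (f : PS) (d : ℕ →₀ ℕ) :
    MvPowerSeries.coeff d (monomialQ [a] * f) = ∑ j ∈ d.support,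
      if (a : ℕ) ≤ d j then MvPowerSeries.coeff (d - Finsupp.single j (a : ℕ)) f else 0 := by
  classical
  have h1 : MvPowerSeries.coeff d (monomialQ [a] * f) =
      MvPowerSeries.coeff d ((∑ j ∈ d.support, (MvPowerSeries.X j ^ (a : ℕ) : PS)) * f) := by
    rw [MvPowerSeries.coeff_mul, MvPowerSeries.coeff_mul]
    refine Finset.sum_congr rfl fun p hp => ?_
    rw [coeff_monomialQ_singleton a p.1 d.support]
    intro j hj
    have := DFunLike.congr_fun (Finset.HasAntidiagonal.mem_antidiagonal.1 hp) j
    rw [Finsupp.add_apply] at this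
    rw [Finsupp.mem_support_iff]
    omega
  rw [h1, Finset.sum_mul, map_sum]
  refine Finset.sum_congr rfl fun j _ => ?_
  rw [MvPowerSeries.X_pow_eq, MvPowerSeries.coeff_monomial_mul, one_mul]
  refine if_congr ?_ rfl rfl
  rw [Finsupp.single_le_iff]

theorem coeff_complSymm (n : ℕ) (d : ℕ →₀ ℕ) :
    MvPowerSeries.coeff d (complSymm n) = if d.degree = n then 1 else 0 := rfl

open scoped Classical in
theorem coeff_elemSymm (n : ℕ) (d : ℕ →₀ ℕ) :
    MvPowerSeries.coeff d (elemSymm n) = if d.degree = n ∧ ∀ i, d i ≤ 1 then 1 else 0 := rfl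

theorem degree_sub_single {d : ℕ →₀ ℕ} {j i : ℕ} (h : i ≤ d j) :
    (d - Finsupp.single j i).degree + i = d.degree := by
  have h1 : d - Finsupp.single j i + Finsupp.single j i = d :=
    tsub_add_cancel_of_le (Finsupp.single_le_iff.2 h)
  have h2 := congrArg Finsupp.degree h1
  rwa [map_add, Finsupp.degree_single] at h2

theorem le_degree (d : ℕ →₀ ℕ) (j : ℕ) : d j ≤ d.degree := Finsupp.le_degree j d

/-- After the signs cancel, the coefficient at d on the right counts the pairs (j, i) with i + 1 ≤
d_j, and their number is the degree of d. -/
theorem complSymm_isNewton :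
    IsNewton complSymm fun n => (-1) ^ (n + 1) * monomialQ [n.toPNat'] := by
  rw [isNewton_iff]
  constructor
  · ext d
    classical
    rw [coeff_complSymm, MvPowerSeries.coeff_one]
    exact if_congr (Finsupp.degree_eq_zero_iff d) rfl rfl
  · intro n
    ext d
    have hterm : ∀ i ∈ Finset.range (n + 1), MvPowerSeries.coeff d
        ((-1) ^ i * ((-1) ^ (i + 1 + 1) * monomialQ [(i + 1).toPNat']) * complSymm (n - i)) =
        ∑ j ∈ d.support, if d.degree = n + 1 ∧ i + 1 ≤ d j then (1 : ℤ) else 0 := by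
      intro i hi
      have hi := Finset.mem_range.1 hi
      have h1 : ((-1 : PS)) ^ i * (-1) ^ (i + 1 + 1) = 1 := by
        rw [← pow_add]
        exact Even.neg_one_pow ⟨i + 1, by ring⟩
      rw [← mul_assoc, h1, one_mul, coeff_monomialQ_singleton_mul]
      refine Finset.sum_congr rfl fun j _ => ?_
      have h2 : (((i + 1).toPNat' : ℕ+) : ℕ) = i + 1 := rfl
      rw [h2]
      by_cases h3 : i + 1 ≤ d j
      · have := degree_sub_single h3
        rw [if_pos h3, coeff_complSymm]
        refine if_congr ⟨fun h => ⟨by omega, h3⟩, fun h => by omega⟩ rfl rfl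
      · rw [if_neg h3, if_neg fun h => h3 h.2]
    rw [map_sum, Finset.sum_congr rfl hterm, Finset.sum_comm]
    have h4 : ((n : PS) + 1) * complSymm (n + 1) = (n + 1) • complSymm (n + 1) := by
      rw [nsmul_eq_mul]; push_cast; rfl
    rw [h4, map_nsmul, coeff_complSymm]
    by_cases hd : d.degree = n + 1
    · simp only [hd, true_and, if_true]
      have h5 : ∀ j ∈ d.support,
          ∑ i ∈ Finset.range (n + 1), (if i + 1 ≤ d j then (1 : ℤ) else 0) = d j := by
        intro j _
        have h6 := le_degree d j
        rw [← Finset.sum_filter, Finset.sum_const, nsmul_eq_mul, mul_one]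
        have h7 : (Finset.range (n + 1)).filter (fun i => i + 1 ≤ d j) = Finset.range (d j) := by
          ext i
          rw [Finset.mem_filter, Finset.mem_range, Finset.mem_range]
          omega
        rw [h7, Finset.card_range]
      rw [Finset.sum_congr rfl h5, nsmul_eq_mul, mul_one, ← hd]
      rw [Finsupp.degree_apply]; push_cast; rfl
    · simp [hd]

theorem elemSymm_isNewton : IsNewton elemSymm fun n => monomialQ [n.toPNat'] := by
  classical
  rw [isNewton_iff]
  constructor
  · ext d
    rw [coeff_elemSymm, MvPowerSeries.coeff_one]
    refine if_congr ?_ rfl rfl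
    constructor
    · exact fun h => (Finsupp.degree_eq_zero_iff d).1 h.1
    · rintro rfl; simp
  · intro n
    ext d
    have hterm : ∀ i ∈ Finset.range (n + 1), MvPowerSeries.coeff d
        ((-1) ^ i * monomialQ [(i + 1).toPNat'] * elemSymm (n - i)) =
        ∑ j ∈ d.support, if d.degree = n + 1 then (-1 : ℤ) ^ i * (if i + 1 ≤ d j ∧
          ∀ l, (d - Finsupp.single j (i + 1)) l ≤ 1 then 1 else 0) else 0 := by
      intro i hi
      have hi := Finset.mem_range.1 hi
      have h0 : (-1 : PS) ^ i * monomialQ [(i + 1).toPNat'] * elemSymm (n - i) =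
          ((-1 : ℤ) ^ i) • (monomialQ [(i + 1).toPNat'] * elemSymm (n - i)) := by
        rw [zsmul_eq_mul, mul_assoc]; push_cast; rfl
      rw [h0, map_zsmul, coeff_monomialQ_singleton_mul, smul_eq_mul, Finset.mul_sum]
      refine Finset.sum_congr rfl fun j _ => ?_
      have h2 : (((i + 1).toPNat' : ℕ+) : ℕ) = i + 1 := rfl
      rw [h2]
      by_cases h3 : i + 1 ≤ d j
      · have := degree_sub_single h3
        rw [if_pos h3, coeff_elemSymm]
        by_cases hd : d.degree = n + 1
        · rw [if_pos hd]
          congr 1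
          exact if_congr ⟨fun h => ⟨h3, h.2⟩, fun h => ⟨by omega, h.2⟩⟩ rfl rfl
        · rw [if_neg hd, if_neg, mul_zero]
          rintro ⟨h, -⟩
          omega
      · rw [if_neg h3, if_neg (c := i + 1 ≤ d j ∧ _) fun h => h3 h.1]
        simp
    rw [map_sum, Finset.sum_congr rfl hterm, Finset.sum_comm]
    have h4 : ((n : PS) + 1) * elemSymm (n + 1) = (n + 1) • elemSymm (n + 1) := by
      rw [nsmul_eq_mul]; push_cast; rfl
    rw [h4, map_nsmul, coeff_elemSymm]
    by_cases hd : d.degree = n + 1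
    · simp only [hd, true_and, if_true]
      -- Removing i + 1 from d_j leaves exponent 0 or 1 at j only for i + 1 = d_j or d_j - 1. If d_j
      -- ≥ 2, both occur and their signs cancel; if d_j = 1, only i = 0 remains.
      have h5 : ∀ j ∈ d.support, ∑ i ∈ Finset.range (n + 1), ((-1 : ℤ) ^ i * if i + 1 ≤ d j ∧
          ∀ l, (d - Finsupp.single j (i + 1)) l ≤ 1 then 1 else 0) =
          if ∀ i, d i ≤ 1 then 1 else 0 := by
        intro j hj
        have h6 := le_degree d j
        rw [Finsupp.mem_support_iff] at hj
        have h7 : ∀ i, (∀ l, (d - Finsupp.single j (i + 1)) l ≤ 1) ↔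
            d j ≤ i + 2 ∧ ∀ l, l ≠ j → d l ≤ 1 := by
          intro i
          constructor
          · refine fun h => ⟨?_, fun l hl => ?_⟩
            · have := h j
              simp at this; omega
            · have := h l
              simpa [Finsupp.single_eq_of_ne hl] using this
          · rintro ⟨h1, h2⟩ l
            rcases eq_or_ne l j with rfl | hl
            · simp; omega
            · simpa [Finsupp.single_eq_of_ne hl] using h2 l hl
        simp only [h7]
        by_cases ho : ∀ l, l ≠ j → d l ≤ 1
        · obtain ⟨m, hm⟩ : ∃ m, d j = m + 1 := ⟨d j - 1, by omega⟩
          rcases m with _ | m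
          · rw [if_pos fun l => if hl : l = j then by rw [hl]; omega else ho l hl,
              Finset.sum_eq_single 0]
            · rw [if_pos ⟨by omega, by omega, ho⟩]; simp
            · intro i _ hi
              rw [if_neg (by omega), mul_zero]
            · simp
          · rw [if_neg fun h => by have := h j; omega,
              ← Finset.sum_subset (s₁ := {m, m + 1})]
            · rw [Finset.sum_pair (by omega), if_pos ⟨by omega, by omega, ho⟩,
                if_pos ⟨by omega, by omega, ho⟩]
              ring
            · intro i hi
              simp at hi ⊢; omega
            · intro i _ hi
              simp at hi
              rw [if_neg (by omega), mul_zero]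
        · rw [if_neg fun h => ho fun l _ => h l, Finset.sum_eq_zero]
          intro i _
          rw [if_neg fun h => ho h.2.2, mul_zero]
      rw [Finset.sum_congr rfl h5, Finset.sum_const]
      by_cases hsq : ∀ i, d i ≤ 1
      · rw [if_pos hsq, ← hd, Finsupp.degree_apply, Finset.card_eq_sum_ones]
        congr 1
        refine Finset.sum_congr rfl fun j hj => ?_
        have := hsq j
        rw [Finsupp.mem_support_iff] at hj
        omega
      · simp [hsq]
    · simp [hd]

theorem coe_peakL_singleton {a : ℕ+} (ha : Odd (a : ℕ)) :
    (peakL [a] : PS) = 2 * monomialQ [a] := by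
  rw [coe_peakL, peakT, peakCoeff, peakCoeff, if_pos ha, consL_single]
  simp [incL, monLin, ofNat_smul_eq_nsmul]

instance : CharZero PS := by
  refine ⟨fun m n h => ?_⟩
  simpa using congrArg (MvPowerSeries.constantCoeff (σ := ℕ) (R := ℤ)) h

/-- The power sums of the q_n are those of the h_n plus those of the e_n: twice the power sum for n
odd, zero for n even. These are the values of ψ_n at L_(1). -/
theorem coe_peakLam_singleton_one (n : ℕ) : (peakLam n (peakL [1]) : PS) = schurq n := by
  have h1 : IsNewton (fun n => (peakLam n (peakL [1]) : PS)) fun n =>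
      (psiHom n (peakL [1]) : PS) := (peakLam_newton [1]).map PQSym.subtype
  have h2 := complSymm_isNewton.mul elemSymm_isNewton
  refine congrFun (h1.unique (h2.congr fun n hn => ?_)) n
  lift n to ℕ+ using hn
  rw [psiHom_peakL, PNat.coe_toPNat']
  rcases Nat.even_or_odd (n : ℕ) with h | h
  · rw [peakL_scale_even h (by simp), pow_succ, h.neg_one_pow]
    simp
  · rw [scale_cons, scale_nil, mul_one, coe_peakL_singleton h, pow_succ, h.neg_one_pow]
    ring

theorem gamma_le : Gamma ≤ PQSym := by
  refine Subring.closure_le.2 ?_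
  rintro _ ⟨n, -, rfl⟩
  rw [← coe_peakLam_singleton_one]
  exact Subtype.property _

theorem gammaAt_one : GammaAt peakLam one1.1 = GammaP := by
  apply le_antisymm
  · refine Subring.closure_le.2 ?_
    rintro _ ⟨n, hn, rfl⟩
    exact Subring.subset_closure ⟨n, hn, coe_peakLam_singleton_one n⟩
  · have h : Gamma ≤ (GammaAt peakLam one1.1).map PQSym.subtype := by
      refine Subring.closure_le.2 ?_
      rintro _ ⟨n, hn, rfl⟩
      exact ⟨_, qAt_mem peakLam one1.1 hn, coe_peakLam_singleton_one n⟩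
    intro x hx
    obtain ⟨y, hy, hyx⟩ := h hx
    exact Subtype.ext hyx ▸ hy

end Gamma

/-! ## The tensor product decomposition -/

section Decomposition

theorem infinite_ELodd : Infinite ELodd := by
  refine Infinite.of_injective (fun n : ℕ => (⟨[1, (2 * n + 2).succPNat], ?_, ?_, ?_⟩ : ELodd)) ?_
  · intro i h0 h1
    have hi : i = 1 := by
      simp only [List.length_cons, List.length_nil] at h1
      omega
    subst hi
    refine List.cons_lt_cons_iff.2 (Or.inl ?_)
    rw [← PNat.coe_lt_coe, PNat.one_coe, Nat.succPNat_coe]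
    omega
  · simp [IsElementary]
  · intro a ha
    rcases List.mem_cons.1 ha with rfl | ha
    · exact odd_one
    · rw [List.mem_singleton.1 ha]
      exact ⟨n + 1, by rw [Nat.succPNat_coe]; omega⟩
  · intro m n h
    have h1 := congrArg Subtype.val h
    simp only [List.cons.injEq, true_and, and_true] at h1
    have := Nat.succPNat_injective h1
    omega

theorem gammaProd_mem (u : ELodd) (k : OddPos →₀ ℕ) : gammaProd u.1 k ∈ GammaAt peakLam u.1 :=
  mem_gammaAt_iff.2 (Submodule.subset_span ⟨k, rfl⟩)

/-- The inclusion of `Γ_u` into `PQSym`, as a linear map. -/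
def gammaIncl (u : ELodd) : GammaAt peakLam u.1 →ₗ[ℤ] PQSym :=
  (GammaAt peakLam u.1).subtype.toAddMonoidHom.toIntLinearMap

theorem gammaIncl_apply (u : ELodd) (x : GammaAt peakLam u.1) : gammaIncl u x = x := rfl

theorem gammaIncl_injective (u : ELodd) : Function.Injective (gammaIncl u) :=
  Subtype.val_injective

theorem gammaProd_linearIndependent (u : ELodd) : LinearIndependent ℤ (gammaProd u.1) := by
  rw [linearIndependent_iff]
  intro x hx
  ext k
  rw [← repr_single_linearCombination u x k, hx, map_zero]; rfl

/-- The basis of `Γ_u`. -/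
def gammaBasis (u : ELodd) : Module.Basis (OddPos →₀ ℕ) ℤ (GammaAt peakLam u.1) :=
  Module.Basis.mk (v := fun k => ⟨gammaProd u.1 k, gammaProd_mem u k⟩)
    (LinearIndependent.of_comp (gammaIncl u) (gammaProd_linearIndependent u)) <| by
    rintro ⟨x, hx⟩ -
    obtain ⟨y, hy⟩ := Finsupp.mem_span_range_iff_exists_finsupp.1 (mem_gammaAt_iff.1 hx)
    refine Finsupp.mem_span_range_iff_exists_finsupp.2 ⟨y, gammaIncl_injective u ?_⟩
    rw [← Finsupp.linearCombination_apply, ← LinearMap.comp_apply,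
      ← Finsupp.linearCombination_linear_comp]
    exact hy

theorem coe_gammaBasis (u : ELodd) (k : OddPos →₀ ℕ) :
    (gammaBasis u k : PQSym) = gammaProd u.1 k := by simp [gammaBasis]

/-- The rings `Γ_u`. -/
abbrev GammaRing (u : ELodd) : Type := GammaAt peakLam u.1

/-- Multiplication on a finite tensor product of the rings `Γ_u`. -/
def mulHom (s : Finset ELodd) : FinTensor GammaRing s →ₐ[ℤ] PQSym :=
  PiTensorProduct.liftAlgHom
    ((MultilinearMap.mkPiAlgebra ℤ s PQSym).compLinearMap fun i => gammaIncl i.1)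
    (by simp [gammaIncl_apply])
    (by
      intro x y
      simp [gammaIncl_apply, Finset.prod_mul_distrib])

theorem mulHom_tprod (s : Finset ELodd) (a : ∀ u : s, GammaRing u.1) :
    mulHom s (PiTensorProduct.tprod ℤ a) = ∏ u, (a u : PQSym) := by
  simp [mulHom, PiTensorProduct.liftAlgHom, gammaIncl_apply]

theorem mulHom_single (t : Finset ELodd) [DecidableEq t] (j : t) (a : GammaRing j.1) :
    mulHom t (PiTensorProduct.singleAlgHom (R := ℤ) (A := fun j : t => GammaRing j.1) j a) = a := by
  rw [PiTensorProduct.singleAlgHom_apply, mulHom_tprod, Finset.prod_eq_single j]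
  · simp
  · intro i _ hi
    simp [Pi.mulSingle_eq_of_ne hi]
  · simp

theorem mulHom_finTensorMap {s t : Finset ELodd} (h : s ≤ t) (x : FinTensor GammaRing s) :
    mulHom t (finTensorMap GammaRing h x) = mulHom s x := by
  induction x using PiTensorProduct.induction_on with
  | smul_tprod r a =>
    rw [map_zsmul, map_zsmul, map_zsmul]
    congr 1
    rw [mulHom_tprod]
    change mulHom t (PiTensorProduct.lift _ (PiTensorProduct.tprod ℤ a)) = _
    rw [PiTensorProduct.lift.tprod, MultilinearMap.compLinearMap_apply,
      MultilinearMap.mkPiAlgebra_apply, map_prod]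
    exact Finset.prod_congr rfl fun i _ =>
      @mulHom_single t (@Subtype.instDecidableEq _ _ (Classical.decEq _)) ⟨i.1, h i.2⟩ (a i)
  | add x y hx hy => simp only [map_add, hx, hy]

theorem prodBasis_single_add {u : ELodd} (k : OddPos →₀ ℕ) {K : ELodd →₀ OddPos →₀ ℕ}
    (hK : K u = 0) : prodBasis (Finsupp.single u k + K) = gammaProd u.1 k * prodBasis K := by
  rw [prodBasis_apply, prodBasis_apply, Finsupp.prod_add_index_of_disjoint,
    Finsupp.prod_single_index]
  · exact gammaProd_zero _
  · rw [Finset.disjoint_left]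
    intro x hx hxK
    have h2 := Finsupp.support_single_subset hx
    rw [Finset.mem_singleton] at h2
    subst h2
    exact Finsupp.mem_support_iff.1 hxK hK

/-- The tensor products of basis elements of the Γ_u go to distinct elements of `prodBasis`, with
indices extended by zero outside s. -/
theorem mulHom_injective (s : Finset ELodd) : Function.Injective (mulHom s) := by
  let b := Basis.piTensorProduct fun u : s => gammaBasis u.1
  let e : (s → OddPos →₀ ℕ) → (ELodd →₀ OddPos →₀ ℕ) := fun p =>
    Finsupp.embDomain (Function.Embedding.subtype _) (Finsupp.equivFunOnFinite.symm p)
  have he : Function.Injective e :=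
    (Finsupp.embDomain_injective _).comp Finsupp.equivFunOnFinite.symm.injective
  have hb : (fun p => mulHom s (b p)) = prodBasis ∘ e := by
    funext p
    rw [Function.comp_apply, prodBasis_apply, Finsupp.prod_embDomain, Finsupp.prod_fintype]
    · simp only [b]
      rw [Basis.piTensorProduct_apply, mulHom_tprod]
      simp only [coe_gammaBasis]
      rfl
    · exact fun u => gammaProd_zero _
  have hli : LinearIndependent ℤ fun p => mulHom s (b p) := by
    rw [hb]
    exact prodBasis.linearIndependent.comp e he
  rw [injective_iff_map_eq_zero]
  intro x hx
  have h1 : Finsupp.linearCombination ℤ (fun p => mulHom s (b p)) (b.repr x) = 0 := by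
    rw [← hx]
    conv_rhs => rw [← b.linearCombination_repr x]
    rw [← AlgHom.toLinearMap_apply, ← LinearMap.comp_apply,
      ← Finsupp.linearCombination_linear_comp]
    rfl
  have h2 := linearIndependent_iff.1 hli _ h1
  exact b.repr.map_eq_zero_iff.1 h2

/-- Multiplication on the infinite tensor product of the rings `Γ_u`. -/
def mulInf : InfTensor GammaRing →+* PQSym :=
  Ring.DirectLimit.lift _ _ _ (fun s => (mulHom s).toRingHom) fun _ _ h x =>
    mulHom_finTensorMap h x

theorem mulInf_pureTensor (s : Finset ELodd) (a : ∀ u : s, GammaRing u.1) :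
    mulInf (pureTensor GammaRing s a) = ∏ u, (a u : PQSym) := by
  rw [mulInf, pureTensor, Ring.DirectLimit.lift_of]
  exact mulHom_tprod s a

theorem mulInf_injective : Function.Injective mulInf :=
  Ring.DirectLimit.lift_injective (injective := fun s => mulHom_injective s) ..

/-- Each element of `prodBasis` is the image of a pure tensor over the support of its index. -/
theorem mulInf_surjective : Function.Surjective mulInf := by
  have h : Submodule.span ℤ (Set.range prodBasis) ≤
      AddSubgroup.toIntSubmodule mulInf.range.toAddSubgroup := by
    refine Submodule.span_le.2 ?_
    rintro _ ⟨K, rfl⟩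
    refine ⟨pureTensor GammaRing K.support fun u => ⟨gammaProd u.1.1 (K u), gammaProd_mem _ _⟩, ?_⟩
    rw [mulInf_pureTensor, prodBasis_apply, Finsupp.prod]
    exact Finset.prod_coe_sort K.support fun u => gammaProd u.1 (K u)
  rw [prodBasis.span_eq] at h
  exact fun x => h (Submodule.mem_top (x := x))

/-- Splitting off the component of an index. -/
def splitEquiv (u : ELodd) : (Σ _ : {K : ELodd →₀ OddPos →₀ ℕ // K u = 0}, OddPos →₀ ℕ) ≃
    (ELodd →₀ OddPos →₀ ℕ) where
  toFun p := Finsupp.single u p.2 + p.1.1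
  invFun K := ⟨⟨K.erase u, Finsupp.erase_same⟩, K u⟩
  left_inv := by
    rintro ⟨⟨K, hK⟩, k⟩
    have h1 : (Finsupp.single u k + K).erase u = K := by
      rw [Finsupp.erase_add, Finsupp.erase_single, zero_add, Finsupp.erase_of_notMem_support]
      simpa using hK
    have h2 : (Finsupp.single u k + K) u = k := by simp [hK]
    simp only [h1, h2]
  right_inv K := Finsupp.single_add_erase u K

/-- `PQSym` is free over each of the rings `Γ_u`. -/
theorem free_gammaAt (u : ELodd) : Module.Free (GammaAt peakLam u.1) PQSym := by
  let f : ({K : ELodd →₀ OddPos →₀ ℕ // K u = 0} →₀ GammaAt peakLam u.1) →ₗ[GammaAt peakLam u.1]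
      PQSym := Finsupp.linearCombination _ fun K => prodBasis K.1
  let b := Finsupp.basis fun _ : {K : ELodd →₀ OddPos →₀ ℕ // K u = 0} => gammaBasis u
  -- The elements of `prodBasis` without a factor from Γ_u are a basis over Γ_u: on ℤ-bases, f is
  -- just the reindexing that splits off the component at u.
  have hf : f.toAddMonoidHom.toIntLinearMap =
      (b.equiv prodBasis (splitEquiv u)).toLinearMap := by
    refine b.ext fun p => ?_
    rw [LinearEquiv.coe_coe, Module.Basis.equiv_apply]
    change f (b p) = prodBasis (Finsupp.single u p.2 + p.1.1)
    rw [prodBasis_single_add _ p.1.2, ← coe_gammaBasis]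
    simp only [b, f, Finsupp.coe_basis]
    rw [Finsupp.linearCombination_single]
    rfl
  have hbij : Function.Bijective f := by
    have h1 : ⇑f = b.equiv prodBasis (splitEquiv u) :=
      funext fun x => congrArg (fun g => g x) hf
    rw [h1]
    exact LinearEquiv.bijective _
  exact Module.Free.of_equiv (LinearEquiv.ofBijective f hbij)

end Decomposition

end PeakQSym

end

open PeakQSym in
theorem corollary3p9 :
    ∃ lam : ℕ → PQSym → PQSym,
      -- the λ-ring structure of `PQSym`, and its uniqueness
      (IsPeakLambda lam ∧ ∀ lam', IsPeakLambda lam' → lam' = lam) ∧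
      -- `Γ` is a λ-subring of `PQSym`
      (Gamma ≤ PQSym ∧ IsLambdaSubring lam GammaP) ∧
      -- each `Γ_α` is a λ-subring, isomorphic to `Γ` as a λ-ring by `q_n(α) ↦ q_n`
      (∀ α : ELodd, IsLambdaSubring lam (GammaAt lam α.1) ∧
        ∃ e : GammaAt lam α.1 ≃+* GammaP,
          (∀ n (hn : 1 ≤ n), ((e ⟨qAt lam α.1 n, qAt_mem lam α.1 hn⟩ : PQSym) : PS) = schurq n) ∧
          ∀ n (x y : GammaAt lam α.1), (y : PQSym) = lam n x → (e y : PQSym) = lam n (e x)) ∧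
      -- `PQSym` is the tensor product of the infinitely many `Γ_α`, by multiplication
      (Infinite ELodd ∧
        ∃ Φ : InfTensor (fun α : ELodd => GammaAt lam α.1) ≃+* PQSym,
          ∀ (s : Finset ELodd) (a : ∀ α : s, GammaAt lam α.1.1),
            Φ (pureTensor (fun α : ELodd => GammaAt lam α.1) s a) = ∏ α, (a α : PQSym)) ∧
      -- `Γ = Γ_{(1)}`, with `q_n((1)) = q_n`, and `PQSym` is free over `Γ`
      ((∀ n, 1 ≤ n → (qAt lam one1.1 n : PS) = schurq n) ∧ GammaAt lam one1.1 = GammaP ∧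
        Module.Free GammaP PQSym) := by
  refine ⟨peakLam, ⟨peakLam_isPeakLambda, fun lam' h => h.eq_peakLam⟩, ⟨gamma_le, ?_⟩,
    fun u => ⟨gammaAt_isLambdaSubring u, ?_⟩, ⟨infinite_ELodd,
      RingEquiv.ofBijective mulInf ⟨mulInf_injective, mulInf_surjective⟩, mulInf_pureTensor⟩,
    fun n _ => coe_peakLam_singleton_one n, gammaAt_one, ?_⟩
  · rw [← gammaAt_one]
    exact gammaAt_isLambdaSubring one1
  · rw [← gammaAt_one]
    -- An element of Γ_u is lifted to its unique family and evaluated at (1); the operations on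
    -- families are componentwise, so they are respected.
    refine ⟨(famEquiv u).symm.trans (famEquiv one1), fun n hn => ?_, fun n x y h => famEquiv_lam h⟩
    rw [← coe_peakLam_singleton_one]
    exact congrArg Subtype.val (famEquiv_qAt u one1 hn)
  · rw [← gammaAt_one]
    exact free_gammaAt one1
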